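/- **Setting.** For real $p$ let $h_p$ be the space of complex sequences $z=(z_j)_{j\in\bar{\mathbb Z}}$, $\bar{\mathbb Z}=\mathbb Z\setminus\{0\}$, with $\|z\|_p^2=\sum_j|z_j|^2|j|^{2p}<\infty$; its real points are those with $z_{-j}=\bar z_j$ for all $j$. The symplectic form is $-i\sum_{j\ge1}dz_j\wedge dz_{-j}$, the Hamiltonian vector field of $A$ is $(X_A)_j=-i\,\mathrm{sgn}(j)\,\partial A/\partial z_{-j}$, the Poisson bracket is $\{A,B\}=dA(X_B)$, and $X_A^t$ is the flow of $X_A$. Put $\lambda_j=\frac{j}{1+j^2}$, $\delta_j=\sqrt{|j|/(1+j^2)}$, and let $$H=\Lambda+G,\qquad \Lambda=\sum_{j\ge1}\lambda_jz_jz_{-j},\qquad G=\frac1{120\pi^2}\sum_{j_1+\cdots+j_6=0}\delta_{j_1}\cdots\delta_{j_6}\,z_{j_1}\cdots z_{j_6}$$ be the Hamiltonian of the generalized Benjamin–Bona–Mahony equation $u_t-u_{xxt}+u_x+u^4u_x=0$ with $2\pi$-periodic boundary condition. For positive integers $n_1,n_2$ let $S=\{\pm n_1,\pm n_2\}$ and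 let $\hat z$ consist of the components $z_j$ with $j\notin S$. Write $|z_n|^2$ for $z_nz_{-n}$ (the two agree at real points). A tuple $(j_1,\dots,j_{2k})$ is called *paired* if it is a permutation of some $(a_1,-a_1,\dots,a_k,-a_k)$. Split $G=\bar G+\tilde G+\hat G$ into its terms with at most two indices outside $S$ that are paired, those with at most two indices outside $S$ that are not paired, and those with at least three indices outside $S$. For a polynomial $P=\sum c_{j_1\cdots j_m}z_{j_1}\cdots z_{j_m}$ let $\mathcal L P=\sum \frac{i\,c_{j_1\cdots j_m}}{\lambda_{j_1}+\cdots+\lambda_{j_m}}z_{j_1}\cdots z_{j_m}$ (terms with zero divisor omitted), and let $F=\mathcal L\tilde G$. All polynomials below have coefficients that vanish unless $j_1+\cdots+j_m=0$ and are bounded by a constant times $\delta_{j_1}\cdots\delta_{j_m}$. **Proposition.** Let $1\ll n_1\ll n_2$, that is, let $n_1$ be sufficiently large and $n_2$ sufficiently large depending on $n_1$. Then there are real numbers $R_0,\dots,R_5$ and $T_0,\dots,T_7$ depending only on $n_1,n_2$, homogeneous polynomials $\tilde R,\hat R$ of degree $10$ and homogeneous polynomials $\tilde T,\hat T$ of degree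 $14$ such that, with $$\bar R=\sum_{k=0}^5R_k|z_{n_1}|^{10-2k}|z_{n_2}|^{2k},\qquad \bar T=\sum_{k=0}^7T_k|z_{n_1}|^{14-2k}|z_{n_2}|^{2k},$$ $$F'=\mathcal L\tilde R,\qquad F''=\mathcal L\tilde T,\qquad \mathcal T=\bigl\{\{\tfrac12(\bar G+\hat G)+\tfrac13\tilde G,F\},F\bigr\},$$ the following holds. The terms of $\tilde R$ have at most one index outside $S$ and are not paired; those of $\hat R$ have at least two indices outside $S$; those of $\tilde T$ have all indices in $S$ and are not paired; those of $\hat T$ have at least one index outside $S$. For every $p>0$, with $q=p+1$, $$\{\bar G+\hat G+\tfrac12\tilde G,F\}=\bar R+\tilde R+\hat R,\qquad \mathcal T+\{\bar G+\hat G,F'\}=\bar T+\tilde T+\hat T\qquad\text{on } h_p .$$ The time-one maps $\Phi_1=X_F^1$, $\Phi_2=X_{F'}^1$, $\Phi_3=X_{F''}^1$ are defined in a neighbourhood of the origin of $h_p$; they are real analytic symplectic coordinate transformations there: they fix the origin, are complex analytic with analytic local inverse, map real points to real points, preserve the symplectic form, and differ from the identity by an analytic map from a neighbourhood of the origin of $h_p$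 to $h_q$. Near the origin of $h_p$, $$H\circ\Phi_1\circ\Phi_2\circ\Phi_3=\Lambda+\bar G+\hat G+\bar R+\hat R+\bar T+\hat T+W,$$ where $W=W_1\circ\Phi_2\circ\Phi_3+W_2\circ\Phi_3+W_3$ with $$W_1=\int_0^1\Bigl\{\bigl\{\{\tfrac12(t-1)^2(\bar G+\hat G)+\tfrac16(t^3-3t+2)\tilde G,F\},F\bigr\},F\Bigr\}\circ X_F^t\,dt,$$ $$W_2=\int_0^1\Bigl[(1-t)\{\{\bar G+\hat G,F'\},F'\}+\{\bar R+\hat R+t\tilde R+\mathcal T,F'\}\Bigr]\circ X_{F'}^t\,dt,$$ $$W_3=\int_0^1\{\bar G+\hat G+\bar R+\hat R+\bar T+\hat T+t\tilde T,F''\}\circ X_{F''}^t\,dt .$$ Moreover, as $z\to0$ in $h_p$, $$|\hat G|=O(\|z\|_p^3\|\hat z\|_p^3),\quad |\hat R|=O(\|z\|_p^8\|\hat z\|_p^2),\quad |\hat T|=O(\|z\|_p^{13}\|\hat z\|_p),\quad |W|=O(\|z\|_p^{18}),$$ and the Hamiltonian vector fields of $\bar G,\hat G,\bar R,\hat R,\bar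 T,\hat T,W$ are analytic from a neighbourhood of the origin of $h_p$ to $h_q$. -/

import Mathlib

open Filter Topology Asymptotics

noncomputable section

namespace GBBM

/-! ### Indices and the sequence spaces `h_p` -/

/-- The index set of the Fourier modes: the nonzero integers. -/
abbrev NZ : Type := {j : ℤ // j ≠ 0}

/-- The index `-j`. -/
def opp (j : NZ) : NZ := ⟨-j.1, neg_ne_zero.mpr j.2⟩

/-- A positive integer as an index. -/
def pos (n : ℕ+) : NZ := ⟨((n : ℕ) : ℤ), by exact_mod_cast n.ne_zero⟩

/-- The weight `|j| ^ p`. -/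
def weight (p : ℝ) (j : NZ) : ℝ := |(j.1 : ℝ)| ^ p

theorem weight_pos (p : ℝ) (j : NZ) : 0 < weight p j :=
  Real.rpow_pos_of_pos (abs_pos.mpr (Int.cast_ne_zero.mpr j.2)) p

/-- Multiplication of a sequence by the weights `|j| ^ p`. -/
def weightMap (p : ℝ) : (NZ → ℂ) →ₗ[ℂ] (NZ → ℂ) where
  toFun z := fun j => (weight p j : ℂ) * z j
  map_add' x y := by funext j; simp [mul_add]
  map_smul' c x := by funext j; simp [mul_left_comm]

/-- The sequences `z` for which `(|j| ^ p z_j)` is square summable. -/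
def hSub (p : ℝ) : Submodule ℂ (NZ → ℂ) where
  carrier := {z | Memℓp (weightMap p z) 2}
  add_mem' {x y} hx hy := by
    have h := Memℓp.add hx hy
    simpa only [Set.mem_ofPred_eq, map_add] using h
  zero_mem' := by
    have h : Memℓp (0 : NZ → ℂ) 2 := zero_memℓp
    simpa only [Set.mem_ofPred_eq, map_zero] using h
  smul_mem' c x hx := by
    have h := Memℓp.const_smul hx c
    simpa only [Set.mem_ofPred_eq, map_smul] using h

/-- The space `h_p` of complex sequences `z = (z_j)`, `j` a nonzero integer, with
`‖z‖_p ^ 2 = ∑ |z_j| ^ 2 |j| ^ (2 p) < ∞`; see `H.norm_sq` for the norm. -/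
def H (p : ℝ) : Type := hSub p

instance (p : ℝ) : AddCommGroup (H p) := inferInstanceAs (AddCommGroup (hSub p))

instance (p : ℝ) : Module ℂ (H p) := inferInstanceAs (Module ℂ (hSub p))

instance (p : ℝ) : CoeFun (H p) (fun _ => NZ → ℂ) := ⟨fun z => z.1⟩

/-- The linear embedding of `h_p` into the unweighted `ℓ²`. -/
def H.toLp (p : ℝ) : H p →ₗ[ℂ] lp (fun _ : NZ => ℂ) 2 where
  toFun z := ⟨weightMap p z.1, z.2⟩
  map_add' x y := Subtype.ext ((weightMap p).map_add x.1 y.1)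
  map_smul' c x := Subtype.ext ((weightMap p).map_smul c x.1)

theorem H.toLp_injective (p : ℝ) : Function.Injective (H.toLp p) := by
  intro x y h
  apply Subtype.ext
  funext j
  have h1 : (weight p j : ℂ) * x.1 j = (weight p j : ℂ) * y.1 j :=
    congrFun (congrArg Subtype.val h) j
  exact mul_left_cancel₀ (Complex.ofReal_ne_zero.mpr (weight_pos p j).ne') h1

instance (p : ℝ) : NormedAddCommGroup (H p) :=
  NormedAddCommGroup.induced (H p) (lp (fun _ : NZ => ℂ) 2) (H.toLp p) (H.toLp_injective p)

instance (p : ℝ) : NormedSpace ℂ (H p) :=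
  NormedSpace.induced ℂ (H p) (lp (fun _ : NZ => ℂ) 2) (H.toLp p)

theorem H.norm_sq {p : ℝ} (z : H p) :
    ‖z‖ ^ 2 = ∑' j : NZ, ‖z j‖ ^ 2 * |(j.1 : ℝ)| ^ (2 * p) := by
  have h : ‖H.toLp p z‖ ^ (2 : ENNReal).toReal
      = ∑' j : NZ, ‖H.toLp p z j‖ ^ (2 : ENNReal).toReal :=
    lp.norm_rpow_eq_tsum (by norm_num) (H.toLp p z)
  have h2 : (2 : ENNReal).toReal = ((2 : ℕ) : ℝ) := by norm_num
  rw [h2] at h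
  simp only [Real.rpow_natCast] at h
  refine (show ‖z‖ ^ 2 = ‖H.toLp p z‖ ^ 2 from rfl).trans (h.trans (tsum_congr fun j => ?_))
  have h3 : H.toLp p z j = (weight p j : ℂ) * z j := rfl
  have h4 : weight p j ^ 2 = |(j.1 : ℝ)| ^ (2 * p) := by
    rw [weight, ← Real.rpow_mul_natCast (abs_nonneg _)]
    congr 1
    push_cast
    ring
  rw [h3, norm_mul, mul_pow, Complex.norm_real, Real.norm_of_nonneg (weight_pos p j).le, h4,
    mul_comm]

/-- The unit sequence at the index `j`. -/
def H.unit (p : ℝ) (j : NZ) : H p :=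
  ⟨Pi.single j 1, by
    have h : weightMap p (Pi.single j 1) = Pi.single j (weight p j : ℂ) := by
      funext k
      by_cases hk : k = j
      · subst hk; simp [weightMap]
      · simp [weightMap, hk]
    show Memℓp (weightMap p (Pi.single j 1)) 2
    rw [h]
    exact (lp.single 2 j (weight p j : ℂ) : lp (fun _ : NZ => ℂ) 2).2⟩

/-- The real points of `h_p`: `z_{-j}` is the complex conjugate of `z_j`. -/
def IsRealPt {p : ℝ} (z : H p) : Prop := ∀ j : NZ, z (opp j) = starRingEnd ℂ (z j)

/-! ### Symplectic structure, Hamiltonian vector fields, Poisson bracket -/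

/-- The sign of the index `j`, as a complex number. -/
def sgn (j : NZ) : ℂ := (Int.sign j.1 : ℂ)

/-- The symplectic form `-i ∑_{j ≥ 1} dz_j ∧ dz_{-j}`, written as a sum over all indices. -/
def symp {p : ℝ} (u v : H p) : ℂ := -Complex.I * ∑' j : NZ, sgn j * (u j * v (opp j))

/-- The sequence of partial derivatives `∂A/∂z_j` at `z`. -/
def pderiv {p : ℝ} (A : H p → ℂ) (z : H p) (j : NZ) : ℂ := fderiv ℂ A z (H.unit p j)

/-- The components of the Hamiltonian vector field of `A`, that is of the system
`i z_j' = ∂A/∂z_{-j}`, `-i z_{-j}' = ∂A/∂z_j` for `j ≥ 1`. -/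
def hamVec {p : ℝ} (A : H p → ℂ) (z : H p) (j : NZ) : ℂ :=
  -Complex.I * sgn j * pderiv A z (opp j)

/-- The Poisson bracket `{A, B}`, the derivative of `A` along the Hamiltonian vector field
of `B`. -/
def poisson {p : ℝ} (A B : H p → ℂ) (z : H p) : ℂ := ∑' j : NZ, pderiv A z j * hamVec B z j

/-- The Hamiltonian vector field of `A` is analytic near the origin from `h_p` to `h_q`. -/
def HasAnalyticField {p : ℝ} (q : ℝ) (A : H p → ℂ) : Prop :=
  ∃ X : H p → H q, AnalyticAt ℂ X 0 ∧ ∀ᶠ z in 𝓝 (0 : H p), ∀ j : NZ, X z j = hamVec A z j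

/-- For initial values `z` near the origin, `φ t z`, `0 ≤ t ≤ 1`, is the flow in `h_p` of the
Hamiltonian vector field of `A`. -/
def IsFlow {p : ℝ} (A : H p → ℂ) (φ : ℝ → H p → H p) : Prop :=
  ∀ᶠ z in 𝓝 (0 : H p), φ 0 z = z ∧ ∀ t ∈ Set.Icc (0 : ℝ) 1,
    ∃ v : H p, (∀ j : NZ, v j = hamVec A (φ t z) j) ∧
      HasDerivWithinAt (fun s => φ s z) v (Set.Icc 0 1) t

/-- A real analytic symplectic coordinate transformation near the origin of `h_p` which differs
from the identity by an analytic map from `h_p` to `h_q`. -/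
structure IsSympTransf {p : ℝ} (q : ℝ) (Φ : H p → H p) : Prop where
  map_zero : Φ 0 = 0
  analytic : ∃ Ψ : H p → H q, AnalyticAt ℂ Ψ 0 ∧
    ∀ᶠ z in 𝓝 (0 : H p), ∀ j : NZ, Φ z j = z j + Ψ z j
  invertible : ∃ Φ' : H p → H p, AnalyticAt ℂ Φ' 0 ∧
    ∀ᶠ z in 𝓝 (0 : H p), Φ' (Φ z) = z ∧ Φ (Φ' z) = z
  real : ∀ᶠ z in 𝓝 (0 : H p), IsRealPt z → IsRealPt (Φ z)
  symplectic : ∀ᶠ z in 𝓝 (0 : H p), ∀ u v : H p,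
    symp (fderiv ℂ Φ z u) (fderiv ℂ Φ z v) = symp u v

/-! ### Frequencies, homogeneous polynomials, index sets -/

/-- `λ_j = j / (1 + j ^ 2)`. -/
def lam (j : NZ) : ℝ := (j.1 : ℝ) / (1 + (j.1 : ℝ) ^ 2)

/-- `δ_j = √(|j| / (1 + j ^ 2))`. -/
def del (j : NZ) : ℝ := Real.sqrt (|(j.1 : ℝ)| / (1 + (j.1 : ℝ) ^ 2))

/-- The homogeneous polynomial `∑ c_{j_1 … j_m} z_{j_1} ⋯ z_{j_m}`. -/
def poly {p : ℝ} {m : ℕ} (c : (Fin m → NZ) → ℂ) (z : H p) : ℂ :=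
  ∑' j : Fin m → NZ, c j * ∏ i, z (j i)

/-- The coefficients vanish unless `j_1 + ⋯ + j_m = 0`, and are bounded by a multiple of
`δ_{j_1} ⋯ δ_{j_m}`. -/
def Admissible {m : ℕ} (c : (Fin m → NZ) → ℂ) : Prop :=
  (∀ j, ∑ i, (j i).1 ≠ 0 → c j = 0) ∧ ∃ C : ℝ, ∀ j, ‖c j‖ ≤ C * ∏ i, del (j i)

/-- The coefficients vanish outside of the index set `D`. -/
def SuppIn {m : ℕ} (c : (Fin m → NZ) → ℂ) (D : Set (Fin m → NZ)) : Prop := ∀ j, j ∉ D → c j = 0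

open Classical in
/-- The terms of a polynomial with index in `D`. -/
def part {m : ℕ} (c : (Fin m → NZ) → ℂ) (D : Set (Fin m → NZ)) : (Fin m → NZ) → ℂ :=
  fun j => if j ∈ D then c j else 0

/-- The tangential index set `S = {± n₁, ± n₂}`. -/
def S (n₁ n₂ : ℕ+) : Set NZ := {pos n₁, opp (pos n₁), pos n₂, opp (pos n₂)}

open Classical in
/-- The number of components not in `S`. -/
def outs (n₁ n₂ : ℕ+) {m : ℕ} (j : Fin m → NZ) : ℕ :=
  (Finset.univ.filter fun i => j i ∉ S n₁ n₂).card

/-- The normal form set: up to a permutation, `j = (a, -a, b, -b, …)`. -/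
def Paired (m : ℕ) : Set (Fin m → NZ) :=
  {j | ∃ τ : Equiv.Perm (Fin m), ∀ i k : Fin m, Even (i : ℕ) → (k : ℕ) = i + 1 →
    j (τ i) = opp (j (τ k))}

/-- `‖ẑ‖_p`, where `ẑ` consists of the components of `z` with index not in `S`. -/
def hatNorm (n₁ n₂ : ℕ+) {p : ℝ} (z : H p) : ℝ :=
  open Classical in
  Real.sqrt (∑' j : NZ, if j ∈ S n₁ n₂ then 0 else ‖z j‖ ^ 2 * |(j.1 : ℝ)| ^ (2 * p))

/-- The coefficients `i c_j / (λ_{j_1} + ⋯ + λ_{j_m})` of the solution `F` of the homological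
equation `{Λ, F} + poly c = 0`. -/
def homol {m : ℕ} (c : (Fin m → NZ) → ℂ) (j : Fin m → NZ) : ℂ :=
  Complex.I * c j / ((∑ i, lam (j i) : ℝ) : ℂ)

/-! ### The Hamiltonian and its terms of order six -/

/-- `Λ = ∑_{j ≥ 1} λ_j z_j z_{-j}`. -/
def Lam {p : ℝ} (z : H p) : ℂ := ∑' n : ℕ+, (lam (pos n) : ℂ) * (z (pos n) * z (opp (pos n)))

/-- The coefficients of `G`. -/
def gCoeff (j : Fin 6 → NZ) : ℂ :=
  if ∑ i, (j i).1 = 0 then ((1 / (120 * Real.pi ^ 2) * ∏ i, del (j i) : ℝ) : ℂ) else 0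

/-- The Hamiltonian `H = Λ + G` of the generalized Benjamin-Bona-Mahony equation. -/
def ham {p : ℝ} (z : H p) : ℂ := Lam z + poly gCoeff z

/-- The normal form part of `G`: at most two components outside of `S`, paired. -/
def Gbar (n₁ n₂ : ℕ+) {p : ℝ} : H p → ℂ :=
  poly (part gCoeff ({j | outs n₁ n₂ j ≤ 2} ∩ Paired 6))

/-- The coefficients of the non-normal form part of `G`: at most two components outside of `S`,
not paired. -/
def gtildeCoeff (n₁ n₂ : ℕ+) : (Fin 6 → NZ) → ℂ :=
  part gCoeff ({j | outs n₁ n₂ j ≤ 2} \ Paired 6)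

/-- The non-normal form part of `G`. -/
def Gtilde (n₁ n₂ : ℕ+) {p : ℝ} : H p → ℂ := poly (gtildeCoeff n₁ n₂)

/-- The part of `G` with at least three components outside of `S`. -/
def Ghat (n₁ n₂ : ℕ+) {p : ℝ} : H p → ℂ := poly (part gCoeff {j | 3 ≤ outs n₁ n₂ j})

/-- The generating function `F` of the first transformation. -/
def F₁ (n₁ n₂ : ℕ+) {p : ℝ} : H p → ℂ := poly (homol (gtildeCoeff n₁ n₂))

/-- `∑_k a_k |z_{n₁}| ^ (2 (d - k)) |z_{n₂}| ^ (2 k)`, where `|z_n| ^ 2` stands for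
`z_n z_{-n}`, to which it is equal at the real points. -/
def actionPoly (n₁ n₂ : ℕ+) {d : ℕ} (a : Fin (d + 1) → ℝ) {p : ℝ} (z : H p) : ℂ :=
  ∑ k : Fin (d + 1), (a k : ℂ) * (z (pos n₁) * z (opp (pos n₁))) ^ (d - (k : ℕ)) *
    (z (pos n₂) * z (opp (pos n₂))) ^ (k : ℕ)

/-! ### The terms of higher order produced by the first transformation -/

/-- The terms of order 10 of `H ∘ Φ₁`: `{Ḡ + Ĝ + G̃ / 2, F}`. -/
def order10 (n₁ n₂ : ℕ+) {p : ℝ} : H p → ℂ :=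
  poisson (fun z => Gbar n₁ n₂ z + Ghat n₁ n₂ z + 1 / 2 * Gtilde n₁ n₂ z) (F₁ n₁ n₂)

/-- The terms of order 14 of `H ∘ Φ₁`: `{{(Ḡ + Ĝ) / 2 + G̃ / 3, F}, F}`. -/
def order14 (n₁ n₂ : ℕ+) {p : ℝ} : H p → ℂ :=
  poisson (poisson
    (fun z => 1 / 2 * (Gbar n₁ n₂ z + Ghat n₁ n₂ z) + 1 / 3 * Gtilde n₁ n₂ z)
    (F₁ n₁ n₂)) (F₁ n₁ n₂)

/-- The terms of order at least 18 of `H ∘ Φ₁`, where `φ` is the flow of `F`. -/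
def remainder₁ (n₁ n₂ : ℕ+) {p : ℝ} (φ : ℝ → H p → H p) (z : H p) : ℂ :=
  ∫ t in (0 : ℝ)..1, poisson (poisson (poisson
    (fun w => 1 / 2 * ((t : ℂ) - 1) ^ 2 * (Gbar n₁ n₂ w + Ghat n₁ n₂ w) +
      1 / 6 * ((t : ℂ) ^ 3 - 3 * t + 2) * Gtilde n₁ n₂ w)
    (F₁ n₁ n₂)) (F₁ n₁ n₂)) (F₁ n₁ n₂) (φ t z)

end GBBM

end

open scoped ENNReal

noncomputable section

namespace GBBM

/-! ### Indices -/

/-! Analysis. Two features of the polynomials suffice: momentum is conserved, and the coefficients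
are bounded by products of the `δ_j ≤ |j|^(-1/2)`. For `p > 0` the sequence `δ_j z_j` is summable,
so the polynomials converge absolutely and are analytic on `h_p`. Component `l` of the Hamiltonian
field carries an extra `δ_l`, worth half a derivative. Momentum conservation bounds `|l|` by a
multiple of the largest index, whose own `δ` gives the other half. Young's inequality for `ℓ² * ℓ¹`
then shows that the fields map `h_p` to `h_{p+1}` (`KerBdd.exists_tsum_le`). The class is closed
under brackets (`Admissible.bracket`), and under `homol` when the divisors stay away from zero.

Divisors. Let `m₁, m₂` be the net multiplicities of `n₁, n₂` in a tuple of zero momentum. With no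
index outside `S`, `n₂ ≥ 40 n₁` forces pairing. With one outside index `a`, momentum determines `a`
from `m₁, m₂`, so there are finitely many divisors and only nonvanishing matters
(`no_resonance_one`). With two outside indices `a, b` and `m₁ = m₂ = 0` the tuple is paired.
Otherwise the divisor tends to `m₁ λ_{n₁} + m₂ λ_{n₂} ≠ 0` as `|a| → ∞`, so again nonvanishing
suffices. If one of `m₁, m₂` vanishes, a resonance is an integer quadratic equation for `a b`, whose
discriminant is no square or whose roots are excluded. If neither vanishes, one of `a, b` has size
at least `n₂ / 4`, and the divisor is close to a quantity bounded below in terms of `n₁` alone; this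
is why `n₂` is chosen after `n₁` (`no_resonance_two`).

Flows. Orbits solve `γ - ∫ X(γ) = z`. The left side is analytic on the space of paths and tangent to
the identity, so the analytic inverse function theorem gives the flow up to time one
(`exists_flow`). As `X` has values in `h_{p+1}`, so has `Φ - id`. Reality follows from uniqueness,
symplecticity from the symmetry of the second derivative.

Normal form. Taylor's formula along orbits, with `{Λ, F}` cancelling the unpaired part, gives each
step (`IsOrbit.lie_transform_two` and its companions). In degree 14 momentum alone forces pairing,
so the third generator vanishes. `W` is defined as the difference of the two sides: the integral
formulas show that it has order 18, while the difference itself gives its vector field, because the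
field of `H ∘ Φ` is `(DΦ)⁻¹ X_H ∘ Φ` and `DΦ⁻¹ - id` gains a derivative (`HasAnalyticField.comp`).
-/

@[simp] theorem opp_opp (j : NZ) : opp (opp j) = j := Subtype.ext (neg_neg j.1)

@[simp] theorem opp_val (j : NZ) : (opp j).1 = -j.1 := rfl

theorem opp_ne (j : NZ) : opp j ≠ j := by
  intro h
  have h1 : -j.1 = j.1 := congrArg Subtype.val h
  have := j.2
  omega

/-- `opp` as a permutation of the indices. -/
def oppEquiv : NZ ≃ NZ := ⟨opp, opp, opp_opp, opp_opp⟩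

@[simp] theorem oppEquiv_apply (j : NZ) : oppEquiv j = opp j := rfl

theorem opp_injective : Function.Injective opp := oppEquiv.injective

@[simp] theorem opp_inj {j k : NZ} : opp j = opp k ↔ j = k := opp_injective.eq_iff

theorem opp_eq_iff {j k : NZ} : opp j = k ↔ j = opp k := by
  constructor
  · rintro rfl; simp
  · rintro rfl; simp

@[simp] theorem sgn_opp (j : NZ) : sgn (opp j) = -sgn j := by
  simp [sgn, opp, Int.sign_neg]

theorem sgn_mul_self (j : NZ) : sgn j * sgn j = 1 := by
  rcases lt_or_gt_of_ne j.2 with h | h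
  · simp [sgn, Int.sign_eq_neg_one_of_neg h]
  · simp [sgn, Int.sign_eq_one_of_pos h]

@[simp] theorem norm_sgn (j : NZ) : ‖sgn j‖ = 1 := by
  rcases lt_or_gt_of_ne j.2 with h | h
  · simp [sgn, Int.sign_eq_neg_one_of_neg h]
  · simp [sgn, Int.sign_eq_one_of_pos h]

@[simp] theorem conj_sgn (j : NZ) : starRingEnd ℂ (sgn j) = sgn j := by
  simp [sgn]

theorem one_le_abs (j : NZ) : (1 : ℝ) ≤ |(j.1 : ℝ)| := by
  have h := Int.one_le_abs j.2
  exact_mod_cast h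

@[simp] theorem weight_opp (p : ℝ) (j : NZ) : weight p (opp j) = weight p j := by
  simp [weight, opp]

theorem one_le_weight {p : ℝ} (hp : 0 ≤ p) (j : NZ) : 1 ≤ weight p j :=
  Real.one_le_rpow (one_le_abs j) hp

theorem weight_mono {p q : ℝ} (h : p ≤ q) (j : NZ) : weight p j ≤ weight q j :=
  Real.rpow_le_rpow_of_exponent_le (one_le_abs j) h

theorem weight_add (p q : ℝ) (j : NZ) : weight (p + q) j = weight p j * weight q j :=
  Real.rpow_add (by linarith [one_le_abs j]) p q

/-! ### The spaces `h_p` -/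

section Space

variable {p : ℝ}

theorem H.ext {x y : H p} (h : ∀ j, x j = y j) : x = y := Subtype.ext (funext h)

@[simp] theorem H.add_apply (x y : H p) (j : NZ) : (x + y) j = x j + y j := rfl
@[simp] theorem H.sub_apply (x y : H p) (j : NZ) : (x - y) j = x j - y j := rfl
@[simp] theorem H.neg_apply (x : H p) (j : NZ) : (-x) j = -x j := rfl
@[simp] theorem H.smul_apply (c : ℂ) (x : H p) (j : NZ) : (c • x) j = c * x j := rfl

theorem H.unit_apply (j k : NZ) : H.unit p j k = if k = j then 1 else 0 := by
  simp [H.unit, Pi.single_apply]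

/-- `h_p` is isometric to the unweighted `ℓ²`. -/
def H.isom (p : ℝ) : H p ≃ₗᵢ[ℂ] lp (fun _ : NZ => ℂ) 2 :=
  LinearIsometryEquiv.ofSurjective ⟨H.toLp p, fun _ => rfl⟩ (by
    intro y
    have h : weightMap p (fun j => (weight p j : ℂ)⁻¹ * y j) = y := by
      funext j
      have := Complex.ofReal_ne_zero.mpr (weight_pos p j).ne'
      simp [weightMap, this]
    exact ⟨⟨fun j => (weight p j : ℂ)⁻¹ * y j, show Memℓp _ 2 by rw [h]; exact y.2⟩,
      Subtype.ext h⟩)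

theorem H.isom_apply (z : H p) (j : NZ) : H.isom p z j = (weight p j : ℂ) * z j := rfl

instance : CompleteSpace (H p) := (H.isom p).toIsometryEquiv.completeSpace

theorem enorm_weight_mul (z : ℂ) (j : NZ) :
    ‖(weight p j : ℂ) * z‖ₑ = ENNReal.ofReal (weight p j) * ‖z‖ₑ := by
  rw [enorm_mul]
  congr 1
  rw [← ofReal_norm, Complex.norm_real, Real.norm_of_nonneg (weight_pos p j).le]

/-- Sums are estimated in the extended nonnegative reals, where they always exist; one inequality
then yields both membership in `h_p` and the norm bound. -/
theorem H.mem_of_tsum_ne_top {y : NZ → ℂ}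
    (h : ∑' j, (ENNReal.ofReal (weight p j) * ‖y j‖ₑ) ^ 2 ≠ ⊤) : y ∈ hSub p := by
  change Memℓp (weightMap p y) 2
  rw [memℓp_gen_iff (by norm_num)]
  have h1 : ∀ j, (‖weightMap p y j‖ ^ (2 : ℝ≥0∞).toReal) =
      ((ENNReal.ofReal (weight p j) * ‖y j‖ₑ) ^ 2).toReal := by
    intro j
    rw [← enorm_weight_mul]
    simp [weightMap]
  simp_rw [h1]
  exact ENNReal.summable_toReal h

theorem H.enorm_sq (z : H p) :
    ‖z‖ₑ ^ 2 = ∑' j, (ENNReal.ofReal (weight p j) * ‖z j‖ₑ) ^ 2 := by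
  have h : HasSum (fun j => ‖H.isom p z j‖ ^ (2 : ℝ≥0∞).toReal)
      (‖H.isom p z‖ ^ (2 : ℝ≥0∞).toReal) := lp.hasSum_norm (by norm_num) _
  have h2 : (2 : ℝ≥0∞).toReal = ((2 : ℕ) : ℝ) := by norm_num
  simp only [h2, Real.rpow_natCast, LinearIsometryEquiv.norm_map] at h
  rw [← ofReal_norm, ← ENNReal.ofReal_pow (norm_nonneg _), ← h.tsum_eq,
    ENNReal.ofReal_tsum_of_nonneg (fun _ => by positivity) h.summable]
  refine tsum_congr fun j => ?_
  rw [ENNReal.ofReal_pow (norm_nonneg _), ofReal_norm, H.isom_apply, enorm_weight_mul]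

/-- A bound of the weighted `ℓ²` sum bounds the norm. -/
theorem H.norm_le_of_tsum_le {z : H p} {K : ℝ} (hK : 0 ≤ K)
    (h : ∑' j, (ENNReal.ofReal (weight p j) * ‖z j‖ₑ) ^ 2 ≤ ENNReal.ofReal K ^ 2) : ‖z‖ ≤ K := by
  rw [← H.enorm_sq] at h
  have h1 : ‖z‖ₑ ≤ ENNReal.ofReal K := (ENNReal.pow_le_pow_left_iff two_ne_zero).mp h
  rwa [← ofReal_norm, ENNReal.ofReal_le_ofReal_iff hK] at h1

theorem H.hasSum_unit (z : H p) : HasSum (fun j => z j • H.unit p j) z := by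
  have h := lp.hasSum_single (p := 2) (by norm_num) (H.isom p z)
  have h1 := h.map (H.isom p).symm (H.isom p).symm.continuous
  rw [(H.isom p).symm_apply_apply] at h1
  convert h1 using 2 with j
  rw [Function.comp_apply, eq_comm, LinearIsometryEquiv.symm_apply_eq]
  apply lp.ext
  funext k
  by_cases hk : k = j
  · subst hk
    rw [lp.single_apply_self, H.isom_apply, H.isom_apply, H.smul_apply, H.unit_apply]
    simp
  · rw [lp.single_apply_ne _ _ _ hk, H.isom_apply, H.smul_apply, H.unit_apply]
    simp [hk]

/-- A bound of the coordinates gives a linear operator between the spaces. -/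
theorem H.tsum_mono {q : ℝ} (z : H p) (y : NZ → ℂ)
    (h : ∀ j, weight q j * ‖y j‖ ≤ weight p j * ‖z j‖) :
    ∑' j, (ENNReal.ofReal (weight q j) * ‖y j‖ₑ) ^ 2 ≤ ‖z‖ₑ ^ 2 := by
  rw [H.enorm_sq]
  refine ENNReal.tsum_le_tsum fun j => ?_
  gcongr ?_ ^ 2
  rw [← ofReal_norm, ← ofReal_norm, ← ENNReal.ofReal_mul (weight_pos _ _).le,
    ← ENNReal.ofReal_mul (weight_pos _ _).le]
  exact ENNReal.ofReal_le_ofReal (h j)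

theorem H.mem_of_le {q : ℝ} (z : H p) (y : NZ → ℂ)
    (h : ∀ j, weight q j * ‖y j‖ ≤ weight p j * ‖z j‖) : y ∈ hSub q :=
  H.mem_of_tsum_ne_top
    (ne_top_of_le_ne_top (ENNReal.pow_ne_top enorm_ne_top) (H.tsum_mono z y h))

theorem H.norm_le_of_le {q : ℝ} (z : H p) (y : H q)
    (h : ∀ j, weight q j * ‖y j‖ ≤ weight p j * ‖z j‖) : ‖y‖ ≤ ‖z‖ :=
  H.norm_le_of_tsum_le (norm_nonneg _) (by rw [ofReal_norm]; exact H.tsum_mono z y h)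

/-- The inclusion of `h_q` in `h_p` for `p ≤ q`. -/
def H.incl {p q : ℝ} (h : p ≤ q) : H q →L[ℂ] H p :=
  LinearMap.mkContinuous
    { toFun := fun z => ⟨z.1, H.mem_of_le z z.1 fun j =>
        mul_le_mul_of_nonneg_right (weight_mono h j) (norm_nonneg _)⟩
      map_add' := fun _ _ => rfl
      map_smul' := fun _ _ => rfl } 1 (fun z => by
        rw [one_mul]
        exact H.norm_le_of_le z _ fun j =>
          mul_le_mul_of_nonneg_right (weight_mono h j) (norm_nonneg _))

@[simp] theorem H.incl_apply {p q : ℝ} (h : p ≤ q) (z : H q) (j : NZ) : H.incl h z j = z j := rfl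

/-- Multiplication of the components by a sequence bounded by one. -/
def H.diag (a : NZ → ℂ) (ha : ∀ j, ‖a j‖ ≤ 1) : H p →L[ℂ] H p :=
  LinearMap.mkContinuous
    { toFun := fun z => ⟨fun j => a j * z j, H.mem_of_le z _ fun j => by
        rw [norm_mul]
        exact mul_le_mul_of_nonneg_left
          (mul_le_of_le_one_left (norm_nonneg _) (ha j)) (weight_pos p j).le⟩
      map_add' := fun x y => H.ext fun j => by
        change a j * (x j + y j) = a j * x j + a j * y j
        ring
      map_smul' := fun c x => H.ext fun j => by
        change a j * (c * x j) = c * (a j * x j)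
        ring } 1 (fun z => by
        rw [one_mul]
        refine H.norm_le_of_le z _ fun j => ?_
        change weight p j * ‖a j * z j‖ ≤ _
        rw [norm_mul]
        exact mul_le_mul_of_nonneg_left
          (mul_le_of_le_one_left (norm_nonneg _) (ha j)) (weight_pos p j).le)

@[simp] theorem H.diag_apply (a : NZ → ℂ) (ha : ∀ j, ‖a j‖ ≤ 1) (z : H p) (j : NZ) :
    H.diag a ha z j = a j * z j := rfl

theorem H.conj_mem (z : H p) : (fun j => starRingEnd ℂ (z (opp j))) ∈ hSub p := by
  refine H.mem_of_tsum_ne_top ?_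
  have h : ∑' j, (ENNReal.ofReal (weight p j) * ‖starRingEnd ℂ (z (opp j))‖ₑ) ^ 2 = ‖z‖ₑ ^ 2 := by
    rw [H.enorm_sq, ← oppEquiv.tsum_eq]
    refine tsum_congr fun j => ?_
    rw [← ofReal_norm, RCLike.norm_conj, ofReal_norm]
    simp
  rw [h]
  exact ENNReal.pow_ne_top enorm_ne_top

/-- The conjugation `z ↦ (conj z_{-j})`, whose fixed points are the real points. -/
def H.conj : H p →L[ℝ] H p :=
  LinearMap.mkContinuous
    { toFun := fun z => ⟨fun j => starRingEnd ℂ (z (opp j)), H.conj_mem z⟩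
      map_add' := fun x y => H.ext fun j => map_add _ _ _
      map_smul' := fun c x => H.ext fun j => by
        change starRingEnd ℂ ((c : ℂ) * x (opp j)) = (c : ℂ) * starRingEnd ℂ (x (opp j))
        simp } 1 (fun z => by
        rw [one_mul]
        refine H.norm_le_of_tsum_le (norm_nonneg _) ?_
        rw [ofReal_norm, H.enorm_sq, ← oppEquiv.tsum_eq]
        refine (tsum_congr fun j => ?_).le
        change (_ * ‖starRingEnd ℂ (z (opp (opp j)))‖ₑ) ^ 2 = _
        rw [← ofReal_norm, RCLike.norm_conj, ofReal_norm]
        simp)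

@[simp] theorem H.conj_apply (z : H p) (j : NZ) : H.conj z j = starRingEnd ℂ (z (opp j)) := rfl

theorem isRealPt_iff (z : H p) : IsRealPt z ↔ H.conj z = z := by
  constructor
  · intro h
    refine H.ext fun j => ?_
    rw [H.conj_apply, h j, Complex.conj_conj]
  · intro h j
    have h1 := congrArg (fun w : H p => w (opp j)) h
    simpa using h1.symm

end Space

/-! ### Sums of nonnegative extended reals -/

/-- Cauchy–Schwarz, as Hölder's inequality for the counting measure; the discrete σ-algebra makes
every function measurable. -/
theorem ENNReal_tsum_mul_sq_le {ι : Type*} (f g : ι → ℝ≥0∞) :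
    (∑' i, f i * g i) ^ 2 ≤ (∑' i, f i ^ 2) * ∑' i, g i ^ 2 := by
  let _ : MeasurableSpace ι := ⊤
  have h := ENNReal.lintegral_mul_le_Lp_mul_Lq (MeasureTheory.Measure.count (α := ι))
    (p := 2) (q := 2) ⟨by norm_num, by norm_num, by norm_num⟩
    (f := f) (g := g) (measurable_from_top).aemeasurable (measurable_from_top).aemeasurable
  simp only [MeasureTheory.lintegral_count, Pi.mul_apply] at h
  have h2 := pow_le_pow_left' h 2
  rw [mul_pow] at h2
  have h3 : ∀ x : ℝ≥0∞, (x ^ ((1 : ℝ) / 2)) ^ 2 = x := by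
    intro x
    rw [← ENNReal.rpow_natCast, ← ENNReal.rpow_mul]
    norm_num
  rw [h3, h3] at h2
  simpa using h2

theorem ENNReal_tsum_prod_pi {α : Type*} {m : ℕ} (f : Fin m → α → ℝ≥0∞) :
    ∑' j : Fin m → α, ∏ i, f i (j i) = ∏ i, ∑' a, f i a := by
  induction m with
  | zero => simp
  | succ m ih =>
    rw [← (Fin.consEquiv fun _ : Fin (m + 1) => α).tsum_eq, ENNReal.tsum_prod']
    simp only [Fin.consEquiv_apply, Fin.prod_univ_succ, Fin.cons_zero, Fin.cons_succ,
      ENNReal.tsum_mul_left, ENNReal.tsum_mul_right]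
    rw [ih]

/-! ### The weights `δ_j` -/

theorem del_pos (j : NZ) : 0 < del j := by
  have := one_le_abs j
  exact Real.sqrt_pos.mpr (by positivity)

theorem del_sq (j : NZ) : del j ^ 2 = |(j.1 : ℝ)| / (1 + (j.1 : ℝ) ^ 2) :=
  Real.sq_sqrt (by positivity)

/-- Each `δ` is worth half a derivative. All estimates use this power bound rather than the exact
value. -/
theorem del_le_weight (j : NZ) : del j ≤ weight (-(1 / 2)) j := by
  have h1 := one_le_abs j
  have h2 : weight (-(1 / 2)) j ^ 2 = |(j.1 : ℝ)|⁻¹ := by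
    rw [weight, ← Real.rpow_mul_natCast (abs_nonneg _)]
    norm_num [Real.rpow_neg_one]
  refine (sq_le_sq₀ (del_pos j).le (weight_pos _ j).le).mp ?_
  rw [del_sq, h2, ← sq_abs, div_le_iff₀ (by positivity)]
  field_simp
  linarith

theorem del_le_one (j : NZ) : del j ≤ 1 := by
  refine (del_le_weight j).trans ?_
  exact Real.rpow_le_one_of_one_le_of_nonpos (one_le_abs j) (by norm_num)

@[simp] theorem del_opp (j : NZ) : del (opp j) = del j := by
  simp [del, opp]

/-- The exponent is `-1 - 2 p`, so this is where positivity of `p` enters. -/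
theorem summable_weight {p : ℝ} (hp : 0 < p) :
    Summable fun j : NZ => weight (-(1 / 2) - p) j ^ 2 := by
  have h := (Real.summable_abs_int_rpow (b := 1 + 2 * p) (by linarith)).comp_injective
    (Subtype.val_injective (p := fun j : ℤ => j ≠ 0))
  refine h.congr fun j => ?_
  rw [weight, ← Real.rpow_mul_natCast (abs_nonneg _)]
  simp only [Function.comp_apply]
  congr 1
  push_cast
  ring

/-- For positive `p` the sequence `(δ_j z_j)` is summable. -/
theorem exists_tsum_del_le {p : ℝ} (hp : 0 < p) : ∃ K : ℝ, 1 ≤ K ∧ ∀ z : H p,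
    ∑' j, ENNReal.ofReal (del j) * ‖z j‖ₑ ≤ ENNReal.ofReal K * ‖z‖ₑ := by
  set T : ℝ := ∑' j : NZ, weight (-(1 / 2) - p) j ^ 2
  have hT : 0 ≤ T := tsum_nonneg fun j => by positivity
  -- Cauchy–Schwarz gives the constant `√T`; `1 + T` dominates it and is at least one.
  refine ⟨1 + T, by linarith, fun z => ?_⟩
  have h1 : ∀ j, ENNReal.ofReal (del j) * ‖z j‖ₑ ≤
      ENNReal.ofReal (weight (-(1 / 2) - p) j) * (ENNReal.ofReal (weight p j) * ‖z j‖ₑ) := by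
    intro j
    rw [← mul_assoc, ← ENNReal.ofReal_mul (weight_pos _ _).le, ← weight_add, sub_add_cancel]
    gcongr
    exact del_le_weight j
  have h2 := (pow_le_pow_left' (ENNReal.tsum_le_tsum h1) 2).trans (ENNReal_tsum_mul_sq_le _ _)
  rw [← H.enorm_sq] at h2
  refine (ENNReal.pow_le_pow_left_iff two_ne_zero).mp (h2.trans ?_)
  rw [mul_pow]
  gcongr
  have h3 : ∑' j : NZ, ENNReal.ofReal (weight (-(1 / 2) - p) j) ^ 2 = ENNReal.ofReal T := by
    rw [ENNReal.ofReal_tsum_of_nonneg (fun _ => by positivity) (summable_weight hp)]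
    exact tsum_congr fun j => (ENNReal.ofReal_pow (weight_pos _ _).le 2).symm
  rw [h3, ← ENNReal.ofReal_pow (by linarith)]
  exact ENNReal.ofReal_le_ofReal (by nlinarith)

/-! ### Multilinear forms with coefficients bounded by products of the `δ_j` -/

/-- The coefficients are bounded by a multiple of `δ_{j_1} ⋯ δ_{j_m}`. -/
def Bdd {m : ℕ} (c : (Fin m → NZ) → ℂ) : Prop := ∃ C : ℝ, ∀ j, ‖c j‖ ≤ C * ∏ i, del (j i)

theorem Admissible.bdd {m : ℕ} {c : (Fin m → NZ) → ℂ} (h : Admissible c) : Bdd c := h.2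

theorem prod_del_pos {m : ℕ} (j : Fin m → NZ) : 0 < ∏ i, del (j i) :=
  Finset.prod_pos fun i _ => del_pos (j i)

theorem Bdd.exists_nonneg {m : ℕ} {c : (Fin m → NZ) → ℂ} (h : Bdd c) :
    ∃ C : ℝ, 0 ≤ C ∧ ∀ j, ‖c j‖ ≤ C * ∏ i, del (j i) := by
  obtain ⟨C, hC⟩ := h
  exact ⟨|C|, abs_nonneg C, fun j => (hC j).trans
    (mul_le_mul_of_nonneg_right (le_abs_self C) (prod_del_pos j).le)⟩

/-- The multilinear form with coefficients `c`. -/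
def mform {p : ℝ} {m : ℕ} (c : (Fin m → NZ) → ℂ) (z : Fin m → H p) : ℂ :=
  ∑' j : Fin m → NZ, c j * ∏ i, z i (j i)

theorem poly_eq_mform {p : ℝ} {m : ℕ} (c : (Fin m → NZ) → ℂ) (z : H p) :
    poly c z = mform c fun _ => z := rfl

theorem enorm_finset_prod {ι : Type*} (s : Finset ι) (f : ι → ℂ) :
    ‖∏ i ∈ s, f i‖ₑ = ∏ i ∈ s, ‖f i‖ₑ := by
  classical
  induction s using Finset.induction_on with
  | empty => simp
  | insert a s ha ih => rw [Finset.prod_insert ha, Finset.prod_insert ha, enorm_mul, ih]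

theorem enorm_term_le {p : ℝ} {m : ℕ} {a : ℂ} {C : ℝ} (hC : 0 ≤ C) (j : Fin m → NZ)
    (ha : ‖a‖ ≤ C * ∏ i, del (j i)) (z : Fin m → H p) :
    ‖a * ∏ i, z i (j i)‖ₑ ≤
      ENNReal.ofReal C * ∏ i, (ENNReal.ofReal (del (j i)) * ‖z i (j i)‖ₑ) := by
  rw [enorm_mul, enorm_finset_prod, Finset.prod_mul_distrib, ← mul_assoc,
    ← ENNReal.ofReal_prod_of_nonneg (fun i _ => (del_pos _).le), ← ENNReal.ofReal_mul hC]
  gcongr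
  rw [← ofReal_norm]
  exact ENNReal.ofReal_le_ofReal ha

/-- Once the coefficient is replaced by its bound, the sum over multi-indices factors into `m`
single sums. -/
theorem tsum_enorm_le {p : ℝ} {m : ℕ} {c : (Fin m → NZ) → ℂ} {C : ℝ} (hC : 0 ≤ C)
    (hc : ∀ j, ‖c j‖ ≤ C * ∏ i, del (j i)) (z : Fin m → H p) :
    ∑' j : Fin m → NZ, ‖c j * ∏ i, z i (j i)‖ₑ ≤
      ENNReal.ofReal C * ∏ i, ∑' a, ENNReal.ofReal (del a) * ‖z i a‖ₑ := by
  rw [← ENNReal_tsum_prod_pi, ← ENNReal.tsum_mul_left]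
  exact ENNReal.tsum_le_tsum fun j => enorm_term_le hC j (hc j) z

theorem summable_of_tsum_enorm_ne_top {ι : Type*} {f : ι → ℂ} (h : ∑' i, ‖f i‖ₑ ≠ ⊤) :
    Summable f := by
  have h1 := ENNReal.summable_toReal h
  simp only [toReal_enorm] at h1
  exact h1.of_norm

theorem Bdd.exists_tsum_le {p : ℝ} (hp : 0 < p) {m : ℕ} {c : (Fin m → NZ) → ℂ} (hc : Bdd c) :
    ∃ B : ℝ, 0 ≤ B ∧ ∀ z : Fin m → H p,
      ∑' j : Fin m → NZ, ‖c j * ∏ i, z i (j i)‖ₑ ≤ ENNReal.ofReal (B * ∏ i, ‖z i‖) := by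
  obtain ⟨C, hC, hcC⟩ := hc.exists_nonneg
  obtain ⟨K, hK, hKz⟩ := exists_tsum_del_le hp
  have hK0 : 0 ≤ K := by linarith
  refine ⟨C * K ^ m, by positivity, fun z => (tsum_enorm_le hC hcC z).trans ?_⟩
  calc ENNReal.ofReal C * ∏ i, ∑' a, ENNReal.ofReal (del a) * ‖z i a‖ₑ
      ≤ ENNReal.ofReal C * ∏ i, (ENNReal.ofReal K * ‖z i‖ₑ) := by
        gcongr with i
        exact hKz (z i)
    _ = ENNReal.ofReal (C * K ^ m * ∏ i, ‖z i‖) := by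
        rw [Finset.prod_mul_distrib, Finset.prod_const, Finset.card_univ, Fintype.card_fin,
          ENNReal.ofReal_mul (by positivity), ENNReal.ofReal_mul hC, ENNReal.ofReal_pow hK0,
          ENNReal.ofReal_prod_of_nonneg fun i _ => norm_nonneg _, mul_assoc]
        simp only [ofReal_norm]

theorem Bdd.summable {p : ℝ} (hp : 0 < p) {m : ℕ} {c : (Fin m → NZ) → ℂ} (hc : Bdd c)
    (z : Fin m → H p) : Summable fun j : Fin m → NZ => c j * ∏ i, z i (j i) := by
  obtain ⟨B, -, h⟩ := hc.exists_tsum_le (p := p) hp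
  exact summable_of_tsum_enorm_ne_top (ne_top_of_le_ne_top ENNReal.ofReal_ne_top (h z))

theorem Bdd.exists_norm_mform_le {p : ℝ} (hp : 0 < p) {m : ℕ} {c : (Fin m → NZ) → ℂ}
    (hc : Bdd c) : ∃ B : ℝ, 0 ≤ B ∧ ∀ z : Fin m → H p, ‖mform c z‖ ≤ B * ∏ i, ‖z i‖ := by
  obtain ⟨B, hB, h⟩ := hc.exists_tsum_le (p := p) hp
  refine ⟨B, hB, fun z => ?_⟩
  have h1 : ‖mform c z‖ₑ ≤ ENNReal.ofReal (B * ∏ i, ‖z i‖) :=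
    (enorm_tsum_le_tsum_enorm ).trans (h z)
  rwa [← ofReal_norm, ENNReal.ofReal_le_ofReal_iff
    (mul_nonneg hB (Finset.prod_nonneg fun i _ => norm_nonneg _))] at h1

theorem prod_update_apply {p : ℝ} {m : ℕ} [DecidableEq (Fin m)] (z : Fin m → H p) (i : Fin m)
    (x : H p) (j : Fin m → NZ) :
    ∏ k, Function.update z i x k (j k) = x (j i) * ∏ k ∈ Finset.univ.erase i, z k (j k) := by
  rw [← Finset.mul_prod_erase _ _ (Finset.mem_univ i), Function.update_self]
  congr 1
  refine Finset.prod_congr rfl fun k hk => ?_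
  rw [Function.update_of_ne (Finset.ne_of_mem_erase hk)]

/-- The multilinear form with coefficients `c` as a continuous multilinear map. -/
def mformL {p : ℝ} (hp : 0 < p) {m : ℕ} {c : (Fin m → NZ) → ℂ} (hc : Bdd c) :
    ContinuousMultilinearMap ℂ (fun _ : Fin m => H p) ℂ :=
  MultilinearMap.mkContinuous
    { toFun := mform c
      map_update_add' := fun z i x y => by
        rw [mform, mform, mform, ← (hc.summable hp _).tsum_add (hc.summable hp _)]
        refine tsum_congr fun j => ?_
        rw [prod_update_apply, prod_update_apply, prod_update_apply, H.add_apply]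
        ring
      map_update_smul' := fun z i a x => by
        rw [mform, mform, smul_eq_mul, ← tsum_mul_left]
        refine tsum_congr fun j => ?_
        rw [prod_update_apply, prod_update_apply, H.smul_apply]
        ring }
    (hc.exists_norm_mform_le hp).choose (hc.exists_norm_mform_le hp).choose_spec.2

@[simp] theorem mformL_apply {p : ℝ} (hp : 0 < p) {m : ℕ} {c : (Fin m → NZ) → ℂ} (hc : Bdd c)
    (z : Fin m → H p) : mformL hp hc z = mform c z := rfl

/-! ### A convolution estimate -/

/-- At most one index has a prescribed value, and none if the value is zero. This is how momentum
conservation removes one summation. -/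
theorem tsum_ite_val_le (t : ℤ) : ∑' a : NZ, (if a.1 = t then (1 : ℝ≥0∞) else 0) ≤ 1 := by
  by_cases ht : t = 0
  · refine (ENNReal.tsum_eq_zero.mpr fun a => ?_).trans_le zero_le_one
    rw [if_neg (ht ▸ a.2)]
  · rw [tsum_eq_single (⟨t, ht⟩ : NZ)]
    · simp
    · intro b hb
      rw [if_neg fun h => hb (Subtype.ext h)]

/-- Write `g h = (g √h) √h` and apply Cauchy–Schwarz at fixed `l`. In the second factor `b` and `l`
determine `a`; after summation over `l`, in the first factor `x` determines `l`. -/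
theorem convolution_le {β : Type*} (g : NZ → ℝ≥0∞) (h : β → ℝ≥0∞) (s : β → ℤ) :
    ∑' l : NZ, (∑' x : NZ × β, if x.1.1 + s x.2 = l.1 then g x.1 * h x.2 else 0) ^ 2 ≤
      (∑' a, g a ^ 2) * (∑' b, h b) ^ 2 := by
  have hsq : ∀ y : ℝ≥0∞, (y ^ ((1 : ℝ) / 2)) ^ 2 = y := by
    intro y
    rw [← ENNReal.rpow_natCast, ← ENNReal.rpow_mul]
    norm_num
  have key : ∀ l : NZ, (∑' x : NZ × β, if x.1.1 + s x.2 = l.1 then g x.1 * h x.2 else 0) ^ 2 ≤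
      (∑' x : NZ × β, if x.1.1 + s x.2 = l.1 then g x.1 ^ 2 * h x.2 else 0) * ∑' b, h b := by
    intro l
    have h1 : ∀ x : NZ × β, (if x.1.1 + s x.2 = l.1 then g x.1 * h x.2 else 0) =
        (if x.1.1 + s x.2 = l.1 then g x.1 * h x.2 ^ ((1 : ℝ) / 2) else 0) *
        (if x.1.1 + s x.2 = l.1 then h x.2 ^ ((1 : ℝ) / 2) else 0) := by
      intro x
      split_ifs
      · rw [mul_assoc, ← sq, hsq]
      · simp
    simp_rw [h1]
    refine (ENNReal_tsum_mul_sq_le _ _).trans (mul_le_mul' (le_of_eq ?_) ?_)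
    · refine tsum_congr fun x => ?_
      split_ifs
      · rw [mul_pow, hsq]
      · simp
    · calc ∑' x : NZ × β, (if x.1.1 + s x.2 = l.1 then h x.2 ^ ((1 : ℝ) / 2) else 0) ^ 2
          = ∑' b, ∑' a : NZ, h b * (if a.1 = l.1 - s b then (1 : ℝ≥0∞) else 0) := by
            rw [ENNReal.tsum_prod', ENNReal.tsum_comm]
            refine tsum_congr fun b => tsum_congr fun a => ?_
            have : a.1 + s b = l.1 ↔ a.1 = l.1 - s b := by omega
            simp only [this]
            split_ifs
            · rw [hsq, mul_one]
            · simp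
        _ ≤ ∑' b, h b := by
            refine ENNReal.tsum_le_tsum fun b => ?_
            rw [ENNReal.tsum_mul_left]
            exact mul_le_of_le_one_right' (tsum_ite_val_le _)
  refine (ENNReal.tsum_le_tsum key).trans ?_
  rw [ENNReal.tsum_mul_right, sq, ← mul_assoc]
  refine mul_le_mul' ?_ le_rfl
  rw [ENNReal.tsum_comm]
  calc ∑' x : NZ × β, ∑' l : NZ, (if x.1.1 + s x.2 = l.1 then g x.1 ^ 2 * h x.2 else 0)
      ≤ ∑' x : NZ × β, g x.1 ^ 2 * h x.2 := by
        refine ENNReal.tsum_le_tsum fun x => ?_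
        have : ∀ l : NZ, (if x.1.1 + s x.2 = l.1 then g x.1 ^ 2 * h x.2 else 0) =
            g x.1 ^ 2 * h x.2 * (if l.1 = x.1.1 + s x.2 then 1 else 0) := by
          intro l
          simp only [eq_comm (a := l.1)]
          split_ifs <;> simp
        simp_rw [this, ENNReal.tsum_mul_left]
        exact mul_le_of_le_one_right' (tsum_ite_val_le _)
    _ = (∑' a, g a ^ 2) * ∑' b, h b := by
        rw [ENNReal.tsum_prod']
        simp_rw [ENNReal.tsum_mul_left, ENNReal.tsum_mul_right]

/-- Young's inequality for a convolution with one factor in `ℓ²` and the others in `ℓ¹`. -/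
theorem convolution_prod_le {m : ℕ} (f : Fin m → NZ → ℝ≥0∞) (i : Fin m) :
    ∑' l : NZ, (∑' j : Fin m → NZ, if ∑ k, (j k).1 = l.1 then ∏ k, f k (j k) else 0) ^ 2 ≤
      (∑' a, f i a ^ 2) * ∏ k ∈ Finset.univ.erase i, (∑' a, f k a) ^ 2 := by
  obtain _ | n := m
  · exact i.elim0
  have h := convolution_le (f i) (fun b : Fin n → NZ => ∏ k, f (i.succAbove k) (b k))
    (fun b => ∑ k, (b k).1)
  rw [ENNReal_tsum_prod_pi (fun k => f (i.succAbove k)), ← Finset.prod_pow] at h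
  have h2 : ∏ k ∈ Finset.univ.erase i, (∑' a, f k a) ^ 2 =
      ∏ k, (∑' a, f (i.succAbove k) a) ^ 2 := by
    rw [Fin.univ_succAbove n i, Finset.erase_cons, Finset.prod_map]
    rfl
  rw [h2]
  refine le_of_eq_of_le (tsum_congr fun l => ?_) h
  rw [← (Fin.insertNthEquiv (fun _ : Fin (n + 1) => NZ) i).tsum_eq]
  congr 1
  refine tsum_congr fun x => ?_
  simp [Fin.insertNthEquiv, Fin.sum_univ_succAbove _ i, Fin.prod_univ_succAbove _ i]

/-! ### Restriction of multilinear maps to the diagonal -/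

section Diagonal

variable {E E' : Type*} [NormedAddCommGroup E] [NormedSpace ℂ E] [NormedAddCommGroup E']
  [NormedSpace ℂ E'] {m : ℕ}

theorem analyticAt_diag (M : ContinuousMultilinearMap ℂ (fun _ : Fin m => E) E') (z : E) :
    AnalyticAt ℂ (fun x => M fun _ => x) z :=
  AnalyticAt.comp (g := M) (f := fun x _ => x) M.analyticAt
    ((ContinuousLinearMap.pi fun _ : Fin m => ContinuousLinearMap.id ℂ E).analyticAt z)

theorem hasFDerivAt_diag (M : ContinuousMultilinearMap ℂ (fun _ : Fin m => E) E') (z : E) :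
    HasFDerivAt (fun x => M fun _ => x) ((M.linearDeriv fun _ => z).comp
      (ContinuousLinearMap.pi fun _ => ContinuousLinearMap.id ℂ E)) z :=
  HasFDerivAt.comp (g := M) (f := fun x _ => x) z (M.hasFDerivAt fun _ => z)
    (ContinuousLinearMap.pi fun _ => ContinuousLinearMap.id ℂ E).hasFDerivAt

theorem fderiv_diag_apply (M : ContinuousMultilinearMap ℂ (fun _ : Fin m => E) E') (z v : E) :
    fderiv ℂ (fun x => M fun _ => x) z v = ∑ i, M (Function.update (fun _ => z) i v) := by
  rw [(hasFDerivAt_diag M z).fderiv]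
  simp [ContinuousMultilinearMap.linearDeriv_apply]

end Diagonal

/-! ### Multilinear maps into `h_{p+1}` -/

/-- The kernel of a multilinear map with values in sequences: it conserves momentum and is
bounded by products of the `δ_j`. -/
def KerBdd {m : ℕ} (d : NZ → (Fin m → NZ) → ℂ) : Prop :=
  (∀ l j, ∑ k, (j k).1 ≠ l.1 → d l j = 0) ∧
    ∃ C : ℝ, 0 ≤ C ∧ ∀ l j, ‖d l j‖ ≤ C * del l * ∏ k, del (j k)

theorem KerBdd.bdd {m : ℕ} {d : NZ → (Fin m → NZ) → ℂ} (h : KerBdd d) (l : NZ) : Bdd (d l) := by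
  obtain ⟨C, -, hC⟩ := h.2
  exact ⟨C * del l, hC l⟩

/-- The largest `|j k|` is at least `|l| / m`. There is such an entry because `l ≠ 0` excludes `m =
0`. -/
theorem weight_le_sum {m : ℕ} {s : ℝ} (hs : 0 ≤ s) (l : NZ) (j : Fin m → NZ)
    (h : ∑ k, (j k).1 = l.1) : weight s l ≤ (m : ℝ) ^ s * ∑ k, weight s (j k) := by
  have h1 : |(l.1 : ℝ)| ≤ ∑ k, |((j k).1 : ℝ)| := by
    rw [← h]
    push_cast
    exact Finset.abs_sum_le_sum_abs _ _
  have hm : (Finset.univ : Finset (Fin m)).Nonempty := by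
    by_contra hne
    rw [Finset.not_nonempty_iff_eq_empty] at hne
    rw [hne, Finset.sum_empty] at h
    exact l.2 h.symm
  obtain ⟨i, -, hi⟩ := Finset.exists_max_image Finset.univ (fun k => |((j k).1 : ℝ)|) hm
  have h2 : |(l.1 : ℝ)| ≤ m * |((j i).1 : ℝ)| := by
    refine h1.trans ((Finset.sum_le_card_nsmul _ _ _ hi).trans ?_)
    simp
  calc weight s l ≤ (m * |((j i).1 : ℝ)|) ^ s := Real.rpow_le_rpow (abs_nonneg _) h2 hs
    _ = (m : ℝ) ^ s * weight s (j i) := Real.mul_rpow (by positivity) (abs_nonneg _)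
    _ ≤ _ := by
      gcongr
      exact Finset.single_le_sum (f := fun k => weight s (j k))
        (fun k _ => (weight_pos _ _).le) (Finset.mem_univ i)

/-- The first half of the gained derivative, paid by the `δ` of the output index; the next lemma is
the second half, paid by the `δ` of the largest input index. -/
theorem weight_succ_mul_del_le (p : ℝ) (l : NZ) :
    weight (p + 1) l * del l ≤ weight (p + 1 / 2) l := by
  refine (mul_le_mul_of_nonneg_left (del_le_weight l) (weight_pos _ _).le).trans ?_
  rw [← weight_add]
  norm_num [add_assoc]

theorem weight_half_mul_del_le (p : ℝ) (l : NZ) :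
    weight (p + 1 / 2) l * del l ≤ weight p l := by
  refine (mul_le_mul_of_nonneg_left (del_le_weight l) (weight_pos _ _).le).trans ?_
  rw [← weight_add]
  norm_num [add_assoc]

open Classical in
-- The weight `p + 1` at `l` is reduced to `p + 1/2` by `δ_l`, moved to the inputs by momentum
-- conservation, and reduced to `p` by the `δ` of the input that receives it. In the `i`-th summand,
-- input `i` has weight `p` (an `ℓ²` factor) and the others keep their `δ` (`ℓ¹` factors).
theorem KerBdd.term_le {p : ℝ} (hp : 0 < p) {m : ℕ} {a : ℂ} {C : ℝ} (hC : 0 ≤ C) (l : NZ)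
    (j : Fin m → NZ) (hj : ∑ k, (j k).1 ≠ l.1 → a = 0) (ha : ‖a‖ ≤ C * del l * ∏ k, del (j k))
    (z : Fin m → H p) :
    ENNReal.ofReal (weight (p + 1) l) * ‖a * ∏ k, z k (j k)‖ₑ ≤
      ENNReal.ofReal (C * (m : ℝ) ^ (p + 1 / 2)) * ∑ i, if ∑ k, (j k).1 = l.1 then
        ∏ k, (if k = i then ENNReal.ofReal (weight p (j k)) * ‖z k (j k)‖ₑ
          else ENNReal.ofReal (del (j k)) * ‖z k (j k)‖ₑ) else 0 := by
  by_cases h : ∑ k, (j k).1 = l.1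
  swap
  · simp [hj h]
  simp only [h, if_true]
  have hprod : ∀ i, ∏ k, (if k = i then ENNReal.ofReal (weight p (j k)) * ‖z k (j k)‖ₑ
      else ENNReal.ofReal (del (j k)) * ‖z k (j k)‖ₑ) =
      ENNReal.ofReal (weight p (j i) * ∏ k ∈ Finset.univ.erase i, del (j k)) *
        ∏ k, ‖z k (j k)‖ₑ := by
    intro i
    have : ∀ k, (if k = i then ENNReal.ofReal (weight p (j k)) * ‖z k (j k)‖ₑ
        else ENNReal.ofReal (del (j k)) * ‖z k (j k)‖ₑ) =
        (if k = i then ENNReal.ofReal (weight p (j k)) else ENNReal.ofReal (del (j k))) *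
          ‖z k (j k)‖ₑ := by
      intro k; split_ifs <;> rfl
    simp_rw [this]
    rw [Finset.prod_mul_distrib]
    congr 1
    rw [← Finset.mul_prod_erase _ _ (Finset.mem_univ i), if_pos rfl,
      ENNReal.ofReal_mul (weight_pos _ _).le,
      ENNReal.ofReal_prod_of_nonneg fun k _ => (del_pos _).le]
    congr 1
    refine Finset.prod_congr rfl fun k hk => ?_
    rw [if_neg (Finset.ne_of_mem_erase hk)]
  simp_rw [hprod]
  rw [← Finset.sum_mul, enorm_mul, enorm_finset_prod, ← mul_assoc, ← mul_assoc]
  refine mul_le_mul' ?_ le_rfl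
  rw [← ENNReal.ofReal_sum_of_nonneg
    (fun i _ => mul_nonneg (weight_pos _ _).le (Finset.prod_nonneg fun k _ => (del_pos _).le)),
    ← ENNReal.ofReal_mul (by positivity), ← ofReal_norm, ← ENNReal.ofReal_mul (weight_pos _ _).le]
  refine ENNReal.ofReal_le_ofReal ?_
  have hD := prod_del_pos j
  calc weight (p + 1) l * ‖a‖ ≤ weight (p + 1) l * (C * del l * ∏ k, del (j k)) :=
        mul_le_mul_of_nonneg_left ha (weight_pos _ _).le
    _ = C * (weight (p + 1) l * del l) * ∏ k, del (j k) := by ring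
    _ ≤ C * ((m : ℝ) ^ (p + 1 / 2) * ∑ k, weight (p + 1 / 2) (j k)) * ∏ k, del (j k) := by
        have h3 := (weight_succ_mul_del_le p l).trans (weight_le_sum (by linarith) l j h)
        exact mul_le_mul_of_nonneg_right (mul_le_mul_of_nonneg_left h3 hC) hD.le
    _ = C * (m : ℝ) ^ (p + 1 / 2) * ∑ i, weight (p + 1 / 2) (j i) * ∏ k, del (j k) := by
        rw [← Finset.sum_mul]; ring
    _ ≤ _ := by
        refine mul_le_mul_of_nonneg_left (Finset.sum_le_sum fun i _ => ?_) (by positivity)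
        rw [← Finset.mul_prod_erase _ _ (Finset.mem_univ i), ← mul_assoc]
        refine mul_le_mul_of_nonneg_right (weight_half_mul_del_le p (j i))
          (Finset.prod_nonneg fun k _ => (del_pos _).le)

open Classical in
-- The gain of one derivative: the termwise bound is a sum of `m` convolutions, to each of which
-- Young's inequality applies.
theorem KerBdd.exists_tsum_le {p : ℝ} (hp : 0 < p) {m : ℕ} {d : NZ → (Fin m → NZ) → ℂ}
    (hd : KerBdd d) : ∃ B : ℝ, 0 ≤ B ∧ ∀ z : Fin m → H p,
      ∑' l, (ENNReal.ofReal (weight (p + 1) l) * ‖mform (d l) z‖ₑ) ^ 2 ≤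
        ENNReal.ofReal (B * ∏ i, ‖z i‖) ^ 2 := by
  obtain ⟨C, hC, hdC⟩ := hd.2
  obtain ⟨K, hK, hKz⟩ := exists_tsum_del_le hp
  have hK0 : 0 ≤ K := by linarith
  obtain ⟨A, hAdef⟩ : ∃ A : ℝ, A = C * (m : ℝ) ^ (p + 1 / 2) := ⟨_, rfl⟩
  have hA : 0 ≤ A := by rw [hAdef]; positivity
  -- `A` comes from the termwise bound and `K ^ m` from the `ℓ¹` norms. The square of a sum of `m`
  -- terms costs a factor `m`, and summing the `m` squares another, which gives `m` after taking
  -- roots.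
  refine ⟨A * m * K ^ m, by positivity, fun z => ?_⟩
  set f : Fin m → Fin m → NZ → ℝ≥0∞ := fun i k a =>
    if k = i then ENNReal.ofReal (weight p a) * ‖z k a‖ₑ else ENNReal.ofReal (del a) * ‖z k a‖ₑ
  set Q : Fin m → NZ → ℝ≥0∞ := fun i l =>
    ∑' j : Fin m → NZ, if ∑ k, (j k).1 = l.1 then ∏ k, f i k (j k) else 0
  have h1 : ∀ l, ENNReal.ofReal (weight (p + 1) l) * ‖mform (d l) z‖ₑ ≤
      ENNReal.ofReal A * ∑ i, Q i l := by
    intro l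
    refine (mul_le_mul' le_rfl enorm_tsum_le_tsum_enorm).trans ?_
    rw [← ENNReal.tsum_mul_left, ← Summable.tsum_finsetSum fun _ _ => ENNReal.summable,
      ← ENNReal.tsum_mul_left]
    rw [hAdef]
    exact ENNReal.tsum_le_tsum fun j => KerBdd.term_le hp hC l j (hd.1 l j) (hdC l j) z
  have h2 : ∀ i, ∑' l, Q i l ^ 2 ≤ (ENNReal.ofReal (K ^ m) * ∏ k, ‖z k‖ₑ) ^ 2 := by
    intro i
    refine (convolution_prod_le (f i) i).trans ?_
    -- No constant is needed for the `ℓ²` factor; `1 ≤ K` is used only to make all factors alike.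
    have e1 : ∑' a, f i i a ^ 2 ≤ (ENNReal.ofReal K * ‖z i‖ₑ) ^ 2 := by
      simp only [f, if_true]
      rw [← H.enorm_sq]
      gcongr
      exact le_mul_of_one_le_left' (by rw [← ENNReal.ofReal_one]; exact ENNReal.ofReal_le_ofReal hK)
    have e2 : ∀ k ∈ Finset.univ.erase i,
        (∑' a, f i k a) ^ 2 ≤ (ENNReal.ofReal K * ‖z k‖ₑ) ^ 2 := by
      intro k hk
      simp only [f, if_neg (Finset.ne_of_mem_erase hk)]
      gcongr
      exact hKz (z k)
    refine (mul_le_mul' e1 (Finset.prod_le_prod' e2)).trans (le_of_eq ?_)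
    rw [Finset.mul_prod_erase _ (fun k => (ENNReal.ofReal K * ‖z k‖ₑ) ^ 2) (Finset.mem_univ i),
      Finset.prod_pow, Finset.prod_mul_distrib, Finset.prod_const, Finset.card_univ,
      Fintype.card_fin, ENNReal.ofReal_pow hK0]
  have h3 : ∀ l, (∑ i, Q i l) ^ 2 ≤ m * ∑ i, Q i l ^ 2 := by
    intro l
    have h := ENNReal_tsum_mul_sq_le (fun _ : Fin m => 1) (fun i => Q i l)
    simpa [tsum_fintype] using h
  calc ∑' l, (ENNReal.ofReal (weight (p + 1) l) * ‖mform (d l) z‖ₑ) ^ 2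
      ≤ ∑' l, ENNReal.ofReal A ^ 2 * (m * ∑ i, Q i l ^ 2) := by
        refine ENNReal.tsum_le_tsum fun l => (pow_le_pow_left' (h1 l) 2).trans ?_
        rw [mul_pow]
        gcongr
        exact h3 l
    _ = ENNReal.ofReal A ^ 2 * (m * ∑ i, ∑' l, Q i l ^ 2) := by
        rw [ENNReal.tsum_mul_left, ENNReal.tsum_mul_left,
          Summable.tsum_finsetSum fun _ _ => ENNReal.summable]
    _ ≤ ENNReal.ofReal A ^ 2 * (m * ∑ _i : Fin m, (ENNReal.ofReal (K ^ m) * ∏ k, ‖z k‖ₑ) ^ 2) := by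
        gcongr with i
        exact h2 i
    _ = _ := by
        have : 0 ≤ ∏ k, ‖z k‖ := Finset.prod_nonneg fun i _ => norm_nonneg _
        rw [ENNReal.ofReal_mul (by positivity),
          ENNReal.ofReal_mul (p := A * m) (by positivity), ENNReal.ofReal_mul hA, ENNReal.ofReal_prod_of_nonneg fun i _ => norm_nonneg _]
        simp only [ofReal_norm, ENNReal.ofReal_natCast, Finset.sum_const, Finset.card_univ,
          Fintype.card_fin, nsmul_eq_mul]
        ring

/-- The continuous multilinear map with kernel `d` from `h_p` to `h_{p+1}`. -/
def fieldL {p : ℝ} (hp : 0 < p) {m : ℕ} {d : NZ → (Fin m → NZ) → ℂ} (hd : KerBdd d) :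
    ContinuousMultilinearMap ℂ (fun _ : Fin m => H p) (H (p + 1)) :=
  MultilinearMap.mkContinuous
    { toFun := fun z => ⟨fun l => mform (d l) z, H.mem_of_tsum_ne_top (ne_top_of_le_ne_top
        (ENNReal.pow_ne_top ENNReal.ofReal_ne_top) ((hd.exists_tsum_le hp).choose_spec.2 z))⟩
      map_update_add' := fun z _ x y =>
        H.ext fun l => (mformL hp (hd.bdd l)).map_update_add z _ x y
      map_update_smul' := fun z i a x =>
        H.ext fun l => (mformL hp (hd.bdd l)).map_update_smul z i a x }
    (hd.exists_tsum_le hp).choose (fun z => H.norm_le_of_tsum_le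
      (mul_nonneg (hd.exists_tsum_le hp).choose_spec.1
        (Finset.prod_nonneg fun _ _ => norm_nonneg _))
      ((hd.exists_tsum_le hp).choose_spec.2 z))

/-! ### Derivatives of polynomials -/

/-- The coefficients of the partial derivative `∂/∂z_l` of a polynomial. -/
def pdCoeff {m : ℕ} (c : (Fin (m + 1) → NZ) → ℂ) (l : NZ) (j : Fin m → NZ) : ℂ :=
  ∑ i : Fin (m + 1), c (i.insertNth l j)

/-- The kernel of the Hamiltonian vector field of a polynomial. -/
def hamKer {m : ℕ} (c : (Fin (m + 1) → NZ) → ℂ) (l : NZ) (j : Fin m → NZ) : ℂ :=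
  -Complex.I * sgn l * pdCoeff c (opp l) j

theorem sum_insertNth {m : ℕ} (i : Fin (m + 1)) (l : NZ) (j : Fin m → NZ) :
    ∑ k, ((i.insertNth l j : Fin (m + 1) → NZ) k).1 = l.1 + ∑ k, (j k).1 := by
  simp [Fin.sum_univ_succAbove _ i]

theorem prod_insertNth {M : Type*} [CommMonoid M] {m : ℕ} (i : Fin (m + 1)) (l : NZ)
    (j : Fin m → NZ) (f : NZ → M) :
    ∏ k, f ((i.insertNth l j : Fin (m + 1) → NZ) k) = f l * ∏ k, f (j k) := by
  simp [Fin.prod_univ_succAbove _ i]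

theorem Admissible.pdCoeff_eq_zero {m : ℕ} {c : (Fin (m + 1) → NZ) → ℂ} (hc : Admissible c)
    {l : NZ} {j : Fin m → NZ} (h : l.1 + ∑ k, (j k).1 ≠ 0) : pdCoeff c l j = 0 :=
  Finset.sum_eq_zero fun i _ => hc.1 _ (by rwa [sum_insertNth])

theorem Bdd.exists_norm_pdCoeff_le {m : ℕ} {c : (Fin (m + 1) → NZ) → ℂ} (hc : Bdd c) :
    ∃ C : ℝ, 0 ≤ C ∧ ∀ l j, ‖pdCoeff c l j‖ ≤ C * del l * ∏ k, del (j k) := by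
  obtain ⟨C, hC, h⟩ := hc.exists_nonneg
  refine ⟨(m + 1) * C, by positivity, fun l j => ?_⟩
  calc ‖pdCoeff c l j‖ ≤ ∑ i : Fin (m + 1), ‖c (i.insertNth l j)‖ := norm_sum_le _ _
    _ ≤ ∑ _i : Fin (m + 1), C * (del l * ∏ k, del (j k)) := by
        refine Finset.sum_le_sum fun i _ => (h _).trans (le_of_eq ?_)
        rw [prod_insertNth i l j del]
    _ = _ := by simp; ring

theorem Bdd.pdCoeff {m : ℕ} {c : (Fin (m + 1) → NZ) → ℂ} (hc : Bdd c) (l : NZ) :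
    Bdd (pdCoeff c l) := by
  obtain ⟨C, -, h⟩ := hc.exists_norm_pdCoeff_le
  exact ⟨C * del l, h l⟩

theorem Admissible.kerBdd {m : ℕ} {c : (Fin (m + 1) → NZ) → ℂ} (hc : Admissible c) :
    KerBdd (hamKer c) := by
  refine ⟨fun l j h => ?_, ?_⟩
  · rw [hamKer, hc.pdCoeff_eq_zero, mul_zero]
    rw [opp_val]
    omega
  · obtain ⟨C, hC, h⟩ := hc.bdd.exists_norm_pdCoeff_le
    refine ⟨C, hC, fun l j => ?_⟩
    simpa [hamKer] using h (opp l) j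

theorem poly_smul {p : ℝ} {m : ℕ} (a : ℂ) (c : (Fin m → NZ) → ℂ) (z : H p) :
    poly (fun j => a * c j) z = a * poly c z := by
  rw [poly, poly, ← tsum_mul_left]
  exact tsum_congr fun j => mul_assoc _ _ _

theorem poly_add {p : ℝ} (hp : 0 < p) {m : ℕ} {c d : (Fin m → NZ) → ℂ} (hc : Bdd c) (hd : Bdd d)
    (z : H p) : poly (fun j => c j + d j) z = poly c z + poly d z := by
  rw [poly, poly, poly, ← (hc.summable hp fun _ => z).tsum_add (hd.summable hp fun _ => z)]
  exact tsum_congr fun j => add_mul _ _ _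

theorem poly_hasFDerivAt {p : ℝ} (hp : 0 < p) {m : ℕ} {c : (Fin m → NZ) → ℂ} (hc : Bdd c)
    (z : H p) : HasFDerivAt (poly c : H p → ℂ)
      (((mformL hp hc).linearDeriv fun _ => z).comp
        (ContinuousLinearMap.pi fun _ => ContinuousLinearMap.id ℂ (H p))) z :=
  hasFDerivAt_diag (mformL hp hc) z

theorem poly_analyticAt {p : ℝ} (hp : 0 < p) {m : ℕ} {c : (Fin m → NZ) → ℂ} (hc : Bdd c)
    (z : H p) : AnalyticAt ℂ (poly c : H p → ℂ) z :=
  analyticAt_diag (mformL hp hc) z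

theorem poly_fderiv {p : ℝ} (hp : 0 < p) {m : ℕ} {c : (Fin m → NZ) → ℂ} (hc : Bdd c)
    (z v : H p) : fderiv ℂ (poly c : H p → ℂ) z v =
      ∑ i, mform c (Function.update (fun _ => z) i v) := by
  rw [(poly_hasFDerivAt hp hc z).fderiv]
  simp [ContinuousMultilinearMap.linearDeriv_apply]

theorem pderiv_poly {p : ℝ} (hp : 0 < p) {m : ℕ} {c : (Fin (m + 1) → NZ) → ℂ} (hc : Bdd c)
    (z : H p) (l : NZ) : pderiv (poly c : H p → ℂ) z l = poly (pdCoeff c l) z := by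
  have key : ∀ i : Fin (m + 1), mform c (Function.update (fun _ => z) i (H.unit p l)) =
      ∑' j : Fin m → NZ, c (i.insertNth l j) * ∏ k, z (j k) := by
    intro i
    have hinj : Function.Injective fun j : Fin m → NZ => (i.insertNth l j : Fin (m + 1) → NZ) :=
      fun a b h => Fin.insertNth_right_injective (α := fun _ => NZ) (p := i) l h
    -- The unit sequence in slot `i` leaves only the multi-indices with `j i = l`, and these are the
    -- range of `insertNth`.
    rw [mform, ← hinj.tsum_eq]
    · refine tsum_congr fun j => ?_
      rw [Fin.prod_univ_succAbove _ i]
      simp [H.unit_apply]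
    · intro j hj
      by_cases h : j i = l
      · exact ⟨i.removeNth j, by rw [← h]; exact Fin.insertNth_self_removeNth i j⟩
      · exfalso
        apply hj
        change c j * _ = 0
        rw [Fin.prod_univ_succAbove _ i]
        simp [H.unit_apply, h]
  rw [pderiv, poly_fderiv hp hc]
  simp_rw [key]
  have hs : ∀ i : Fin (m + 1),
      Summable fun j : Fin m → NZ => c (i.insertNth l j) * ∏ k, z (j k) := by
    intro i
    have hb : Bdd fun j : Fin m → NZ => c (i.insertNth l j) := by
      obtain ⟨C, hC⟩ := hc
      refine ⟨C * del l, fun j => (hC _).trans (le_of_eq ?_)⟩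
      rw [prod_insertNth i l j del, mul_assoc]
    exact hb.summable hp fun _ => z
  rw [← Summable.tsum_finsetSum fun i _ => hs i, poly]
  refine tsum_congr fun j => ?_
  rw [pdCoeff, Finset.sum_mul]

theorem hamVec_poly {p : ℝ} (hp : 0 < p) {m : ℕ} {c : (Fin (m + 1) → NZ) → ℂ} (hc : Bdd c)
    (z : H p) (l : NZ) : hamVec (poly c : H p → ℂ) z l = poly (hamKer c l) z := by
  rw [hamVec, pderiv_poly hp hc, ← poly_smul]
  rfl

/-- The Hamiltonian vector field of an admissible polynomial, with values in `h_{p+1}`. -/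
def field {p : ℝ} (hp : 0 < p) {m : ℕ} {c : (Fin (m + 1) → NZ) → ℂ} (hc : Admissible c)
    (z : H p) : H (p + 1) := fieldL hp hc.kerBdd fun _ => z

theorem field_apply {p : ℝ} (hp : 0 < p) {m : ℕ} {c : (Fin (m + 1) → NZ) → ℂ}
    (hc : Admissible c) (z : H p) (l : NZ) :
    field hp hc z l = hamVec (poly c : H p → ℂ) z l := by
  rw [hamVec_poly hp hc.bdd]
  rfl

theorem field_analyticAt {p : ℝ} (hp : 0 < p) {m : ℕ} {c : (Fin (m + 1) → NZ) → ℂ}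
    (hc : Admissible c) (z : H p) : AnalyticAt ℂ (field hp hc) z :=
  analyticAt_diag (fieldL hp hc.kerBdd) z

theorem poly_hasAnalyticField {p : ℝ} (hp : 0 < p) {m : ℕ} {c : (Fin (m + 1) → NZ) → ℂ}
    (hc : Admissible c) : HasAnalyticField (p + 1) (poly c : H p → ℂ) :=
  ⟨field hp hc, field_analyticAt hp hc 0, Eventually.of_forall fun z j => field_apply hp hc z j⟩

theorem exists_norm_poly_le {p : ℝ} (hp : 0 < p) {m : ℕ} {c : (Fin m → NZ) → ℂ} (hc : Bdd c) :
    ∃ B : ℝ, 0 ≤ B ∧ ∀ z : H p, ‖poly c z‖ ≤ B * ‖z‖ ^ m := by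
  obtain ⟨B, hB, h⟩ := hc.exists_norm_mform_le (p := p) hp
  refine ⟨B, hB, fun z => ?_⟩
  simpa [poly_eq_mform] using h fun _ => z

/-! ### Derivatives in coordinates, Poisson brackets and the symplectic form -/

section Bracket

variable {p : ℝ}

theorem hasSum_apply_unit (L : H p →L[ℂ] ℂ) (v : H p) :
    HasSum (fun j => L (H.unit p j) * v j) (L v) := by
  have h := (H.hasSum_unit v).mapL L
  simpa [mul_comm] using h

theorem fderiv_eq_tsum (A : H p → ℂ) (z v : H p) :
    fderiv ℂ A z v = ∑' j, pderiv A z j * v j :=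
  (hasSum_apply_unit (fderiv ℂ A z) v).tsum_eq.symm

/-- This replaces the coordinate sum by a directional derivative as soon as the field of `B` is a
vector of `h_p`. -/
theorem poisson_eq_fderiv {A B : H p → ℂ} {z X : H p} (h : ∀ j, X j = hamVec B z j) :
    poisson A B z = fderiv ℂ A z X := by
  rw [fderiv_eq_tsum, poisson]
  exact tsum_congr fun j => by rw [h]

/-- The Hamiltonian vector field of an admissible polynomial as a vector field on `h_p`. -/
def vfield (hp : 0 < p) {m : ℕ} {c : (Fin (m + 1) → NZ) → ℂ} (hc : Admissible c) (z : H p) :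
    H p := H.incl (by linarith : p ≤ p + 1) (field hp hc z)

theorem vfield_apply (hp : 0 < p) {m : ℕ} {c : (Fin (m + 1) → NZ) → ℂ} (hc : Admissible c)
    (z : H p) (j : NZ) : vfield hp hc z j = hamVec (poly c : H p → ℂ) z j :=
  field_apply hp hc z j

theorem poisson_poly_right (hp : 0 < p) {m : ℕ} {c : (Fin (m + 1) → NZ) → ℂ} (hc : Admissible c)
    (A : H p → ℂ) (z : H p) : poisson A (poly c) z = fderiv ℂ A z (vfield hp hc z) :=
  poisson_eq_fderiv (vfield_apply hp hc z)

/-- For `p ≥ 0` the weights are at least one, so `h_p` lies in `ℓ²` and Cauchy–Schwarz applies. -/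
theorem tsum_symp_le (hp : 0 ≤ p) (u v : H p) :
    ∑' j : NZ, ‖sgn j * (u j * v (opp j))‖ₑ ≤ ‖u‖ₑ * ‖v‖ₑ := by
  have h1 : ∀ w : H p, ∑' j, ‖w j‖ₑ ^ 2 ≤ ‖w‖ₑ ^ 2 := by
    intro w
    rw [H.enorm_sq]
    refine ENNReal.tsum_le_tsum fun j => ?_
    gcongr
    refine le_mul_of_one_le_left' ?_
    rw [← ENNReal.ofReal_one]
    exact ENNReal.ofReal_le_ofReal (one_le_weight hp j)
  have h2 : ∑' j : NZ, ‖v (opp j)‖ₑ ^ 2 = ∑' j, ‖v j‖ₑ ^ 2 :=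
    oppEquiv.tsum_eq fun j => ‖v j‖ₑ ^ 2
  refine (ENNReal.pow_le_pow_left_iff two_ne_zero).mp ?_
  have h3 : ∀ j, ‖sgn j * (u j * v (opp j))‖ₑ = ‖u j‖ₑ * ‖v (opp j)‖ₑ := by
    intro j
    rw [enorm_mul, enorm_mul, ← ofReal_norm (sgn j), norm_sgn, ENNReal.ofReal_one, one_mul]
  simp_rw [h3]
  refine (ENNReal_tsum_mul_sq_le _ _).trans ?_
  rw [h2, mul_pow]
  exact mul_le_mul' (h1 u) (h1 v)

theorem summable_symp (hp : 0 ≤ p) (u v : H p) :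
    Summable fun j : NZ => sgn j * (u j * v (opp j)) :=
  summable_of_tsum_enorm_ne_top (ne_top_of_le_ne_top
    (ENNReal.mul_ne_top enorm_ne_top enorm_ne_top) (tsum_symp_le hp u v))

/-- The symplectic form as a continuous bilinear map. -/
def sympL (hp : 0 ≤ p) : H p →L[ℂ] H p →L[ℂ] ℂ :=
  LinearMap.mkContinuous₂
    (LinearMap.mk₂ ℂ (symp (p := p))
      (fun x y v => by
        simp only [symp]
        rw [← mul_add, ← (summable_symp hp x v).tsum_add (summable_symp hp y v)]
        congr 1
        exact tsum_congr fun j => by rw [H.add_apply]; ring)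
      (fun a x v => by
        simp only [symp, smul_eq_mul]
        rw [mul_left_comm]
        congr 1
        rw [← tsum_mul_left]
        exact tsum_congr fun j => by rw [H.smul_apply]; ring)
      (fun x v w => by
        simp only [symp]
        rw [← mul_add, ← (summable_symp hp x v).tsum_add (summable_symp hp x w)]
        congr 1
        exact tsum_congr fun j => by rw [H.add_apply]; ring)
      (fun a x v => by
        simp only [symp, smul_eq_mul]
        rw [mul_left_comm]
        congr 1
        rw [← tsum_mul_left]
        exact tsum_congr fun j => by rw [H.smul_apply]; ring)) 1 (fun u v => by
    have h : ‖symp u v‖ₑ ≤ ‖u‖ₑ * ‖v‖ₑ := by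
      rw [symp, enorm_mul, ← ofReal_norm (-Complex.I)]
      simp only [norm_neg, Complex.norm_I, ENNReal.ofReal_one, one_mul]
      exact enorm_tsum_le_tsum_enorm.trans (tsum_symp_le hp u v)
    rw [← ofReal_norm, ← ofReal_norm, ← ofReal_norm, ← ENNReal.ofReal_mul (norm_nonneg _),
      ENNReal.ofReal_le_ofReal_iff (by positivity)] at h
    simpa using h)

theorem symp_swap (u v : H p) : symp u v = -symp v u := by
  rw [symp, symp, ← mul_neg, ← tsum_neg, ← oppEquiv.tsum_eq]
  congr 1
  refine tsum_congr fun j => ?_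
  simp only [oppEquiv_apply, sgn_opp, opp_opp]
  ring

theorem symp_unit (y : H p) (l : NZ) : symp y (H.unit p l) = Complex.I * sgn l * y (opp l) := by
  rw [symp, tsum_eq_single (opp l)]
  · simp [H.unit_apply]
    ring
  · intro j hj
    rw [H.unit_apply, if_neg fun h => hj (opp_eq_iff.mp h)]
    simp

/-- Together with its converse `hamVec_eq_of_symp`, this describes Hamiltonian fields without
coordinates, which is what compositions with symplectic maps require. -/
theorem symp_hamVec {A : H p → ℂ} {z X : H p} (h : ∀ j, X j = hamVec A z j) (v : H p) :
    symp X v = -fderiv ℂ A z v := by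
  rw [fderiv_eq_tsum, symp, ← tsum_mul_left, ← tsum_neg, ← oppEquiv.tsum_eq]
  refine tsum_congr fun j => ?_
  simp only [oppEquiv_apply, h, hamVec, sgn_opp, opp_opp]
  linear_combination (pderiv A z j * v j) * Complex.I ^ 2 * sgn_mul_self j +
    (pderiv A z j * v j) * Complex.I_sq

theorem hamVec_eq_of_symp {A : H p → ℂ} {z Y : H p}
    (h : ∀ l, symp Y (H.unit p l) = -pderiv A z l) (j : NZ) : Y j = hamVec A z j := by
  have h1 := h (opp j)
  rw [symp_unit, opp_opp, sgn_opp] at h1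
  rw [hamVec]
  linear_combination (Complex.I * sgn j) * h1 + Y j * Complex.I ^ 2 * sgn_mul_self j +
    Y j * Complex.I_sq

end Bracket

/-! ### Brackets of polynomials -/

/-- The coefficients of the Poisson bracket of two polynomials. -/
def bracketCoeff {a b : ℕ} (c : (Fin (a + 1) → NZ) → ℂ) (d : (Fin (b + 1) → NZ) → ℂ)
    (x : Fin (a + b) → NZ) : ℂ :=
  ∑' l : NZ, pdCoeff c l (fun i => x (Fin.castAdd b i)) * hamKer d l (fun i => x (Fin.natAdd a i))

section BracketCoeff

variable {a b : ℕ} {c : (Fin (a + 1) → NZ) → ℂ} {d : (Fin (b + 1) → NZ) → ℂ}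

theorem exists_bracket_term_le (hc : Admissible c) (hd : Admissible d) :
    ∃ C : ℝ, 0 ≤ C ∧ ∀ (l : NZ) (x : Fin (a + b) → NZ),
      ‖pdCoeff c l (fun i => x (Fin.castAdd b i)) * hamKer d l (fun i => x (Fin.natAdd a i))‖ ≤
        C * ∏ i, del (x i) := by
  obtain ⟨C, hC, h1⟩ := hc.bdd.exists_norm_pdCoeff_le
  obtain ⟨C', hC', h2⟩ := hd.kerBdd.2
  refine ⟨C * C', by positivity, fun l x => ?_⟩
  rw [norm_mul, Fin.prod_univ_add]
  have e1 : ‖pdCoeff c l (fun i => x (Fin.castAdd b i))‖ ≤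
      C * ∏ i, del (x (Fin.castAdd b i)) := by
    refine (h1 l _).trans (mul_le_mul_of_nonneg_right ?_ (prod_del_pos _).le)
    exact mul_le_of_le_one_right hC (del_le_one l)
  have e2 : ‖hamKer d l (fun i => x (Fin.natAdd a i))‖ ≤
      C' * ∏ i, del (x (Fin.natAdd a i)) := by
    refine (h2 l _).trans (mul_le_mul_of_nonneg_right ?_ (prod_del_pos _).le)
    exact mul_le_of_le_one_right hC' (del_le_one l)
  refine (mul_le_mul e1 e2 (norm_nonneg _)
    (mul_nonneg hC (prod_del_pos _).le)).trans (le_of_eq (by ring))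

theorem bracket_term_eq_zero (hc : Admissible c) (hd : Admissible d) {l : NZ}
    {x : Fin (a + b) → NZ} (h : l.1 ≠ ∑ i, (x (Fin.natAdd a i)).1 ∨ ∑ i, (x i).1 ≠ 0) :
    pdCoeff c l (fun i => x (Fin.castAdd b i)) * hamKer d l (fun i => x (Fin.natAdd a i)) = 0 := by
  by_cases h1 : ∑ i, (x (Fin.natAdd a i)).1 = l.1
  · rw [hc.pdCoeff_eq_zero, zero_mul]
    rw [Fin.sum_univ_add] at h
    omega
  · rw [hd.kerBdd.1 _ _ h1, mul_zero]

/-- Momentum conservation of the second factor fixes `l`, so the sum over `l` has at most one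
nonzero term, and none if the prescribed value is zero. The two factors `δ_l` of that term are
bounded by one. -/
theorem Admissible.bracket (hc : Admissible c) (hd : Admissible d) :
    Admissible (bracketCoeff c d) := by
  constructor
  · intro x hx
    rw [bracketCoeff]
    simp_rw [bracket_term_eq_zero hc hd (Or.inr hx)]
    exact tsum_zero
  · obtain ⟨C, hC, h⟩ := exists_bracket_term_le hc hd
    refine ⟨C, fun x => ?_⟩
    rw [bracketCoeff]
    by_cases hs : ∑ i, (x (Fin.natAdd a i)).1 = 0
    · have : ∀ l : NZ, l.1 ≠ ∑ i, (x (Fin.natAdd a i)).1 := fun l => by rw [hs]; exact l.2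
      simp_rw [fun l => bracket_term_eq_zero hc hd (Or.inl (this l))]
      rw [tsum_zero, norm_zero]
      exact mul_nonneg hC (prod_del_pos _).le
    · rw [tsum_eq_single (⟨∑ i, (x (Fin.natAdd a i)).1, hs⟩ : NZ)]
      · exact h _ _
      · intro l hl
        exact bracket_term_eq_zero hc hd (Or.inl fun e => hl (Subtype.ext e))

/-- Absolute summability over both `l` and the multi-index, which justifies the exchange of sums in
`poisson_poly`. -/
theorem summable_bracket {p : ℝ} (hp : 0 < p) (hc : Admissible c) (hd : Admissible d) (z : H p) :
    Summable fun y : NZ × (Fin (a + b) → NZ) =>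
      pdCoeff c y.1 (fun i => y.2 (Fin.castAdd b i)) *
        hamKer d y.1 (fun i => y.2 (Fin.natAdd a i)) * ∏ i, z (y.2 i) := by
  obtain ⟨C, hC, h⟩ := exists_bracket_term_le hc hd
  obtain ⟨K, hK, hKz⟩ := exists_tsum_del_le hp
  refine summable_of_tsum_enorm_ne_top ?_
  rw [ENNReal.tsum_prod', ENNReal.tsum_comm]
  have h1 : ∀ (x : Fin (a + b) → NZ), ∑' l : NZ, ‖pdCoeff c l (fun i => x (Fin.castAdd b i)) *
        hamKer d l (fun i => x (Fin.natAdd a i)) * ∏ i, z (x i)‖ₑ ≤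
      ENNReal.ofReal C * ∏ i, (ENNReal.ofReal (del (x i)) * ‖z (x i)‖ₑ) := by
    intro x
    calc _ ≤ ∑' l : NZ, (ENNReal.ofReal C * ∏ i, (ENNReal.ofReal (del (x i)) * ‖z (x i)‖ₑ)) *
          (if l.1 = ∑ i, (x (Fin.natAdd a i)).1 then 1 else 0) := by
          refine ENNReal.tsum_le_tsum fun l => ?_
          split_ifs with hl
          · rw [mul_one]
            exact enorm_term_le hC x (h l x) fun _ => z
          · rw [bracket_term_eq_zero hc hd (Or.inl hl)]
            simp
      _ ≤ _ := by
          rw [ENNReal.tsum_mul_left]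
          exact mul_le_of_le_one_right' (tsum_ite_val_le _)
  refine ne_top_of_le_ne_top ?_ (ENNReal.tsum_le_tsum h1)
  rw [ENNReal.tsum_mul_left,
    ENNReal_tsum_prod_pi fun (_ : Fin (a + b)) j => ENNReal.ofReal (del j) * ‖z j‖ₑ]
  refine ENNReal.mul_ne_top ENNReal.ofReal_ne_top (ENNReal.prod_ne_top fun i _ => ?_)
  exact ne_top_of_le_ne_top (ENNReal.mul_ne_top ENNReal.ofReal_ne_top enorm_ne_top) (hKz z)

theorem poly_mul_poly {p : ℝ} (hp : 0 < p) {c : (Fin a → NZ) → ℂ} {d : (Fin b → NZ) → ℂ}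
    (hc : Bdd c) (hd : Bdd d) (z : H p) : poly c z * poly d z =
      ∑' x : Fin (a + b) → NZ, c (fun i => x (Fin.castAdd b i)) *
        d (fun i => x (Fin.natAdd a i)) * ∏ i, z (x i) := by
  rw [poly, poly, tsum_mul_tsum_of_summable_norm (hc.summable hp fun _ => z).norm
    (hd.summable hp fun _ => z).norm, ← (Fin.appendEquiv (α := NZ) a b).tsum_eq]
  refine tsum_congr fun y => ?_
  rw [Fin.prod_univ_add]
  simp only [Fin.appendEquiv, Equiv.coe_fn_mk, Fin.append_left, Fin.append_right]
  ring

theorem poisson_poly {p : ℝ} (hp : 0 < p) (hc : Admissible c) (hd : Admissible d) (z : H p) :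
    poisson (poly c : H p → ℂ) (poly d) z = poly (bracketCoeff c d) z := by
  have h1 : ∀ l : NZ, pderiv (poly c : H p → ℂ) z l * hamVec (poly d : H p → ℂ) z l =
      ∑' x : Fin (a + b) → NZ, pdCoeff c l (fun i => x (Fin.castAdd b i)) *
        hamKer d l (fun i => x (Fin.natAdd a i)) * ∏ i, z (x i) := by
    intro l
    rw [hamVec_poly hp hd.bdd, pderiv_poly hp hc.bdd,
      poly_mul_poly hp (hc.bdd.pdCoeff l) (hd.kerBdd.bdd l)]
  have hs : Summable (Function.uncurry fun (l : NZ) (x : Fin (a + b) → NZ) =>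
      pdCoeff c l (fun i => x (Fin.castAdd b i)) *
        hamKer d l (fun i => x (Fin.natAdd a i)) * ∏ i, z (x i)) :=
    (summable_bracket hp hc hd z).congr fun _ => rfl
  rw [poisson, tsum_congr h1, ← hs.tsum_comm, poly]
  refine tsum_congr fun x => ?_
  rw [bracketCoeff, tsum_mul_right]

end BracketCoeff

/-! ### Flows of polynomial vector fields -/

section Flow

open Set

variable {E E' : Type*} [NormedAddCommGroup E] [NormedSpace ℂ E] [NormedAddCommGroup E']
  [NormedSpace ℂ E']

/-- The analytic inverse function theorem at the origin, for maps tangent to the identity. -/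
theorem exists_analytic_inverse [CompleteSpace E] {f : E → E} (hf : AnalyticAt ℂ f 0)
    (h0 : f 0 = 0) (hd : HasFDerivAt f (ContinuousLinearMap.id ℂ E) 0) :
    ∃ g : E → E, AnalyticAt ℂ g 0 ∧ g 0 = 0 ∧ HasFDerivAt g (ContinuousLinearMap.id ℂ E) 0 ∧
      (∀ᶠ x in 𝓝 0, g (f x) = x) ∧ ∀ᶠ y in 𝓝 0, f (g y) = y := by
  have hs : HasStrictFDerivAt f ((ContinuousLinearEquiv.refl ℂ E : E ≃L[ℂ] E) : E →L[ℂ] E) 0 := by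
    have := hf.hasStrictFDerivAt
    rwa [hd.fderiv] at this
  -- The exponent `⊤` in `WithTop ℕ∞` means analyticity, so the local inverse is analytic and not
  -- merely smooth.
  have hc : ContDiffAt ℂ (⊤ : WithTop ℕ∞) f 0 := hf.contDiffAt
  have hinv := hs.to_localInverse
  have h00 := hs.localInverse_apply_image
  rw [h0] at hinv h00
  refine ⟨hs.localInverse f _ 0, ?_, h00, hinv.hasFDerivAt, hs.eventually_left_inverse, ?_⟩
  · have h := ContDiffAt.to_localInverse hc hs.hasFDerivAt (by simp)
    rw [h0] at h
    exact h.analyticAt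
  · have := hs.eventually_right_inverse
    rwa [h0] at this

/-- The action of a multilinear map on paths. -/
def pathMul {m : ℕ} (M : ContinuousMultilinearMap ℂ (fun _ : Fin m => E) E') :
    ContinuousMultilinearMap ℂ (fun _ : Fin m => C(Icc (0 : ℝ) 1, E)) C(Icc (0 : ℝ) 1, E') :=
  MultilinearMap.mkContinuous
    { toFun := fun γ => ⟨fun t => M fun k => γ k t, by fun_prop⟩
      map_update_add' := fun γ i x y => by
        ext t
        have h : ∀ w : C(Icc (0 : ℝ) 1, E), (fun k => Function.update γ i w k t) =
            Function.update (fun k => γ k t) i (w t) := by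
          intro w; funext k
          by_cases hk : k = i
          · subst hk; simp
          · simp [hk]
        simp [h]
      map_update_smul' := fun γ i a x => by
        ext t
        have h : ∀ w : C(Icc (0 : ℝ) 1, E), (fun k => Function.update γ i w k t) =
            Function.update (fun k => γ k t) i (w t) := by
          intro w; funext k
          by_cases hk : k = i
          · subst hk; simp
          · simp [hk]
        simp [h] } ‖M‖ (fun γ => by
    refine (ContinuousMap.norm_le _ (by positivity)).mpr fun t => ?_
    refine (M.le_opNorm _).trans ?_
    refine mul_le_mul_of_nonneg_left ?_ (norm_nonneg _)
    exact Finset.prod_le_prod (fun _ _ => norm_nonneg _) fun k _ => (γ k).norm_coe_le_norm t)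

@[simp] theorem pathMul_apply {m : ℕ} (M : ContinuousMultilinearMap ℂ (fun _ : Fin m => E) E')
    (γ : Fin m → C(Icc (0 : ℝ) 1, E)) (t : Icc (0 : ℝ) 1) :
    pathMul M γ t = M fun k => γ k t := rfl

/-- The extension of a path to the line, constant outside of the unit interval. -/
def pathExt {E : Type*} [NormedAddCommGroup E] (γ : C(Icc (0 : ℝ) 1, E)) (t : ℝ) : E := γ (projIcc 0 1 zero_le_one t)

theorem continuous_pathExt {E : Type*} [NormedAddCommGroup E] (γ : C(Icc (0 : ℝ) 1, E)) :
    Continuous (pathExt γ) :=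
  γ.continuous.comp continuous_projIcc

/-- The primitive of a path. -/
def pathInt [CompleteSpace E] : C(Icc (0 : ℝ) 1, E) →L[ℂ] C(Icc (0 : ℝ) 1, E) :=
  LinearMap.mkContinuous
    { toFun := fun γ => ⟨fun t => ∫ s in (0 : ℝ)..t, pathExt γ s,
        (intervalIntegral.continuous_primitive
          (fun a b => (continuous_pathExt γ).intervalIntegrable a b) 0).comp continuous_subtype_val⟩
      map_add' := fun γ η => by
        ext t
        exact intervalIntegral.integral_add ((continuous_pathExt γ).intervalIntegrable _ _)
          ((continuous_pathExt η).intervalIntegrable _ _)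
      map_smul' := fun a γ => by
        ext t
        exact intervalIntegral.integral_smul a (pathExt γ) } 1 (fun γ => by
    rw [one_mul]
    refine (ContinuousMap.norm_le _ (norm_nonneg _)).mpr fun t => ?_
    refine (intervalIntegral.norm_integral_le_of_norm_le_const (C := ‖γ‖)
      fun s _ => γ.norm_coe_le_norm _).trans ?_
    rw [sub_zero, abs_of_nonneg t.2.1]
    exact mul_le_of_le_one_right (norm_nonneg _) t.2.2)

theorem pathInt_apply [CompleteSpace E] (γ : C(Icc (0 : ℝ) 1, E)) (t : Icc (0 : ℝ) 1) :
    pathInt γ t = ∫ s in (0 : ℝ)..t, pathExt γ s := rfl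

theorem hasDerivWithinAt_pathInt [CompleteSpace E] (γ : C(Icc (0 : ℝ) 1, E)) {t : ℝ}
    (ht : t ∈ Icc (0 : ℝ) 1) :
    HasDerivWithinAt (pathExt (pathInt γ)) (γ ⟨t, ht⟩) (Icc 0 1) t := by
  have h := intervalIntegral.integral_hasDerivAt_right
    ((continuous_pathExt γ).intervalIntegrable 0 t)
    ((continuous_pathExt γ).stronglyMeasurableAtFilter _ _) (continuous_pathExt γ).continuousAt
  have h2 : pathExt γ t = γ ⟨t, ht⟩ := by rw [pathExt, projIcc_of_mem _ ht]
  rw [h2] at h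
  refine h.hasDerivWithinAt.congr (fun s hs => ?_) ?_
  · rw [pathExt, projIcc_of_mem _ hs, pathInt_apply]
  · rw [pathExt, projIcc_of_mem _ ht, pathInt_apply]

variable {m : ℕ} (M : ContinuousMultilinearMap ℂ (fun _ : Fin m => E) E') (ι : E' →L[ℂ] E)

/-- The path `γ - ∫ X(γ)`, where `X` is the vector field `ι ∘ M` on the diagonal. -/
def pathDefect [CompleteSpace E'] (γ : C(Icc (0 : ℝ) 1, E)) : C(Icc (0 : ℝ) 1, E) :=
  γ - ι.compLeftContinuous ℂ (Icc (0 : ℝ) 1) (pathInt (pathMul M fun _ => γ))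

theorem hasFDerivAt_pathDefect [CompleteSpace E'] (γ : C(Icc (0 : ℝ) 1, E)) :
    HasFDerivAt (pathDefect M ι) (ContinuousLinearMap.id ℂ _ -
      (ι.compLeftContinuous ℂ (Icc (0 : ℝ) 1)).comp
        (pathInt.comp (fderiv ℂ (fun x => pathMul M fun _ => x) γ))) γ :=
  (hasFDerivAt_id γ).sub (((ι.compLeftContinuous ℂ (Icc (0 : ℝ) 1)).comp
    (pathInt (E := E'))).hasFDerivAt.comp γ
      (analyticAt_diag (pathMul M) γ).differentiableAt.hasFDerivAt)

theorem analyticAt_pathDefect [CompleteSpace E'] (γ : C(Icc (0 : ℝ) 1, E)) :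
    AnalyticAt ℂ (pathDefect M ι) γ :=
  analyticAt_id.sub ((((ι.compLeftContinuous ℂ (Icc (0 : ℝ) 1)).comp
    (pathInt (E := E'))).analyticAt _).comp (analyticAt_diag (pathMul M) γ))

/-- With at least two slots, each term of the derivative at the origin still has a slot filled by
zero. -/
theorem fderiv_diag_zero (hm : 2 ≤ m) : fderiv ℂ (fun x => M fun _ => x) 0 = 0 := by
  ext v
  rw [fderiv_diag_apply]
  refine Finset.sum_eq_zero fun i _ => ?_
  obtain ⟨k, hk⟩ : ∃ k : Fin m, k ≠ i := by
    have : Nontrivial (Fin m) := Fin.nontrivial_iff_two_le.mpr hm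
    exact exists_ne i
  exact M.map_coord_zero k (by simp [hk])

theorem fderiv_pathMul_apply (γ η : C(Icc (0 : ℝ) 1, E)) (t : Icc (0 : ℝ) 1) :
    fderiv ℂ (fun x => pathMul M fun _ => x) γ η t = fderiv ℂ (fun x => M fun _ => x) (γ t) (η t) := by
  rw [fderiv_diag_apply, fderiv_diag_apply]
  rw [ContinuousMap.sum_apply]
  refine Finset.sum_congr rfl fun i _ => ?_
  rw [pathMul_apply]
  congr 1
  funext k
  by_cases hk : k = i
  · subst hk; simp
  · simp [hk]

/-- Constant paths. -/
def pathConst : E →L[ℂ] C(Icc (0 : ℝ) 1, E) :=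
  LinearMap.mkContinuous
    { toFun := fun z => ContinuousMap.const _ z
      map_add' := fun _ _ => rfl
      map_smul' := fun _ _ => rfl } 1 (fun z => by
    rw [one_mul]
    exact (ContinuousMap.norm_le _ (norm_nonneg _)).mpr fun t => le_rfl)

@[simp] theorem pathConst_apply (z : E) (t : Icc (0 : ℝ) 1) : pathConst z t = z := rfl

/-- Evaluation of paths. -/
def pathEval (t : Icc (0 : ℝ) 1) : C(Icc (0 : ℝ) 1, E) →L[ℂ] E := ContinuousMap.evalCLM ℂ t

/-- A symmetry of the vector field passes through the integral. Only real linearity of `σ` is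
assumed, since conjugation is not complex linear. -/
theorem pathDefect_conj [CompleteSpace E'] [CompleteSpace E] (σ : E →L[ℝ] E)
    (hσ : ∀ z, ι (M fun _ => σ z) = σ (ι (M fun _ => z))) (γ : C(Icc (0 : ℝ) 1, E)) :
    pathDefect M ι (σ.compLeftContinuous ℝ (Icc (0 : ℝ) 1) γ) =
      σ.compLeftContinuous ℝ (Icc (0 : ℝ) 1) (pathDefect M ι γ) := by
  ext t
  have hint : ∀ g : C(Icc (0 : ℝ) 1, E'), ι (pathInt g t) = ∫ s in (0 : ℝ)..t, ι (pathExt g s) := by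
    intro g
    exact ((ι.restrictScalars ℝ).intervalIntegral_comp_comm
      ((continuous_pathExt g).intervalIntegrable _ _)).symm
  change σ (γ t) - ι (pathInt _ t) = σ (γ t - ι (pathInt _ t))
  have hcont : Continuous fun s => ι (pathExt (pathMul M fun _ => γ) s) :=
    ι.continuous.comp (continuous_pathExt _)
  rw [map_sub, hint, hint, ← σ.intervalIntegral_comp_comm (hcont.intervalIntegrable _ _)]
  congr 1
  refine intervalIntegral.integral_congr fun s _ => ?_
  exact hσ _

/-- Existence of the flow of the vector field `X z = ι (M (z, …, z))` near the origin up to time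
one, its analytic dependence on the initial value, the equation of variations, and its
compatibility with the real linear symmetries of the vector field. -/
theorem exists_flow [CompleteSpace E] [CompleteSpace E'] (hm : 2 ≤ m) :
    ∃ (φ : ℝ → E → E) (Ψ : E → E'), AnalyticAt ℂ Ψ 0 ∧ φ 1 0 = 0 ∧
      HasFDerivAt (φ 1) (ContinuousLinearMap.id ℂ E) 0 ∧ AnalyticAt ℂ (φ 1) 0 ∧
      (∀ᶠ z in 𝓝 0, φ 1 z = z + ι (Ψ z)) ∧
      (∀ᶠ z in 𝓝 0, φ 0 z = z ∧ ∀ t ∈ Icc (0 : ℝ) 1,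
        HasDerivWithinAt (fun s => φ s z) (ι (M fun _ => φ t z)) (Icc 0 1) t) ∧
      (∃ C : ℝ, ∀ᶠ z in 𝓝 0, ∀ t ∈ Icc (0 : ℝ) 1, ‖φ t z‖ ≤ C * ‖z‖) ∧
      (∀ᶠ z in 𝓝 0, ∀ u, fderiv ℂ (φ 0) z u = u ∧ ∀ t ∈ Icc (0 : ℝ) 1,
        HasDerivWithinAt (fun s => fderiv ℂ (φ s) z u)
          (ι (fderiv ℂ (fun x => M fun _ => x) (φ t z) (fderiv ℂ (φ t) z u))) (Icc 0 1) t) ∧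
      ∀ σ : E →L[ℝ] E, (∀ z, ι (M fun _ => σ z) = σ (ι (M fun _ => z))) →
        ∀ᶠ z in 𝓝 0, σ z = z → σ (φ 1 z) = φ 1 z := by
  have h0 : pathDefect M ι 0 = 0 := by
    have : (pathMul M fun _ => (0 : C(Icc (0 : ℝ) 1, E))) = 0 :=
      (pathMul M).map_coord_zero ⟨0, by omega⟩ rfl
    simp [pathDefect, this]
  have hd : HasFDerivAt (pathDefect M ι) (ContinuousLinearMap.id ℂ _) 0 := by
    have h := hasFDerivAt_pathDefect M ι 0
    rw [fderiv_diag_zero _ hm] at h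
    simpa using h
  -- The orbit of `z` is the path whose defect is the constant path `z`, so `Γ` applied to constant
  -- paths gives the flow for all times at once.
  obtain ⟨Γ, hΓ, hΓ0, hΓd, hl, hr⟩ :=
    exists_analytic_inverse (analyticAt_pathDefect M ι 0) h0 hd
  have hct : Tendsto (pathConst : E → C(Icc (0 : ℝ) 1, E)) (𝓝 0) (𝓝 0) :=
    (map_zero (pathConst : E →L[ℂ] _)) ▸ (pathConst (E := E)).continuous.tendsto 0
  have hΓt : Tendsto Γ (𝓝 0) (𝓝 0) := by simpa only [hΓ0] using hΓ.continuousAt.tendsto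
  have hΓc : AnalyticAt ℂ (fun z : E => Γ (pathConst z)) 0 :=
    AnalyticAt.comp (g := Γ) (f := pathConst (E := E)) (by rwa [map_zero])
      ((pathConst (E := E)).analyticAt 0)
  -- the integral equation
  have heq : ∀ᶠ z in 𝓝 (0 : E), ∀ t, Γ (pathConst z) t =
      z + ι (pathInt (pathMul M fun _ => Γ (pathConst z)) t) := by
    filter_upwards [hct.eventually hr] with z hz t
    have := congrArg (fun γ : C(Icc (0 : ℝ) 1, E) => γ t) hz
    simp only [pathDefect, ContinuousMap.sub_apply, pathConst_apply] at this
    exact sub_eq_iff_eq_add.mp this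
  -- `Ψ` is the time-one integral of the field taken in `E'`, before `ι` is applied; this keeps the
  -- smoothing of `φ 1 - id`.
  refine ⟨fun t z => pathExt (Γ (pathConst z)) t,
    fun z => pathInt (pathMul M fun _ => Γ (pathConst z)) 1, ?_, ?_, ?_, ?_, ?_, ?_, ?_, ?_, ?_⟩
  · exact AnalyticAt.comp ((pathEval 1).analyticAt _) (AnalyticAt.comp (pathInt.analyticAt _)
      ((analyticAt_diag (pathMul M) _).comp hΓc))
  · simp [pathExt, hΓ0]
  · have h1 : HasFDerivAt (fun z : E => Γ (pathConst z))
        ((ContinuousLinearMap.id ℂ _).comp (pathConst (E := E))) 0 :=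
      HasFDerivAt.comp (g := Γ) 0 (by rwa [map_zero]) (pathConst (E := E)).hasFDerivAt
    have h2 := (pathEval (projIcc (0 : ℝ) 1 zero_le_one 1)).hasFDerivAt.comp (0 : E) h1
    exact h2
  · exact AnalyticAt.comp ((pathEval (projIcc (0 : ℝ) 1 zero_le_one 1)).analyticAt _) hΓc
  · filter_upwards [heq] with z hz
    rw [pathExt, projIcc_right, hz]
    rfl
  · filter_upwards [heq] with z hz
    constructor
    · rw [pathExt, projIcc_left, hz, pathInt_apply]
      simp
    · intro t ht
      have h1 := (hasDerivWithinAt_pathInt (pathMul M fun _ => Γ (pathConst z)) ht)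
      have h2 := ((ι.restrictScalars ℝ).hasFDerivAt.comp_hasDerivWithinAt t h1).const_add z
      have h3 : pathExt (Γ (pathConst z)) t = Γ (pathConst z) ⟨t, ht⟩ := by
        rw [pathExt, projIcc_of_mem _ ht]
      rw [h3]
      exact h2.congr (fun s _ => hz _) (hz _)
  -- `Γ` is differentiable at the origin and fixes it, so `Γ γ = O(γ)` in the supremum norm, which
  -- is uniform in time.
  · obtain ⟨C, hC⟩ := (hΓd.isBigO_sub).bound
    refine ⟨C, ?_⟩
    filter_upwards [hct.eventually hC] with z hz t ht
    simp only [hΓ0, sub_zero] at hz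
    have hC0 : ‖(pathConst z : C(Icc (0 : ℝ) 1, E))‖ = ‖z‖ := by
      refine le_antisymm ((ContinuousMap.norm_le _ (norm_nonneg _)).mpr fun t => le_rfl) ?_
      exact (pathConst z : C(Icc (0 : ℝ) 1, E)).norm_coe_le_norm 0
    rw [hC0] at hz
    exact ((Γ (pathConst z)).norm_coe_le_norm _).trans hz
  · filter_upwards [hct.eventually (hr.eventually_nhds), hct.eventually hΓ.eventually_analyticAt]
      with z hz hza u
    set η : C(Icc (0 : ℝ) 1, E) := fderiv ℂ Γ (pathConst z) (pathConst u) with hη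
    have hfd : ∀ s, fderiv ℂ (fun z => pathExt (Γ (pathConst z)) s) z u = pathExt η s := by
      intro s
      have h1 : HasFDerivAt (fun z : E => Γ (pathConst z))
          ((fderiv ℂ Γ (pathConst z)).comp (pathConst (E := E))) z :=
        HasFDerivAt.comp (g := Γ) z hza.differentiableAt.hasFDerivAt
          (pathConst (E := E)).hasFDerivAt
      have h2 := (pathEval (projIcc (0 : ℝ) 1 zero_le_one s)).hasFDerivAt.comp z h1
      have h3 : HasFDerivAt (fun z : E => pathExt (Γ (pathConst z)) s) _ z := h2
      rw [h3.fderiv]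
      rfl
    -- The equation of variations in integral form, from differentiating `pathDefect ∘ Γ = id` at
    -- the constant path `z`.
    have hlin : ∀ t, η t = u + ι (pathInt
        (fderiv ℂ (fun x => pathMul M fun _ => x) (Γ (pathConst z)) η) t) := by
      intro t
      have h1 := (hasFDerivAt_pathDefect M ι (Γ (pathConst z))).comp (pathConst z)
        hza.differentiableAt.hasFDerivAt
      have h2 : HasFDerivAt (pathDefect M ι ∘ Γ) (ContinuousLinearMap.id ℂ _) (pathConst z) :=
        (hasFDerivAt_id _).congr_of_eventuallyEq hz
      have h3 := congrArg (fun L : C(Icc (0 : ℝ) 1, E) →L[ℂ] C(Icc (0 : ℝ) 1, E) =>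
        L (pathConst u) t) (h1.unique h2)
      exact sub_eq_iff_eq_add.mp h3
    simp only [hfd]
    constructor
    · rw [pathExt, projIcc_left, hlin, pathInt_apply]
      simp
    · intro t ht
      have h1 := hasDerivWithinAt_pathInt
        (fderiv ℂ (fun x => pathMul M fun _ => x) (Γ (pathConst z)) η) ht
      have h2 := ((ι.restrictScalars ℝ).hasFDerivAt.comp_hasDerivWithinAt t h1).const_add u
      rw [fderiv_pathMul_apply] at h2
      have h3 : ∀ γ : C(Icc (0 : ℝ) 1, E), pathExt γ t = γ ⟨t, ht⟩ := fun γ => by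
        rw [pathExt, projIcc_of_mem _ ht]
      rw [h3, h3]
      exact h2.congr (fun s _ => hlin _) (hlin _)
  · intro σ hσ
    have hσt : Tendsto (σ.compLeftContinuous ℝ (Icc (0 : ℝ) 1)) (𝓝 0) (𝓝 0) := by
      have := (σ.compLeftContinuous ℝ (Icc (0 : ℝ) 1)).continuous.tendsto 0
      rwa [map_zero] at this
    filter_upwards [hct.eventually hr, hct.eventually (hΓt.eventually (hσt.eventually hl))]
      with z hz hz2 hzσ
    -- Uniqueness: the image of the orbit under `σ` has defect `σ z = z`, so the left inverse sends
    -- this defect both to the image and to the orbit.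
    rw [pathDefect_conj M ι σ hσ, hz] at hz2
    have h1 : σ.compLeftContinuous ℝ (Icc (0 : ℝ) 1) (pathConst z) = pathConst z := by
      ext t
      exact hzσ
    rw [h1] at hz2
    exact (congrArg (fun γ : C(Icc (0 : ℝ) 1, E) => γ (projIcc (0 : ℝ) 1 zero_le_one 1)) hz2).symm

end Flow

/-! ### Hamiltonian flows -/

section HamFlow

variable {p : ℝ}

/-- The coefficients of a polynomial which is real at the real points. -/
def Herm {m : ℕ} (c : (Fin m → NZ) → ℂ) : Prop :=
  ∀ j, starRingEnd ℂ (c j) = c fun i => opp (j i)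

/-- `opp` in every component, as a permutation of the multi-indices. -/
def oppPi (m : ℕ) : (Fin m → NZ) ≃ (Fin m → NZ) := Equiv.piCongrRight fun _ => oppEquiv

@[simp] theorem oppPi_apply {m : ℕ} (j : Fin m → NZ) : oppPi m j = fun i => opp (j i) := rfl

theorem Herm.pdCoeff {m : ℕ} {c : (Fin (m + 1) → NZ) → ℂ} (hc : Herm c) (l : NZ)
    (j : Fin m → NZ) : starRingEnd ℂ (pdCoeff c l j) = pdCoeff c (opp l) fun i => opp (j i) := by
  rw [GBBM.pdCoeff, GBBM.pdCoeff, map_sum]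
  refine Finset.sum_congr rfl fun i _ => ?_
  rw [hc]
  congr 1
  funext k
  refine Fin.succAboveCases i ?_ (fun k => ?_) k <;> simp

theorem Herm.hamKer {m : ℕ} {c : (Fin (m + 1) → NZ) → ℂ} (hc : Herm c) (l : NZ)
    (j : Fin m → NZ) : starRingEnd ℂ (hamKer c l j) = hamKer c (opp l) fun i => opp (j i) := by
  rw [GBBM.hamKer, GBBM.hamKer, map_mul, map_mul, hc.pdCoeff, sgn_opp, conj_sgn, map_neg,
    Complex.conj_I]
  ring

theorem Herm.bracket {a b : ℕ} {c : (Fin (a + 1) → NZ) → ℂ} {d : (Fin (b + 1) → NZ) → ℂ}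
    (hc : Herm c) (hd : Herm d) : Herm (bracketCoeff c d) := by
  intro x
  rw [bracketCoeff, bracketCoeff, Complex.conj_tsum, ← oppEquiv.tsum_eq]
  refine tsum_congr fun l => ?_
  rw [map_mul, hc.pdCoeff, hd.hamKer]
  simp

theorem field_conj (hp : 0 < p) {m : ℕ} {c : (Fin (m + 1) → NZ) → ℂ} (hc : Admissible c)
    (hh : Herm c) (z : H p) : field hp hc (H.conj z) = H.conj (field hp hc z) := by
  refine H.ext fun l => ?_
  change ∑' j, hamKer c l j * ∏ i, (H.conj z) (j i) =
    starRingEnd ℂ (∑' j, hamKer c (opp l) j * ∏ i, z (j i))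
  rw [Complex.conj_tsum, ← (oppPi m).tsum_eq]
  refine tsum_congr fun j => ?_
  rw [map_mul, hh.hamKer, map_prod, opp_opp]
  simp

/-- By `symp_hamVec`, pairing the derivative of the field with the symplectic form gives minus the
second derivative of the Hamiltonian, which is symmetric, whereas the form is antisymmetric. -/
theorem symp_field_deriv (hp : 0 < p) {m : ℕ} {c : (Fin (m + 1) → NZ) → ℂ} (hc : Admissible c)
    (z u v : H p) :
    symp (H.incl (by linarith : p ≤ p + 1) (fderiv ℂ (field hp hc) z u)) v +
      symp u (H.incl (by linarith : p ≤ p + 1) (fderiv ℂ (field hp hc) z v)) = 0 := by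
  have hA : AnalyticAt ℂ (poly c : H p → ℂ) z := poly_analyticAt hp hc.bdd z
  have hsym : IsSymmSndFDerivAt ℂ (poly c : H p → ℂ) z :=
    ContDiffAt.isSymmSndFDerivAt_of_omega hA.contDiffAt
  have key : ∀ u v : H p,
      symp (H.incl (by linarith : p ≤ p + 1) (fderiv ℂ (field hp hc) z u)) v =
        -fderiv ℂ (fderiv ℂ (poly c : H p → ℂ)) z u v := by
    intro u v
    have h1 : (fun w => sympL hp.le (vfield hp hc w)) = fun w => -fderiv ℂ (poly c : H p → ℂ) w := by
      funext w
      ext v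
      exact symp_hamVec (vfield_apply hp hc w) v
    have h2 : HasFDerivAt (fun w => sympL hp.le (vfield hp hc w))
        ((sympL hp.le).comp ((H.incl (by linarith : p ≤ p + 1)).comp
          (fderiv ℂ (field hp hc) z))) z :=
      (sympL hp.le).hasFDerivAt.comp z ((H.incl (by linarith : p ≤ p + 1)).hasFDerivAt.comp z
        (field_analyticAt hp hc z).differentiableAt.hasFDerivAt)
    have h3 : HasFDerivAt (fun w => -fderiv ℂ (poly c : H p → ℂ) w)
        (-fderiv ℂ (fderiv ℂ (poly c : H p → ℂ)) z) z :=
      hA.fderiv.differentiableAt.hasFDerivAt.neg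
    rw [h1] at h2
    exact congrArg (fun L : H p →L[ℂ] H p →L[ℂ] ℂ => L u v) (h2.unique h3)
  rw [symp_swap u, key, key, hsym u v]
  ring

/-- The Hamiltonian flow of a real admissible polynomial of degree at least three. -/
theorem exists_hamFlow (hp : 0 < p) {m : ℕ} (hm : 2 ≤ m) {c : (Fin (m + 1) → NZ) → ℂ}
    (hc : Admissible c) (hh : Herm c) :
    ∃ φ : ℝ → H p → H p, IsFlow (poly c) φ ∧ IsSympTransf (p + 1) (φ 1) ∧
      (∀ᶠ z in 𝓝 (0 : H p), φ 0 z = z ∧ ∀ t ∈ Set.Icc (0 : ℝ) 1,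
        HasDerivWithinAt (fun s => φ s z) (vfield hp hc (φ t z)) (Set.Icc 0 1) t) ∧
      ∃ C : ℝ, ∀ᶠ z in 𝓝 (0 : H p), ∀ t ∈ Set.Icc (0 : ℝ) 1, ‖φ t z‖ ≤ C * ‖z‖ := by
  obtain ⟨φ, Ψ, hΨ, h0, hd, han, heq, hflow, hC, hvar, hσ⟩ :=
    exists_flow (fieldL hp hc.kerBdd) (H.incl (by linarith : p ≤ p + 1)) hm
  refine ⟨φ, ?_, ⟨h0, ⟨Ψ, hΨ, ?_⟩, ?_, ?_, ?_⟩, hflow, hC⟩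
  · filter_upwards [hflow] with z hz
    exact ⟨hz.1, fun t ht => ⟨_, vfield_apply hp hc (φ t z), hz.2 t ht⟩⟩
  · filter_upwards [heq] with z hz j
    rw [hz]
    rfl
  · obtain ⟨g, hg, -, -, hl, hr⟩ := exists_analytic_inverse han h0 hd
    exact ⟨g, hg, hl.and hr⟩
  · have h1 : ∀ᶠ z in 𝓝 (0 : H p), H.conj z = z → H.conj (φ 1 z) = φ 1 z := by
      refine hσ H.conj fun z => ?_
      change H.incl _ (field hp hc (H.conj z)) = H.conj (H.incl _ (field hp hc z))
      rw [field_conj hp hc hh]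
      rfl
    filter_upwards [h1] with z hz hzr
    exact (isRealPt_iff _).mpr (hz ((isRealPt_iff z).mp hzr))
  · filter_upwards [hvar] with z hz u v
    set B : H p →L[ℝ] H p →L[ℝ] ℂ := (sympL hp.le).bilinearRestrictScalars ℝ with hB
    -- Both variations solve `w' = DX(φ t z) w`, so the derivative of their pairing is the sum shown
    -- to vanish in `symp_field_deriv`.
    have hder : ∀ t ∈ Set.Icc (0 : ℝ) 1, HasDerivWithinAt
        (fun s => symp (fderiv ℂ (φ s) z u) (fderiv ℂ (φ s) z v)) 0 (Set.Icc 0 1) t := by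
      intro t ht
      have h := B.hasDerivWithinAt_of_bilinear ((hz u).2 t ht) ((hz v).2 t ht)
      have h2 := symp_field_deriv hp hc (φ t z) (fderiv ℂ (φ t) z u) (fderiv ℂ (φ t) z v)
      rw [add_comm] at h2
      rw [← h2]
      exact h
    have hconst := constant_of_has_deriv_right_zero
      (f := fun s => symp (fderiv ℂ (φ s) z u) (fderiv ℂ (φ s) z v)) (a := 0) (b := 1)
      (fun t ht => (hder t ht).continuousWithinAt)
      (fun t ht => ((hder t ⟨ht.1, ht.2.le⟩).mono_of_mem_nhdsWithin (Icc_mem_nhdsGE_of_mem ht)))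
      1 ⟨zero_le_one, le_rfl⟩
    simpa only [(hz u).1, (hz v).1] using hconst

/-! ### Vector fields of composed functions -/

theorem IsSympTransf.analyticAt {q : ℝ} {Φ : H p → H p} (hpq : p ≤ q) (h : IsSympTransf q Φ) :
    AnalyticAt ℂ Φ 0 := by
  obtain ⟨Ψ, hΨ, he⟩ := h.analytic
  have h1 : AnalyticAt ℂ (fun z => z + H.incl hpq (Ψ z)) 0 :=
    analyticAt_id.add (((H.incl hpq).analyticAt _).comp hΨ)
  refine h1.congr ?_
  filter_upwards [he] with z hz
  exact H.ext fun j => (hz j).symm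

theorem IsSympTransf.tendsto {q : ℝ} {Φ : H p → H p} (hpq : p ≤ q) (h : IsSympTransf q Φ) :
    Tendsto Φ (𝓝 0) (𝓝 0) := by
  have := (h.analyticAt hpq).continuousAt.tendsto
  rwa [h.map_zero] at this

/-- The composition with a symplectic transformation of a function with an analytic vector field
has an analytic vector field. -/
theorem HasAnalyticField.comp {q : ℝ} (hpq : p ≤ q) {A : H p → ℂ} {Φ : H p → H p}
    (hA : AnalyticAt ℂ A 0) (hX : HasAnalyticField q A) (hΦ : IsSympTransf q Φ) :
    HasAnalyticField q (fun z => A (Φ z)) := by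
  obtain ⟨X, hXa, hXe⟩ := hX
  have hΦa := hΦ.analyticAt hpq
  have hΦt := hΦ.tendsto hpq
  obtain ⟨Ψ, hΨ, hΨe⟩ := hΦ.analytic
  obtain ⟨Φ', hΦ'a, hinv⟩ := hΦ.invertible
  have hΦ'0 : Φ' 0 = 0 := by
    have := hinv.self_of_nhds.1
    rwa [hΦ.map_zero] at this
  have hΦ't : Tendsto Φ' (𝓝 0) (𝓝 0) := by
    have := hΦ'a.continuousAt.tendsto
    rwa [hΦ'0] at this
  have hΨ'a : AnalyticAt ℂ (fun w => -Ψ (Φ' w)) 0 :=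
    (AnalyticAt.comp (g := Ψ) (by rwa [hΦ'0]) hΦ'a).neg
  have hΨ'e : ∀ᶠ w in 𝓝 (0 : H p), Φ' w = w + H.incl hpq (-Ψ (Φ' w)) := by
    filter_upwards [hinv, hΦ't.eventually hΨe] with w hw hw2
    refine H.ext fun j => ?_
    have h1 := hw2 j
    rw [hw.2] at h1
    simp only [H.add_apply, H.incl_apply, H.neg_apply]
    rw [h1]
    ring
  -- The field of `A ∘ Φ` is `(DΦ)⁻¹ X ∘ Φ`. Differentiating `Φ' w = w - Ψ (Φ' w)` shows that
  -- `(DΦ)⁻¹` is the identity plus an operator with values in `h_q`, so the formula makes sense in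
  -- `h_q`.
  refine ⟨fun z => X (Φ z) +
    fderiv ℂ (fun w => -Ψ (Φ' w)) (Φ z) (H.incl hpq (X (Φ z))), ?_, ?_⟩
  · have hXΦ : AnalyticAt ℂ (fun z => X (Φ z)) 0 :=
      AnalyticAt.comp (g := X) (by rwa [hΦ.map_zero]) hΦa
    have hD : AnalyticAt ℂ (fun z => fderiv ℂ (fun w => -Ψ (Φ' w)) (Φ z)) 0 :=
      AnalyticAt.comp (g := fderiv ℂ (fun w => -Ψ (Φ' w))) (by rw [hΦ.map_zero]; exact hΨ'a.fderiv) hΦa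
    refine hXΦ.add ?_
    exact AnalyticAt.comp₂ (h := fun x : (H p →L[ℂ] H q) × H p => x.1 x.2)
      (ContinuousLinearMap.analyticAt_bilinear (ContinuousLinearMap.id ℂ (H p →L[ℂ] H q)) _)
      hD (((H.incl hpq).analyticAt _).comp hXΦ)
  · filter_upwards [hΦt.eventually hXe, hΦt.eventually hΨ'e.eventually_nhds,
      hΦt.eventually hA.eventually_analyticAt, hΦa.eventually_analyticAt,
      hΦt.eventually hΨ'a.eventually_analyticAt, hinv.eventually_nhds,
      hΦt.eventually hinv.eventually_nhds, hΦ.symplectic] with z h1 h2 h3 h4 h5 h6 h7 h8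
    set w := Φ z with hw
    set Y : H q := X w + fderiv ℂ (fun w => -Ψ (Φ' w)) w (H.incl hpq (X w)) with hY
    have hDΦ' : HasFDerivAt Φ' (ContinuousLinearMap.id ℂ (H p) +
        (H.incl hpq).comp (fderiv ℂ (fun w => -Ψ (Φ' w)) w)) w :=
      (((hasFDerivAt_id w).add ((H.incl hpq).hasFDerivAt.comp w
        h5.differentiableAt.hasFDerivAt)).congr_of_eventuallyEq h2)
    have hDY : fderiv ℂ Φ z (H.incl hpq Y) = H.incl hpq (X w) := by
      have hz : Φ' w = z := h6.self_of_nhds.1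
      have e1 : HasFDerivAt (Φ ∘ Φ') (ContinuousLinearMap.id ℂ (H p)) w :=
        (hasFDerivAt_id w).congr_of_eventuallyEq (h7.mono fun x hx => hx.2)
      have e2 : HasFDerivAt (Φ ∘ Φ') _ w :=
        HasFDerivAt.comp w (by rw [hz]; exact h4.differentiableAt.hasFDerivAt) hDΦ'
      have e3 := congrArg (fun L : H p →L[ℂ] H p => L (H.incl hpq (X w))) (e2.unique e1)
      rw [← ContinuousLinearMap.id_apply (R₁ := ℂ) (H.incl hpq (X w)), ← e3]
      simp only [ContinuousLinearMap.comp_apply, add_apply,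
        ContinuousLinearMap.id_apply, hY, map_add]
    -- With `ω` the symplectic form, `ω(Y, v) = ω(DΦ Y, DΦ v) = ω(X ∘ Φ, DΦ v) = -d(A ∘ Φ) v`.
    have hfin := hamVec_eq_of_symp (A := fun z => A (Φ z)) (z := z) (Y := H.incl hpq Y)
      fun l => by
        rw [← h8, hDY, symp_hamVec (A := A) (z := w) (X := H.incl hpq (X w)) h1, pderiv]
        have e : HasFDerivAt (fun z => A (Φ z)) ((fderiv ℂ A w).comp (fderiv ℂ Φ z)) z :=
          HasFDerivAt.comp (g := A) z h3.differentiableAt.hasFDerivAt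
            h4.differentiableAt.hasFDerivAt
        rw [e.fderiv]
        rfl
    exact hfin

theorem HasAnalyticField.sub {q : ℝ} {A B : H p → ℂ} (hA : AnalyticAt ℂ A 0)
    (hB : AnalyticAt ℂ B 0) (hXA : HasAnalyticField q A) (hXB : HasAnalyticField q B) :
    HasAnalyticField q (fun z => A z - B z) := by
  obtain ⟨X, hX, hXe⟩ := hXA
  obtain ⟨Y, hY, hYe⟩ := hXB
  refine ⟨fun z => X z - Y z, hX.sub hY, ?_⟩
  filter_upwards [hXe, hYe, hA.eventually_analyticAt, hB.eventually_analyticAt] with z h1 h2 h3 h4 j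
  rw [H.sub_apply, h1, h2, hamVec, hamVec, hamVec, pderiv, pderiv, pderiv,
    fderiv_fun_sub h3.differentiableAt h4.differentiableAt]
  simp only [sub_apply]
  ring

theorem HasAnalyticField.add {q : ℝ} {A B : H p → ℂ} (hA : AnalyticAt ℂ A 0)
    (hB : AnalyticAt ℂ B 0) (hXA : HasAnalyticField q A) (hXB : HasAnalyticField q B) :
    HasAnalyticField q (fun z => A z + B z) := by
  obtain ⟨X, hX, hXe⟩ := hXA
  obtain ⟨Y, hY, hYe⟩ := hXB
  refine ⟨fun z => X z + Y z, hX.add hY, ?_⟩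
  filter_upwards [hXe, hYe, hA.eventually_analyticAt, hB.eventually_analyticAt] with z h1 h2 h3 h4 j
  rw [H.add_apply, h1, h2, hamVec, hamVec, hamVec, pderiv, pderiv, pderiv,
    fderiv_fun_add h3.differentiableAt h4.differentiableAt]
  simp only [add_apply]
  ring

end HamFlow

/-! ### The quadratic part of the Hamiltonian -/

/-- The coefficients of `Λ` as a polynomial of degree two. -/
def lamCoeff (j : Fin 2 → NZ) : ℂ :=
  if (j 0).1 + (j 1).1 = 0 then ((del (j 0) * del (j 1) / 2 : ℝ) : ℂ) else 0

theorem lamCoeff_admissible : Admissible lamCoeff := by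
  constructor
  · intro j hj
    rw [Fin.sum_univ_two] at hj
    rw [lamCoeff, if_neg hj]
  · refine ⟨1, fun j => ?_⟩
    have := mul_pos (del_pos (j 0)) (del_pos (j 1))
    rw [lamCoeff, Fin.prod_univ_two]
    split_ifs
    · rw [Complex.norm_real, Real.norm_of_nonneg (by positivity)]
      linarith
    · rw [norm_zero]
      linarith

theorem lam_eq (j : NZ) : (lam j : ℂ) = sgn j * (del j : ℂ) ^ 2 := by
  have h : lam j = (Int.sign j.1 : ℝ) * del j ^ 2 := by
    have h1 : (Int.sign j.1 : ℝ) * |(j.1 : ℝ)| = j.1 := by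
      have := Int.sign_mul_abs j.1
      exact_mod_cast this
    rw [del_sq, lam, ← mul_div_assoc, h1]
  rw [h, sgn]
  push_cast
  rfl

theorem lam_pos_eq (n : ℕ+) : (lam (pos n) : ℂ) = (del (pos n) : ℂ) ^ 2 := by
  have h : sgn (pos n) = 1 := by
    have : Int.sign (pos n).1 = 1 := Int.sign_eq_one_of_pos (by simp [pos])
    simp [sgn, this]
  rw [lam_eq, h, one_mul]

theorem norm_lam_le (j : NZ) : ‖Complex.I * (lam j : ℂ)‖ ≤ 1 := by
  rw [lam_eq, norm_mul, norm_mul, norm_sgn, Complex.norm_I, norm_pow, Complex.norm_real,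
    Real.norm_of_nonneg (del_pos j).le]
  have := del_le_one j
  have := del_pos j
  nlinarith

/-- The nonzero integers are the positive ones and their opposites. -/
def signEquiv : ℕ+ ⊕ ℕ+ ≃ NZ :=
  Equiv.ofBijective (Sum.elim pos fun n => opp (pos n)) (by
    constructor
    · rintro (a | a) (b | b) h <;> have h1 := congrArg Subtype.val h <;>
        simp only [Sum.elim_inl, Sum.elim_inr, pos, opp_val] at h1 <;>
        have ha := a.pos <;> have hb := b.pos
      · congr 1; apply PNat.eq; omega
      · omega
      · omega
      · congr 1; apply PNat.eq; omega
    · intro j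
      rcases lt_or_gt_of_ne j.2 with h | h
      · refine ⟨Sum.inr ⟨(-j.1).toNat, by omega⟩, Subtype.ext ?_⟩
        change -(((-j.1).toNat : ℕ) : ℤ) = j.1
        omega
      · refine ⟨Sum.inl ⟨j.1.toNat, by omega⟩, Subtype.ext ?_⟩
        change ((j.1.toNat : ℕ) : ℤ) = j.1
        omega)

theorem tsum_eq_pos_add_neg {g : NZ → ℂ} (hg : Summable g) :
    ∑' l, g l = ∑' n : ℕ+, (g (pos n) + g (opp (pos n))) := by
  have hs : Summable fun x : ℕ+ ⊕ ℕ+ => g (signEquiv x) := hg.comp_injective signEquiv.injective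
  have h1 : Summable fun n : ℕ+ => g (pos n) := hs.comp_injective Sum.inl_injective
  have h2 : Summable fun n : ℕ+ => g (opp (pos n)) := hs.comp_injective Sum.inr_injective
  rw [h1.tsum_add h2, ← signEquiv.tsum_eq]
  exact Summable.tsum_sum (f := fun x => g (signEquiv x)) h1 h2

/-- For positive `n` one has `λ_n = δ_n ^ 2`, so `Λ` is itself admissible and its analyticity and
vector field come from the general theory. The factor `1/2` in `lamCoeff` accounts for the two
orders `(l, -l)` and `(-l, l)`. -/
theorem Lam_eq_poly {p : ℝ} (hp : 0 < p) : (Lam : H p → ℂ) = poly lamCoeff := by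
  funext z
  have hs := lamCoeff_admissible.bdd.summable hp fun _ : Fin 2 => z
  set e : NZ → Fin 2 → NZ := fun l => ![l, opp l] with he
  have hinj : Function.Injective e := fun a b h => congrFun h 0
  have hterm : ∀ l, lamCoeff (e l) * ∏ i, z (e l i) = (del l : ℂ) ^ 2 / 2 * (z l * z (opp l)) := by
    intro l
    have h0 : l.1 + (opp l).1 = 0 := by rw [opp_val]; omega
    rw [lamCoeff, Fin.prod_univ_two]
    change (if l.1 + (opp l).1 = 0 then ((del l * del (opp l) / 2 : ℝ) : ℂ) else 0) *
      (z l * z (opp l)) = _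
    rw [if_pos h0, del_opp]
    push_cast
    ring
  have hs2 : Summable fun l : NZ => (del l : ℂ) ^ 2 / 2 * (z l * z (opp l)) :=
    (hs.comp_injective hinj).congr hterm
  have h1 : poly lamCoeff z = ∑' l : NZ, (del l : ℂ) ^ 2 / 2 * (z l * z (opp l)) := by
    rw [poly, ← hinj.tsum_eq]
    · exact tsum_congr hterm
    · intro j hj
      by_cases h : (j 0).1 + (j 1).1 = 0
      · refine ⟨j 0, funext fun i => ?_⟩
        fin_cases i
        · rfl
        · apply Subtype.ext
          simp only [he, Fin.mk_one, Matrix.cons_val_one, Matrix.cons_val_fin_one, opp_val]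
          omega
      · exact absurd (by simp [lamCoeff, h]) hj
  rw [h1, tsum_eq_pos_add_neg hs2, Lam]
  refine tsum_congr fun n => ?_
  rw [lam_pos_eq, opp_opp, del_opp]
  ring

theorem pderiv_Lam {p : ℝ} (hp : 0 < p) (z : H p) (l : NZ) :
    pderiv (Lam : H p → ℂ) z l = (del l : ℂ) ^ 2 * z (opp l) := by
  rw [Lam_eq_poly hp, pderiv_poly hp lamCoeff_admissible.bdd, poly,
    tsum_eq_single (fun _ => opp l)]
  · have e0 : ((0 : Fin 2).insertNth l (fun _ => opp l) : Fin 2 → NZ) = ![l, opp l] := by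
      funext i; fin_cases i <;> rfl
    have e1 : ((1 : Fin 2).insertNth l (fun _ => opp l) : Fin 2 → NZ) = ![opp l, l] := by
      funext i; fin_cases i <;> rfl
    rw [pdCoeff, Fin.sum_univ_two, e0, e1, Fin.prod_univ_one]
    simp only [lamCoeff, Matrix.cons_val_zero, Matrix.cons_val_one, Matrix.cons_val_fin_one,
      opp_val, del_opp, add_neg_cancel, neg_add_cancel, if_true]
    push_cast
    ring
  · intro k hk
    have h : l.1 + ∑ i, (k i).1 ≠ 0 := by
      intro h
      apply hk
      funext i
      apply Subtype.ext
      rw [Fin.sum_univ_one] at h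
      rw [Subsingleton.elim i 0, opp_val]
      omega
    rw [lamCoeff_admissible.pdCoeff_eq_zero h, zero_mul]

/-- The homological equation. -/
theorem poisson_Lam_homol {p : ℝ} (hp : 0 < p) {m : ℕ} {c : (Fin (m + 1) → NZ) → ℂ}
    (hc : Admissible (homol c)) (hdiv : ∀ j, c j ≠ 0 → ∑ i, lam (j i) ≠ 0) (z : H p) :
    poisson (Lam : H p → ℂ) (poly (homol c)) z = -poly c z := by
  -- The bracket with `Λ` is the derivative along `z_j ↦ i λ_j z_j`, for which each monomial is an
  -- eigenvector with eigenvalue `i` times its divisor.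
  set D : H p →L[ℂ] H p := H.diag (fun j => Complex.I * (lam j : ℂ)) norm_lam_le with hD
  have h1 : poisson (Lam : H p → ℂ) (poly (homol c)) z =
      fderiv ℂ (poly (homol c) : H p → ℂ) z (D z) := by
    rw [fderiv_eq_tsum, poisson, ← oppEquiv.tsum_eq]
    refine tsum_congr fun j => ?_
    rw [oppEquiv_apply, pderiv_Lam hp, hamVec, opp_opp, hD, H.diag_apply, lam_eq, del_opp, sgn_opp]
    ring
  rw [h1, poly_fderiv hp hc.bdd]
  have h2 : ∀ i : Fin (m + 1), mform (homol c) (Function.update (fun _ => z) i (D z)) =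
      ∑' j, homol c j * (Complex.I * lam (j i)) * ∏ k, z (j k) := by
    intro i
    refine tsum_congr fun j => ?_
    rw [prod_update_apply, ← Finset.mul_prod_erase _ (fun k => z (j k)) (Finset.mem_univ i),
      hD, H.diag_apply]
    ring
  simp_rw [h2]
  have hs : ∀ i : Fin (m + 1),
      Summable fun j : Fin (m + 1) → NZ => homol c j * (Complex.I * lam (j i)) * ∏ k, z (j k) := by
    intro i
    refine (hc.bdd.summable hp (Function.update (fun _ => z) i (D z))).congr fun j => ?_
    rw [prod_update_apply, ← Finset.mul_prod_erase _ (fun k => z (j k)) (Finset.mem_univ i),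
      hD, H.diag_apply]
    ring
  rw [← Summable.tsum_finsetSum fun i _ => hs i, poly, ← tsum_neg]
  refine tsum_congr fun j => ?_
  rw [← Finset.sum_mul, ← Finset.mul_sum, ← Finset.mul_sum, ← neg_mul]
  congr 1
  by_cases hcj : c j = 0
  · simp [homol, hcj]
  · have h3 : ((∑ i, lam (j i) : ℝ) : ℂ) ≠ 0 := Complex.ofReal_ne_zero.mpr (hdiv j hcj)
    rw [homol, ← Complex.ofReal_sum]
    field_simp
    rw [Complex.I_sq]

/-! ### Parts of polynomials -/

section Parts

variable {m : ℕ} {c d : (Fin m → NZ) → ℂ}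

theorem part_of_mem {D : Set (Fin m → NZ)} {j : Fin m → NZ} (h : j ∈ D) : part c D j = c j :=
  if_pos h

theorem part_of_notMem {D : Set (Fin m → NZ)} {j : Fin m → NZ} (h : j ∉ D) : part c D j = 0 :=
  if_neg h

theorem part_suppIn (c : (Fin m → NZ) → ℂ) (D : Set (Fin m → NZ)) : SuppIn (part c D) D :=
  fun _ h => part_of_notMem h

theorem Bdd.part (hc : Bdd c) (D : Set (Fin m → NZ)) : Bdd (part c D) := by
  obtain ⟨C, hC0, hC⟩ := hc.exists_nonneg
  refine ⟨C, fun j => ?_⟩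
  by_cases h : j ∈ D
  · rw [part_of_mem h]; exact hC j
  · rw [part_of_notMem h, norm_zero]; exact mul_nonneg hC0 (prod_del_pos j).le

theorem Admissible.part (hc : Admissible c) (D : Set (Fin m → NZ)) : Admissible (part c D) := by
  refine ⟨fun j hj => ?_, hc.bdd.part D⟩
  by_cases h : j ∈ D
  · rw [part_of_mem h]; exact hc.1 j hj
  · exact part_of_notMem h

theorem Herm.part (hc : Herm c) {D : Set (Fin m → NZ)}
    (hD : ∀ j, (fun i => opp (j i)) ∈ D ↔ j ∈ D) : Herm (part c D) := by
  intro j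
  by_cases h : j ∈ D
  · rw [part_of_mem h, part_of_mem ((hD j).mpr h), hc]
  · rw [part_of_notMem h, part_of_notMem (mt (hD j).mp h), map_zero]

theorem Bdd.add (hc : Bdd c) (hd : Bdd d) : Bdd fun j => c j + d j := by
  obtain ⟨C, hC⟩ := hc
  obtain ⟨C', hC'⟩ := hd
  exact ⟨C + C', fun j => (norm_add_le _ _).trans ((add_le_add (hC j) (hC' j)).trans_eq
    (add_mul _ _ _).symm)⟩

theorem Admissible.add (hc : Admissible c) (hd : Admissible d) : Admissible fun j => c j + d j :=
  ⟨fun j hj => by simp only [hc.1 j hj, hd.1 j hj, add_zero], hc.bdd.add hd.bdd⟩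

theorem Admissible.const_mul (a : ℂ) (hc : Admissible c) : Admissible fun j => a * c j := by
  refine ⟨fun j hj => by simp only [hc.1 j hj, mul_zero], ?_⟩
  obtain ⟨C, hC⟩ := hc.2
  refine ⟨‖a‖ * C, fun j => ?_⟩
  rw [norm_mul, mul_assoc]
  exact mul_le_mul_of_nonneg_left (hC j) (norm_nonneg a)

theorem Herm.add (hc : Herm c) (hd : Herm d) : Herm fun j => c j + d j := fun j => by
  rw [map_add, hc, hd]

theorem Herm.const_mul {a : ℂ} (ha : starRingEnd ℂ a = a) (hc : Herm c) :
    Herm fun j => a * c j := fun j => by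
  rw [map_mul, ha, hc]

@[simp] theorem lam_opp (j : NZ) : lam (opp j) = -lam j := by
  simp [lam, opp, neg_div]

theorem Herm.homol (hc : Herm c) : Herm (homol c) := by
  intro j
  rw [GBBM.homol, GBBM.homol, map_div₀, map_mul, hc, Complex.conj_I, Complex.conj_ofReal]
  simp only [lam_opp, Finset.sum_neg_distrib, Complex.ofReal_neg, div_neg]
  rw [neg_mul, neg_div]

theorem Admissible.homol (hc : Admissible c) {κ : ℝ} (hκ : 0 < κ)
    (h : ∀ j, c j ≠ 0 → κ ≤ |∑ i, lam (j i)|) : Admissible (homol c) := by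
  refine ⟨fun j hj => by rw [GBBM.homol, hc.1 j hj, mul_zero, zero_div], ?_⟩
  obtain ⟨C, hC0, hC⟩ := hc.bdd.exists_nonneg
  refine ⟨C / κ, fun j => ?_⟩
  have hprod := prod_del_pos j
  by_cases hcj : c j = 0
  · rw [GBBM.homol, hcj, mul_zero, zero_div, norm_zero]; positivity
  · rw [GBBM.homol, norm_div, norm_mul, Complex.norm_I, one_mul, Complex.norm_real,
      Real.norm_eq_abs, div_mul_eq_mul_div]
    exact div_le_div₀ (by positivity) (hC j) hκ (h j hcj)

end Parts

theorem gCoeff_admissible : Admissible gCoeff := by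
  refine ⟨fun j hj => if_neg hj, 1 / (120 * Real.pi ^ 2), fun j => ?_⟩
  have := prod_del_pos j
  rw [gCoeff]
  split_ifs
  · rw [Complex.norm_real, Real.norm_of_nonneg (by positivity)]
  · rw [norm_zero]; positivity

theorem gCoeff_herm : Herm gCoeff := by
  intro j
  have h : ∑ i, (opp (j i)).1 = 0 ↔ ∑ i, (j i).1 = 0 := by simp
  simp only [gCoeff, h, del_opp]
  split_ifs
  · exact Complex.conj_ofReal _
  · simp

/-! ### Estimates in terms of the components outside of `S` -/

open Classical in
/-- The projection to the components outside of `S`. -/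
def H.hat (n₁ n₂ : ℕ+) {p : ℝ} : H p →L[ℂ] H p :=
  H.diag (fun j => if j ∈ S n₁ n₂ then 0 else 1) fun j => by split_ifs <;> simp

open Classical in
/-- The projection to the components in `S`. -/
def H.tan (n₁ n₂ : ℕ+) {p : ℝ} : H p →L[ℂ] H p :=
  H.diag (fun j => if j ∈ S n₁ n₂ then 1 else 0) fun j => by split_ifs <;> simp

theorem H.norm_diag_le {p : ℝ} (a : NZ → ℂ) (ha : ∀ j, ‖a j‖ ≤ 1) (z : H p) :
    ‖H.diag a ha z‖ ≤ ‖z‖ := by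
  refine H.norm_le_of_le z _ fun j => ?_
  rw [H.diag_apply, norm_mul]
  exact mul_le_mul_of_nonneg_left (mul_le_of_le_one_left (norm_nonneg _) (ha j))
    (weight_pos p j).le

theorem H.norm_hat (n₁ n₂ : ℕ+) {p : ℝ} (z : H p) : ‖H.hat n₁ n₂ z‖ = hatNorm n₁ n₂ z := by
  rw [hatNorm, ← Real.sqrt_sq (norm_nonneg (H.hat n₁ n₂ z)), H.norm_sq]
  congr 1
  refine tsum_congr fun j => ?_
  rw [H.hat, H.diag_apply]
  split_ifs <;> simp

/-- Split every argument into its parts outside and inside `S` and expand by multilinearity into `2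
^ m` terms. Terms with fewer than `k` outside arguments vanish; the others contain the required
powers. -/
theorem exists_norm_poly_le_hat {p : ℝ} (hp : 0 < p) (n₁ n₂ : ℕ+) {m k : ℕ} (hk : k ≤ m)
    {c : (Fin m → NZ) → ℂ} (hc : Bdd c) (hs : SuppIn c {j | k ≤ outs n₁ n₂ j}) :
    (poly c : H p → ℂ) =O[𝓝 0] fun z => ‖z‖ ^ (m - k) * hatNorm n₁ n₂ z ^ k := by
  classical
  obtain ⟨B, hB, hBz⟩ := hc.exists_norm_mform_le (p := p) hp
  refine IsBigO.of_bound (2 ^ m * B) (Eventually.of_forall fun z => ?_)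
  have hadd : z = H.hat n₁ n₂ z + H.tan n₁ n₂ z := by
    refine H.ext fun j => ?_
    rw [H.add_apply, H.hat, H.tan, H.diag_apply, H.diag_apply]
    split_ifs <;> simp
  have hexp : poly c z = ∑ s : Finset (Fin m),
      mform c (s.piecewise (fun _ => H.hat n₁ n₂ z) fun _ => H.tan n₁ n₂ z) := by
    have h := (mformL hp hc).toMultilinearMap.map_add_univ (fun _ => H.hat n₁ n₂ z)
      (fun _ => H.tan n₁ n₂ z)
    rw [poly_eq_mform]
    conv_lhs => rw [hadd]
    exact h
  have hterm : ∀ s : Finset (Fin m),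
      ‖mform c (s.piecewise (fun _ => H.hat n₁ n₂ z) fun _ => H.tan n₁ n₂ z)‖ ≤
        B * (‖z‖ ^ (m - k) * hatNorm n₁ n₂ z ^ k) := by
    intro s
    have hz1 : hatNorm n₁ n₂ z ≤ ‖z‖ := by rw [← H.norm_hat]; exact H.norm_diag_le _ _ z
    have hz2 : ‖H.tan n₁ n₂ z‖ ≤ ‖z‖ := H.norm_diag_le _ _ z
    have hz0 : 0 ≤ hatNorm n₁ n₂ z := Real.sqrt_nonneg _
    -- If `s` has fewer than `k` elements, a multi-index with at least `k` entries outside `S` has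
    -- such an entry in a slot filled by the tangential part.
    by_cases hsk : s.card < k
    · have h0 : mform c (s.piecewise (fun _ => H.hat n₁ n₂ z) fun _ => H.tan n₁ n₂ z) = 0 := by
        refine (tsum_congr fun j => ?_).trans tsum_zero
        by_cases hj : k ≤ outs n₁ n₂ j
        · obtain ⟨i, hi, his⟩ : ∃ i, j i ∉ S n₁ n₂ ∧ i ∉ s := by
            by_contra hcon
            push Not at hcon
            have : (Finset.univ.filter fun i => j i ∉ S n₁ n₂) ⊆ s := fun i hi =>
              hcon i (Finset.mem_filter.mp hi).2
            have := Finset.card_le_card this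
            rw [outs] at hj
            omega
          rw [Finset.prod_eq_zero (Finset.mem_univ i), mul_zero]
          rw [Finset.piecewise_eq_of_notMem _ _ _ his, H.tan, H.diag_apply, if_neg hi, zero_mul]
        · rw [hs j hj, zero_mul]
      rw [h0, norm_zero]
      positivity
    · refine (hBz _).trans (mul_le_mul_of_nonneg_left ?_ hB)
      have hprod : ∏ i, ‖s.piecewise (fun _ => H.hat n₁ n₂ z) (fun _ => H.tan n₁ n₂ z) i‖ =
          hatNorm n₁ n₂ z ^ s.card * ‖H.tan n₁ n₂ z‖ ^ (m - s.card) := by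
        have : ∀ i, ‖s.piecewise (fun _ => H.hat n₁ n₂ z) (fun _ => H.tan n₁ n₂ z) i‖ =
            s.piecewise (fun _ => hatNorm n₁ n₂ z) (fun _ => ‖H.tan n₁ n₂ z‖) i := by
          intro i
          by_cases hi : i ∈ s
          · simp [hi, H.norm_hat]
          · simp [hi]
        simp_rw [this]
        rw [Finset.prod_piecewise, Finset.prod_const, Finset.prod_const, Finset.univ_inter,
          ← Finset.compl_eq_univ_sdiff, Finset.card_compl, Fintype.card_fin]
      rw [hprod]
      have hcard : s.card ≤ m := by simpa using Finset.card_le_univ s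
      calc hatNorm n₁ n₂ z ^ s.card * ‖H.tan n₁ n₂ z‖ ^ (m - s.card)
          = hatNorm n₁ n₂ z ^ (s.card - k) * hatNorm n₁ n₂ z ^ k *
            ‖H.tan n₁ n₂ z‖ ^ (m - s.card) := by
            rw [← pow_add]; congr 2; omega
        _ ≤ ‖z‖ ^ (s.card - k) * hatNorm n₁ n₂ z ^ k * ‖z‖ ^ (m - s.card) := by gcongr
        _ = ‖z‖ ^ (m - k) * hatNorm n₁ n₂ z ^ k := by
            rw [mul_right_comm, ← pow_add]; congr 2; omega
  rw [hexp]
  refine (norm_sum_le _ _).trans ((Finset.sum_le_sum fun s _ => hterm s).trans (le_of_eq ?_))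
  have : 0 ≤ hatNorm n₁ n₂ z := Real.sqrt_nonneg _
  rw [Finset.sum_const, Finset.card_univ, Fintype.card_finset, Fintype.card_fin, nsmul_eq_mul,
    Real.norm_of_nonneg (by positivity)]
  push_cast
  ring

/-! ### Paired multi-indices -/

section Paired

open Classical in
/-- The number of components equal to `l`. -/
def cnt {m : ℕ} (j : Fin m → NZ) (l : NZ) : ℕ := (Finset.univ.filter fun i => j i = l).card

/-- Conjugate the exchange of positions `2 i` and `2 i + 1` by the permutation that sorts the tuple
into pairs; evenness of `m` keeps `2 i + 1` in range. -/
theorem exists_perm_of_paired {m : ℕ} (hm : Even m) {j : Fin m → NZ} (hj : j ∈ Paired m) :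
    ∃ π : Equiv.Perm (Fin m), ∀ i, j (π i) = opp (j i) := by
  obtain ⟨τ, hτ⟩ := hj
  have hm2 : m % 2 = 0 := Nat.even_iff.mp hm
  let s : Fin m → Fin m := fun i =>
    if h : (i : ℕ) % 2 = 0 then ⟨i + 1, by omega⟩ else ⟨i - 1, by omega⟩
  have hs : Function.Involutive s := by
    intro i
    apply Fin.ext
    by_cases h : (i : ℕ) % 2 = 0
    · have h2 : ((i : ℕ) + 1) % 2 ≠ 0 := by omega
      simp only [s, h, h2, dite_true, dite_false]
      omega
    · have h2 : ((i : ℕ) - 1) % 2 = 0 := by omega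
      simp only [s, h, h2, dite_true, dite_false]
      omega
  have key : ∀ i, j (τ (s i)) = opp (j (τ i)) := by
    intro i
    by_cases h : (i : ℕ) % 2 = 0
    · rw [hτ i (s i) (Nat.even_iff.mpr h) (by simp [s, h]), opp_opp]
    · refine hτ (s i) i (Nat.even_iff.mpr ?_) ?_
      · simp only [s, h, dite_false]; omega
      · simp only [s, h, dite_false]; omega
  refine ⟨(τ.symm.trans hs.toPerm).trans τ, fun i => ?_⟩
  have := key (τ.symm i)
  simpa using this

theorem cnt_opp_of_paired {m : ℕ} (hm : Even m) {j : Fin m → NZ} (hj : j ∈ Paired m) (l : NZ) :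
    cnt j (opp l) = cnt j l := by
  obtain ⟨π, hπ⟩ := exists_perm_of_paired hm hj
  refine (Finset.card_bij (fun i _ => π i) ?_ ?_ ?_).symm
  · intro i hi
    rw [Finset.mem_filter] at hi ⊢
    exact ⟨Finset.mem_univ _, by rw [hπ, hi.2]⟩
  · intro i _ i' _ h
    exact π.injective h
  · intro i hi
    rw [Finset.mem_filter] at hi
    refine ⟨π.symm i, ?_, by simp⟩
    rw [Finset.mem_filter]
    refine ⟨Finset.mem_univ _, ?_⟩
    have := hπ (π.symm i)
    rw [Equiv.apply_symm_apply, hi.2] at this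
    exact (opp_inj.mp this).symm

/-- Pairing is detected by multiplicities: if `l` and `-l` occur equally often, match the positions
of `l` with those of `-l` and list each position of a positive entry before its partner. -/
theorem paired_of_cnt {k : ℕ} {j : Fin (k * 2) → NZ} (h : ∀ l, cnt j (opp l) = cnt j l) :
    j ∈ Paired (k * 2) := by
  classical
  have he : ∀ l, Nonempty ({i // j i = l} ≃ {i // j i = opp l}) := fun l => by
    refine ⟨Fintype.equivOfCardEq ?_⟩
    rw [Fintype.card_subtype, Fintype.card_subtype]
    have := h l
    rw [cnt, cnt] at this
    convert this.symm
  have e := fun l => Classical.choice (he l)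
  have hval : ∀ (l : NZ) (i : Fin (k * 2)) (hi : j i = l), j (e l ⟨i, hi⟩) = opp l :=
    fun l i hi => (e l ⟨i, hi⟩).2
  let P := {i : Fin (k * 2) // 0 < (j i).1}
  -- Second component `0` is a position with a positive entry, `1` is its partner under the chosen
  -- matching.
  let f : P × Fin 2 → Fin (k * 2) := fun x => if x.2 = 0 then x.1.1 else (e (j x.1.1) ⟨x.1.1, rfl⟩).1
  have hf0 : ∀ i : P, f (i, 0) = i.1 := fun i => rfl
  have hf1 : ∀ i : P, f (i, 1) = (e (j i.1) ⟨i.1, rfl⟩).1 := fun i => rfl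
  have hj1 : ∀ i : P, j (f (i, 1)) = opp (j i.1) := fun i => hval _ _ _
  have hinj : Function.Injective f := by
    rintro ⟨i, a⟩ ⟨i', a'⟩ hii
    have hp := i.2
    have hp' := i'.2
    fin_cases a <;> fin_cases a'
    · change f (i, 0) = f (i', 0) at hii
      rw [hf0, hf0] at hii
      rw [Subtype.ext hii]
    · change f (i, 0) = f (i', 1) at hii
      have := congrArg (fun x => (j x).1) hii
      simp only [hf0, hj1, opp_val] at this
      omega
    · change f (i, 1) = f (i', 0) at hii
      have := congrArg (fun x => (j x).1) hii
      simp only [hf0, hj1, opp_val] at this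
      omega
    · change f (i, 1) = f (i', 1) at hii
      have hl : j i.1 = j i'.1 := by
        have := congrArg j hii
        rw [hj1, hj1] at this
        exact opp_inj.mp this
      have gen : ∀ (l l' : NZ) (x : {i // j i = l}) (x' : {i // j i = l'}), l = l' →
          (e l x).1 = (e l' x').1 → x.1 = x'.1 := by
        rintro l l' x x' rfl hx
        rw [(e l).injective (Subtype.ext hx)]
      have hiv : i.1 = i'.1 := gen _ _ ⟨i.1, rfl⟩ ⟨i'.1, rfl⟩ hl hii
      have hi : i = i' := Subtype.ext hiv
      rw [hi]
  have hsurj : Function.Surjective f := by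
    intro i
    by_cases hi : 0 < (j i).1
    · exact ⟨(⟨i, hi⟩, 0), rfl⟩
    · have hne := (j i).2
      have gen : ∀ (l l' : NZ) (x : {i // j i = l}) (x' : {i // j i = l'}), l = l' →
          x.1 = x'.1 → (e l x).1 = (e l' x').1 := by
        rintro l l' x x' rfl hx
        rw [Subtype.ext hx]
      set y := (e (opp (j i))).symm ⟨i, (opp_opp (j i)).symm⟩ with hy
      have hpos : 0 < (j y.1).1 := by rw [y.2, opp_val]; omega
      refine ⟨(⟨y.1, hpos⟩, 1), ?_⟩
      rw [hf1, gen (j y.1) (opp (j i)) ⟨y.1, rfl⟩ y y.2 rfl, hy, Equiv.apply_symm_apply]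
  let F : P × Fin 2 ≃ Fin (k * 2) := Equiv.ofBijective f ⟨hinj, hsurj⟩
  have hcard : Fintype.card P = k := by
    have := Fintype.card_congr F
    rw [Fintype.card_prod, Fintype.card_fin, Fintype.card_fin] at this
    omega
  let G : Fin k ≃ P := (Fintype.equivFinOfCardEq hcard).symm
  refine ⟨(finProdFinEquiv.symm.trans (G.prodCongr (Equiv.refl (Fin 2)))).trans F, ?_⟩
  intro i i' hi hii
  have hk : 0 < k := by have := i.2; omega
  have hi2 := Nat.even_iff.mp hi
  have e1 : finProdFinEquiv.symm i = ((⟨i / 2, by omega⟩ : Fin k), (0 : Fin 2)) := by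
    rw [Equiv.symm_apply_eq]
    apply Fin.ext
    simp only [finProdFinEquiv_apply_val]
    change (i : ℕ) = 0 + 2 * (i / 2)
    omega
  have e2 : finProdFinEquiv.symm i' = ((⟨i / 2, by omega⟩ : Fin k), (1 : Fin 2)) := by
    rw [Equiv.symm_apply_eq]
    apply Fin.ext
    simp only [finProdFinEquiv_apply_val]
    change (i' : ℕ) = 1 + 2 * (i / 2)
    omega
  simp only [Equiv.trans_apply, e1, e2]
  change j (f (G _, 0)) = opp (j (f (G _, 1)))
  rw [hf0, hj1, opp_opp]

theorem paired_opp {m : ℕ} (j : Fin m → NZ) : (fun i => opp (j i)) ∈ Paired m ↔ j ∈ Paired m := by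
  constructor
  · rintro ⟨τ, h⟩
    exact ⟨τ, fun i k hi hk => opp_inj.mp (h i k hi hk)⟩
  · rintro ⟨τ, h⟩
    exact ⟨τ, fun i k hi hk => congrArg opp (h i k hi hk)⟩

theorem opp_mem_S {n₁ n₂ : ℕ+} {j : NZ} : opp j ∈ S n₁ n₂ ↔ j ∈ S n₁ n₂ := by
  simp only [S, Set.mem_insert_iff, Set.mem_singleton_iff, opp_eq_iff, opp_opp]
  tauto

theorem outs_opp {n₁ n₂ : ℕ+} {m : ℕ} (j : Fin m → NZ) :
    outs n₁ n₂ (fun i => opp (j i)) = outs n₁ n₂ j := by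
  unfold outs
  congr 1
  ext i
  simp [opp_mem_S]

/-- The partner of an entry outside `S` is again outside `S`, at a different position because `-j ≠
j`; outside entries of a paired tuple therefore never come alone. -/
theorem outs_eq_zero_of_paired {n₁ n₂ : ℕ+} {m : ℕ} (hm : Even m) {j : Fin m → NZ}
    (hj : j ∈ Paired m) (h : outs n₁ n₂ j ≤ 1) : outs n₁ n₂ j = 0 := by
  classical
  obtain ⟨π, hπ⟩ := exists_perm_of_paired hm hj
  by_contra h0
  obtain ⟨i, hi⟩ := Finset.card_pos.mp (Nat.pos_of_ne_zero h0)
  have hi2 := (Finset.mem_filter.mp hi).2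
  have hπi : π i ∈ Finset.univ.filter fun i => j i ∉ S n₁ n₂ := by
    rw [Finset.mem_filter]
    exact ⟨Finset.mem_univ _, by rw [hπ, opp_mem_S]; exact hi2⟩
  have heq := Finset.card_le_one.mp h _ hi _ hπi
  have := hπ i
  rw [← heq] at this
  exact opp_ne _ this.symm

end Paired

/-! ### Sums and products over multi-indices -/

section Counting

open Classical in
/-- The index set `S` as a finite set. -/
def SF (n₁ n₂ : ℕ+) : Finset NZ := {pos n₁, opp (pos n₁), pos n₂, opp (pos n₂)}

theorem mem_SF {n₁ n₂ : ℕ+} {j : NZ} : j ∈ SF n₁ n₂ ↔ j ∈ S n₁ n₂ := by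
  simp [SF, S]

theorem pos_injective : Function.Injective pos := by
  intro a b h
  have h1 := congrArg Subtype.val h
  apply PNat.eq
  simpa [pos] using h1

theorem pos_ne_opp (a b : ℕ+) : pos a ≠ opp (pos b) := by
  intro h
  have h1 := congrArg Subtype.val h
  have ha := a.pos
  have hb := b.pos
  simp only [pos, opp_val] at h1
  omega

theorem prod_SF {M : Type*} [CommMonoid M] {n₁ n₂ : ℕ+} (hn : n₁ ≠ n₂) (f : NZ → M) :
    ∏ l ∈ SF n₁ n₂, f l =
      f (pos n₁) * (f (opp (pos n₁)) * (f (pos n₂) * f (opp (pos n₂)))) := by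
  have h12 : pos n₁ ≠ pos n₂ := fun h => hn (pos_injective h)
  rw [SF, Finset.prod_insert, Finset.prod_insert, Finset.prod_insert, Finset.prod_singleton]
  · simp [pos_ne_opp]
  · simp [(pos_ne_opp _ _).symm, h12]
  · simp [h12, pos_ne_opp]

theorem sum_SF {M : Type*} [AddCommMonoid M] {n₁ n₂ : ℕ+} (hn : n₁ ≠ n₂) (f : NZ → M) :
    ∑ l ∈ SF n₁ n₂, f l =
      f (pos n₁) + (f (opp (pos n₁)) + (f (pos n₂) + f (opp (pos n₂)))) :=
  prod_SF (M := Multiplicative M) hn f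

variable {n₁ n₂ : ℕ+} {m : ℕ}

theorem outs_eq_zero_iff (j : Fin m → NZ) : outs n₁ n₂ j = 0 ↔ ∀ i, j i ∈ S n₁ n₂ := by
  classical
  rw [outs, Finset.card_eq_zero, Finset.filter_eq_empty_iff]
  simp

/-- The multiplicity of `n` minus the multiplicity of `-n`. -/
def netCnt (j : Fin m → NZ) (n : ℕ+) : ℤ := (cnt j (pos n) : ℤ) - cnt j (opp (pos n))

open Classical in
-- Applied to `g l = l` this gives the momentum and to `g = lam` the divisor, both in terms of the
-- same two net multiplicities.
theorem sum_odd_eq (hn : n₁ ≠ n₂) (j : Fin m → NZ) {g : NZ → ℝ} (hg : ∀ l, g (opp l) = -g l) :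
    ∑ i, g (j i) = ∑ i ∈ Finset.univ.filter (fun i => j i ∉ S n₁ n₂), g (j i) +
      (netCnt j n₁ * g (pos n₁) + netCnt j n₂ * g (pos n₂)) := by
  have h1 : ∑ i ∈ Finset.univ.filter (fun i => j i ∈ S n₁ n₂), g (j i) =
      ∑ l ∈ SF n₁ n₂, cnt j l * g l := by
    rw [← Finset.sum_fiberwise_of_maps_to (g := j) (t := SF n₁ n₂)
      (fun i hi => mem_SF.mpr (Finset.mem_filter.mp hi).2)]
    refine Finset.sum_congr rfl fun l hl => ?_
    rw [Finset.sum_congr rfl (g := fun _ => g l) fun i hi => by rw [(Finset.mem_filter.mp hi).2],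
      Finset.sum_const, nsmul_eq_mul, cnt]
    congr 3
    ext i
    simp only [Finset.mem_filter, Finset.mem_univ, true_and, and_iff_right_iff_imp]
    rintro rfl
    exact mem_SF.mp hl
  rw [← Finset.sum_filter_add_sum_filter_not Finset.univ (fun i => j i ∈ S n₁ n₂), h1, sum_SF hn,
    hg, hg, netCnt, netCnt]
  push_cast
  ring

open Classical in
theorem card_in_eq (hn : n₁ ≠ n₂) (j : Fin m → NZ) :
    cnt j (pos n₁) + (cnt j (opp (pos n₁)) + (cnt j (pos n₂) + cnt j (opp (pos n₂)))) +
      outs n₁ n₂ j = m := by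
  have h1 : (Finset.univ.filter (fun i => j i ∈ S n₁ n₂)).card = ∑ l ∈ SF n₁ n₂, cnt j l := by
    rw [Finset.card_eq_sum_card_fiberwise (f := j) (t := SF n₁ n₂)
      (fun i hi => mem_SF.mpr (Finset.mem_filter.mp hi).2)]
    refine Finset.sum_congr rfl fun l hl => ?_
    rw [cnt]
    congr 1
    ext i
    simp only [Finset.mem_filter, Finset.mem_univ, true_and, and_iff_right_iff_imp]
    rintro rfl
    exact mem_SF.mp hl
  rw [← sum_SF hn (cnt j), ← h1, outs, Finset.card_filter_add_card_filter_not,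
    Finset.card_univ, Fintype.card_fin]

open Classical in
theorem prod_eq_of_outs_eq_zero (hn : n₁ ≠ n₂) {j : Fin m → NZ} (hj : outs n₁ n₂ j = 0)
    (g : NZ → ℂ) : ∏ i, g (j i) = g (pos n₁) ^ cnt j (pos n₁) *
      (g (opp (pos n₁)) ^ cnt j (opp (pos n₁)) *
        (g (pos n₂) ^ cnt j (pos n₂) * g (opp (pos n₂)) ^ cnt j (opp (pos n₂)))) := by
  rw [← prod_SF hn fun l => g l ^ cnt j l,
    ← Finset.prod_fiberwise_of_maps_to (g := j) (t := SF n₁ n₂)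
      (fun i _ => mem_SF.mpr ((outs_eq_zero_iff j).mp hj i))]
  refine Finset.prod_congr rfl fun l _ => ?_
  rw [Finset.prod_congr rfl (g := fun _ => g l) fun i hi => by rw [(Finset.mem_filter.mp hi).2],
    Finset.prod_const, cnt]

theorem cnt_opp_pi (j : Fin m → NZ) (l : NZ) : cnt (fun i => opp (j i)) l = cnt j (opp l) := by
  simp only [cnt, opp_eq_iff]

end Counting

/-! ### Polynomials in the actions -/

/-- The paired terms of a real polynomial with all indices in `S` form a polynomial in the actions
with real coefficients. -/
theorem exists_actionPoly {n₁ n₂ : ℕ+} (hn : n₁ ≠ n₂) (d : ℕ) {c : (Fin (d * 2) → NZ) → ℂ}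
    (hc : Herm c) {D : Set (Fin (d * 2) → NZ)}
    (hD : ∀ j, j ∈ D ↔ outs n₁ n₂ j = 0 ∧ j ∈ Paired (d * 2)) :
    ∃ r : Fin (d + 1) → ℝ, ∀ (p : ℝ) (z : H p), actionPoly n₁ n₂ r z = poly (part c D) z := by
  classical
  have hev : Even (d * 2) := ⟨d, by ring⟩
  set J : Finset (Fin (d * 2) → NZ) :=
    (Fintype.piFinset fun _ => SF n₁ n₂).filter fun j => j ∈ D with hJ
  have hJD : ∀ j, j ∈ J ↔ j ∈ D := by
    intro j
    rw [hJ, Finset.mem_filter, Fintype.mem_piFinset]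
    refine ⟨fun h => h.2, fun h => ⟨fun i => mem_SF.mpr ?_, h⟩⟩
    exact (outs_eq_zero_iff j).mp ((hD j).mp h).1 i
  have hcnt : ∀ j ∈ J, cnt j (pos n₁) + cnt j (pos n₂) = d := by
    intro j hj
    have h1 := (hD j).mp ((hJD j).mp hj)
    have h2 := card_in_eq hn j
    rw [cnt_opp_of_paired hev h1.2, cnt_opp_of_paired hev h1.2, h1.1] at h2
    omega
  have hoppJ : ∀ j, (fun i => opp (j i)) ∈ J ↔ j ∈ J := by
    intro j
    rw [hJD, hJD, hD, hD, outs_opp, paired_opp]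
  -- The minimum only makes `K` land in `Fin (d + 1)`; on `J` the multiplicity of `n₂` is at most
  -- `d` and is not truncated.
  let K : (Fin (d * 2) → NZ) → Fin (d + 1) := fun j => ⟨min (cnt j (pos n₂)) d, by omega⟩
  set s : Fin (d + 1) → ℂ := fun k => ∑ j ∈ J.filter (fun j => K j = k), c j with hs
  -- The involution `j ↦ -j` conjugates the coefficients and, on paired tuples, preserves the
  -- multiplicity of `n₂`, so each group has a real sum.
  have hreal : ∀ k, ((s k).re : ℂ) = s k := by
    intro k
    rw [← Complex.conj_eq_iff_re, hs, map_sum]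
    refine Finset.sum_bij (fun j _ => fun i => opp (j i)) ?_ ?_ ?_ ?_
    · intro j hj
      rw [Finset.mem_filter] at hj ⊢
      refine ⟨(hoppJ j).mpr hj.1, ?_⟩
      rw [← hj.2]
      apply Fin.ext
      simp only [K]
      rw [cnt_opp_pi, cnt_opp_of_paired hev ((hD j).mp ((hJD j).mp hj.1)).2]
    · intro j _ j' _ h
      funext i
      exact opp_inj.mp (congrFun h i)
    · intro j hj
      rw [Finset.mem_filter] at hj
      refine ⟨fun i => opp (j i), ?_, by simp⟩
      rw [Finset.mem_filter]
      refine ⟨(hoppJ j).mpr hj.1, ?_⟩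
      rw [← hj.2]
      apply Fin.ext
      simp only [K]
      rw [cnt_opp_pi, cnt_opp_of_paired hev ((hD j).mp ((hJD j).mp hj.1)).2]
    · intro j _
      exact hc j
  refine ⟨fun k => (s k).re, fun p z => ?_⟩
  have hmon : ∀ j ∈ J, c j * ∏ i, z (j i) = c j *
      ((z (pos n₁) * z (opp (pos n₁))) ^ (d - (K j : ℕ)) *
        (z (pos n₂) * z (opp (pos n₂))) ^ (K j : ℕ)) := by
    intro j hj
    have h1 := (hD j).mp ((hJD j).mp hj)
    have h2 := hcnt j hj
    have hK : (K j : ℕ) = cnt j (pos n₂) := by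
      simp only [K]
      omega
    rw [prod_eq_of_outs_eq_zero hn h1.1 fun l => z l, cnt_opp_of_paired hev h1.2,
      cnt_opp_of_paired hev h1.2, hK, show d - cnt j (pos n₂) = cnt j (pos n₁) by omega,
      mul_pow, mul_pow]
    ring
  have hpoly : poly (part c D) z = ∑ j ∈ J, c j * ∏ i, z (j i) := by
    rw [poly, tsum_eq_sum (s := J)]
    · refine Finset.sum_congr rfl fun j hj => ?_
      rw [part_of_mem ((hJD j).mp hj)]
    · intro j hj
      rw [part_of_notMem fun h => hj ((hJD j).mpr h), zero_mul]
  rw [hpoly, Finset.sum_congr rfl hmon, actionPoly,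
    ← Finset.sum_fiberwise_of_maps_to (g := K) (t := Finset.univ) fun j _ => Finset.mem_univ _]
  refine Finset.sum_congr rfl fun k _ => ?_
  rw [hreal k, hs, mul_assoc, Finset.sum_mul]
  refine Finset.sum_congr rfl fun j hj => ?_
  rw [(Finset.mem_filter.mp hj).2]

/-! ### Small divisors -/

section Divisors

/-- The frequency `λ_a`, for all integers `a`. -/
def lamZ (a : ℤ) : ℝ := (a : ℝ) / (1 + (a : ℝ) ^ 2)

theorem abs_lamZ_le {a : ℤ} {r : ℝ} (hr : 0 < r) (h : r ≤ |(a : ℝ)|) : |lamZ a| ≤ 1 / r := by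
  rw [lamZ, abs_div, abs_of_pos (by positivity : (0 : ℝ) < 1 + (a : ℝ) ^ 2),
    div_le_div_iff₀ (by positivity) hr, ← sq_abs]
  nlinarith

theorem one_div_le_lamZ {n : ℤ} (hn : 1 ≤ n) : 1 / (2 * (n : ℝ)) ≤ lamZ n := by
  have h : (1 : ℝ) ≤ n := by exact_mod_cast hn
  rw [lamZ, div_le_div_iff₀ (by positivity) (by positivity)]
  nlinarith

theorem lamZ_pos {n : ℤ} (hn : 1 ≤ n) : 0 < lamZ n := by
  have h : (1 : ℝ) ≤ n := by exact_mod_cast hn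
  rw [lamZ]
  positivity

theorem one_le_abs_cast {m : ℤ} (hm : m ≠ 0) : (1 : ℝ) ≤ |(m : ℝ)| := by
  exact_mod_cast Int.one_le_abs hm

theorem lamZ_le_abs_mul {n m : ℤ} (hn : 1 ≤ n) (hm : m ≠ 0) : lamZ n ≤ |m * lamZ n| := by
  rw [abs_mul, abs_of_pos (lamZ_pos hn)]
  nlinarith [lamZ_pos hn, one_le_abs_cast hm]

theorem exists_pos_le_of_finite {α : Type*} {s : Set α} (hs : s.Finite) {f : α → ℝ}
    (h : ∀ x ∈ s, 0 < f x) : ∃ κ > 0, ∀ x ∈ s, κ ≤ f x := by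
  rcases s.eq_empty_or_nonempty with rfl | hne
  · exact ⟨1, one_pos, by simp⟩
  · obtain ⟨x, hx, hmin⟩ := Set.exists_min_image s f hs hne
    exact ⟨f x, h x hx, hmin⟩

theorem not_between_sq {y b : ℤ} (h1 : b ^ 2 < y ^ 2) (h2 : y ^ 2 < (b + 1) ^ 2) (hb : 0 ≤ b) :
    False := by
  have e1 : |b| < |y| := sq_lt_sq.mp h1
  have e2 : |y| < |b + 1| := sq_lt_sq.mp h2
  rw [abs_of_nonneg hb] at e1
  rw [abs_of_nonneg (by omega : 0 ≤ b + 1)] at e2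
  omega

theorem sq_cases_of_abs_le_four {m : ℤ} (hm : m ≠ 0) (h : |m| ≤ 4) :
    m ^ 2 = 1 ∨ m ^ 2 = 4 ∨ m ^ 2 = 9 ∨ m ^ 2 = 16 := by
  obtain ⟨h1, h2⟩ := abs_le.mp h
  interval_cases m <;> simp_all

/-- `|m₁| n₁ ≤ 14 n₁ < 40 n₁ ≤ n₂`, so the term in `n₂` cannot be balanced. -/
theorem no_resonance_zero {n₁ n₂ m₁ m₂ : ℤ} (h₁ : 1 ≤ n₁) (h₂ : 40 * n₁ ≤ n₂) (hm : |m₁| ≤ 14)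
    (h : m₁ * n₁ + m₂ * n₂ = 0) : m₁ = 0 ∧ m₂ = 0 := by
  obtain ⟨ha, hb⟩ := abs_le.mp hm
  have hm2 : m₂ = 0 := by
    rcases lt_trichotomy m₂ 0 with h0 | h0 | h0
    · exfalso
      nlinarith
    · exact h0
    · exfalso
      nlinarith
  subst hm2
  refine ⟨?_, rfl⟩
  have : m₁ * n₁ = 0 := by simpa using h
  rcases mul_eq_zero.mp this with h0 | h0
  · exact h0
  · omega

/-- Over a common denominator the numerator is `m n³ (m² - 1)`. -/
theorem sq_eq_one_of_lamZ {n m : ℤ} (hn : 1 ≤ n) (hm : m ≠ 0)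
    (h : lamZ (-(m * n)) + m * lamZ n = 0) : m ^ 2 = 1 := by
  have hn' : (1 : ℝ) ≤ n := by exact_mod_cast hn
  have hm' : (m : ℝ) ≠ 0 := by exact_mod_cast hm
  have e : lamZ (-(m * n)) + m * lamZ n =
      m * n ^ 3 * (m ^ 2 - 1) / ((1 + (m * n : ℝ) ^ 2) * (1 + (n : ℝ) ^ 2)) := by
    rw [lamZ, lamZ]
    push_cast
    field_simp
    ring
  rw [e, div_eq_zero_iff] at h
  rcases h with h | h
  · have h3 : ((m : ℝ) ^ 2 - 1) = 0 := by
      rcases mul_eq_zero.mp h with h' | h'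
      · exfalso
        have : (m : ℝ) * n ^ 3 ≠ 0 := by positivity
        exact this h'
      · exact h'
    have h4 : (m : ℝ) ^ 2 = 1 := by linarith
    exact_mod_cast h4
  · exfalso
    have : (0 : ℝ) < (1 + (m * n : ℝ) ^ 2) * (1 + (n : ℝ) ^ 2) := by positivity
    exact this.ne' h

/-- If only one of `m₁, m₂` is nonzero, `sq_eq_one_of_lamZ` puts `a` into the excluded set. If both
are, `λ_a` and `m₂ λ_{n₂}` are too small to cancel `m₁ λ_{n₁}`, which is at least `1 / (2 n₁)` in
modulus. If both vanish, `a = 0`. -/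
theorem no_resonance_one {n₁ n₂ m₁ m₂ a : ℤ} (h₁ : 1 ≤ n₁) (h₂ : 40 * n₁ ≤ n₂)
    (hm₁ : |m₁| ≤ 9) (hm₂ : |m₂| ≤ 9) (ha0 : a ≠ 0) (ha₁ : a ≠ n₁ ∧ a ≠ -n₁)
    (ha₂ : a ≠ n₂ ∧ a ≠ -n₂) (h : a + m₁ * n₁ + m₂ * n₂ = 0) :
    lamZ a + (m₁ * lamZ n₁ + m₂ * lamZ n₂) ≠ 0 := by
  intro hres
  by_cases hm20 : m₂ = 0
  · subst hm20
    have ha : a = -(m₁ * n₁) := by linarith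
    have hm10 : m₁ ≠ 0 := by rintro rfl; simp at ha; exact ha0 ha
    rw [ha] at hres
    have := sq_eq_one_of_lamZ h₁ hm10 (by simpa using hres)
    rcases sq_eq_one_iff.mp this with h' | h' <;> subst h' <;> omega
  by_cases hm10 : m₁ = 0
  · subst hm10
    have ha : a = -(m₂ * n₂) := by linarith
    rw [ha] at hres
    have := sq_eq_one_of_lamZ (n := n₂) (by omega) hm20 (by simpa using hres)
    rcases sq_eq_one_iff.mp this with h' | h' <;> subst h' <;> omega
  have hn₁ : (1 : ℝ) ≤ n₁ := by exact_mod_cast h₁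
  have hn₂ : 40 * (n₁ : ℝ) ≤ n₂ := by exact_mod_cast h₂
  have hM₁ : |(m₁ : ℝ)| ≤ 9 := by exact_mod_cast hm₁
  have hM₂ : |(m₂ : ℝ)| ≤ 9 := by exact_mod_cast hm₂
  -- `|m₂| n₂ ≥ 40 n₁` and `|m₁| n₁ ≤ 9 n₁`. The contradiction below is `1/31 + 9/40 < 1/2`.
  have hA : 31 * (n₁ : ℝ) ≤ |(a : ℝ)| := by
    have e : (a : ℝ) = -(m₁ * n₁ + m₂ * n₂) := by
      have : (a : ℝ) + m₁ * n₁ + m₂ * n₂ = 0 := by exact_mod_cast h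
      linarith
    have e1 : |(m₂ * n₂ : ℝ)| ≤ |(a : ℝ)| + |(m₁ * n₁ : ℝ)| := by
      have : (m₂ * n₂ : ℝ) = -a - m₁ * n₁ := by linarith
      rw [this]
      exact (abs_sub _ _).trans (by rw [abs_neg])
    rw [abs_mul, abs_mul, abs_of_pos (by linarith : (0 : ℝ) < n₂),
      abs_of_pos (by linarith : (0 : ℝ) < n₁)] at e1
    nlinarith [one_le_abs_cast hm20]
  have b1 := abs_lamZ_le (by positivity) hA
  have b2 : |m₂ * lamZ n₂| ≤ 9 * (1 / (40 * n₁)) := by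
    rw [abs_mul]
    refine mul_le_mul hM₂ (abs_lamZ_le (by positivity) ?_) (abs_nonneg _) (by norm_num)
    exact hn₂.trans (le_abs_self _)
  have b3 := lamZ_le_abs_mul h₁ hm10
  have b4 := one_div_le_lamZ h₁
  have b5 : |m₁ * lamZ n₁| ≤ |lamZ a| + |m₂ * lamZ n₂| := by
    have : m₁ * lamZ n₁ = -lamZ a - m₂ * lamZ n₂ := by linarith
    rw [this]
    exact (abs_sub _ _).trans (by rw [abs_neg])
  have b6 : 1 / (2 * (n₁ : ℝ)) ≤ 1 / (31 * n₁) + 9 * (1 / (40 * n₁)) := by linarith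
  have b7 : 1 / (31 * (n₁ : ℝ)) + 9 * (1 / (40 * n₁)) < 1 / (2 * n₁) := by
    have : (0 : ℝ) < 1 / n₁ := by positivity
    have e1 : 1 / (31 * (n₁ : ℝ)) = 1 / 31 * (1 / n₁) := by ring
    have e2 : 1 / (40 * (n₁ : ℝ)) = 1 / 40 * (1 / n₁) := by ring
    have e3 : 1 / (2 * (n₁ : ℝ)) = 1 / 2 * (1 / n₁) := by ring
    rw [e1, e2, e3]
    linarith
  linarith

/-- Eliminating `a + b = -m n` from the resonance leaves `x² - (3 + n²) x + (m² - 1) n² = 0` for `x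
= a b`. For `m² = 1` the root `n² + 3` exceeds `(a + b)² / 4`. For `m² = 4` the roots are `3`,
incompatible with a large sum, and `n²`, which gives `a = b = ± n`. For `m² = 9, 16` the
discriminant is not a square. -/
theorem no_resonance_two_pure {n m a b : ℤ} (hn : 30 ≤ n) (hm0 : m ≠ 0) (hm : |m| ≤ 4)
    (ha0 : a ≠ 0) (hb0 : b ≠ 0) (ha : a ≠ n ∧ a ≠ -n) (h : a + b + m * n = 0) :
    lamZ a + lamZ b + m * lamZ n ≠ 0 := by
  intro hres
  have hint : m * n * ((1 + a ^ 2) * (1 + b ^ 2) - (1 + a * b) * (1 + n ^ 2)) = 0 := by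
    have e : (lamZ a + lamZ b + m * lamZ n) * ((1 + (a : ℝ) ^ 2) * (1 + (b : ℝ) ^ 2) *
        (1 + (n : ℝ) ^ 2)) = (a + b) * (1 + a * b) * (1 + n ^ 2) +
        m * n * ((1 + a ^ 2) * (1 + b ^ 2)) := by
      rw [lamZ, lamZ, lamZ]
      have h1 : (1 + (a : ℝ) ^ 2) ≠ 0 := by positivity
      have h2 : (1 + (b : ℝ) ^ 2) ≠ 0 := by positivity
      have h3 : (1 + (n : ℝ) ^ 2) ≠ 0 := by positivity
      field_simp
      ring
    rw [hres, zero_mul] at e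
    have e2 : (a + b) * (1 + a * b) * (1 + n ^ 2) + m * n * ((1 + a ^ 2) * (1 + b ^ 2)) = 0 := by
      exact_mod_cast e.symm
    have e3 : a + b = -(m * n) := by linarith
    rw [e3] at e2
    linarith
  have hx : (a * b) ^ 2 - (3 + n ^ 2) * (a * b) + (m ^ 2 - 1) * n ^ 2 = 0 := by
    have hmn : m * n ≠ 0 := mul_ne_zero hm0 (by omega)
    have e1 := (mul_eq_zero.mp hint).resolve_left hmn
    have e2 : (a + b) ^ 2 = m ^ 2 * n ^ 2 := by
      have : a + b = -(m * n) := by linarith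
      rw [this]; ring
    linear_combination e1 - e2
  have hs : (a + b) ^ 2 = m ^ 2 * n ^ 2 := by
    have : a + b = -(m * n) := by linarith
    rw [this]; ring
  set x := a * b with hxdef
  have hx0 : x ≠ 0 := mul_ne_zero ha0 hb0
  have hy : (2 * x - (3 + n ^ 2)) ^ 2 = (3 + n ^ 2) ^ 2 - 4 * ((m ^ 2 - 1) * n ^ 2) := by
    linear_combination 4 * hx
  rcases sq_cases_of_abs_le_four hm0 hm with h2 | h2 | h2 | h2 <;> rw [h2] at hx hs hy
  · have e1 : x * (x - (3 + n ^ 2)) = 0 := by linear_combination hx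
    have e2 : x = 3 + n ^ 2 := by
      rcases mul_eq_zero.mp e1 with h' | h'
      · exact absurd h' hx0
      · linarith
    nlinarith [sq_nonneg (a - b)]
  · have e1 : (x - 3) * (x - n ^ 2) = 0 := by linear_combination hx
    rcases mul_eq_zero.mp e1 with h' | h'
    · have e2 : a * b = 3 := by linarith
      have e3 : a ^ 2 ≤ 9 := by
        have hb1 : 1 ≤ b ^ 2 := by
          have := Int.one_le_abs hb0
          nlinarith [sq_abs b, abs_nonneg b]
        nlinarith [sq_nonneg a]
      have e4 : b ^ 2 ≤ 9 := by
        have ha1 : 1 ≤ a ^ 2 := by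
          have := Int.one_le_abs ha0
          nlinarith [sq_abs a, abs_nonneg a]
        nlinarith [sq_nonneg b]
      nlinarith
    · have e2 : a * b = n ^ 2 := by linarith
      have e3 : (a - b) ^ 2 = 0 := by linear_combination hs - 4 * e2
      have e4 : a = b := by
        have := pow_eq_zero_iff (two_ne_zero) |>.mp e3
        linarith
      rw [← e4] at e2
      rcases sq_eq_sq_iff_eq_or_eq_neg.mp (by rw [← e2]; ring : a ^ 2 = n ^ 2) with h' | h'
      · exact ha.1 h'
      · exact ha.2 h'
  -- The discriminants `n⁴ - 26 n² + 9` and, in the next case, `n⁴ - 54 n² + 9` lie between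
  -- consecutive squares for `n ≥ 30`.
  · exact not_between_sq (y := 2 * x - (3 + n ^ 2)) (b := n ^ 2 - 14)
      (by rw [hy]; nlinarith) (by rw [hy]; nlinarith) (by nlinarith)
  · exact not_between_sq (y := 2 * x - (3 + n ^ 2)) (b := n ^ 2 - 28)
      (by rw [hy]; nlinarith) (by rw [hy]; nlinarith) (by nlinarith)

/-- No momentum condition is available here. A zero would be an integer root `a` of `m n a² + (1 +
n²) a + m n`, with discriminant `(1 + n²)² - 4 m² n²`. For `m² = 1` the roots are `± n` and `± 1 /
n`; otherwise the discriminant lies between consecutive squares. -/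
theorem lamZ_add_mul_ne_zero {n m a : ℤ} (hn : 30 ≤ n) (hm0 : m ≠ 0) (hm : |m| ≤ 4)
    (ha : a ≠ n ∧ a ≠ -n) : lamZ a + m * lamZ n ≠ 0 := by
  intro hres
  have hint : a * (1 + n ^ 2) + m * n * (1 + a ^ 2) = 0 := by
    have e : (lamZ a + m * lamZ n) * ((1 + (a : ℝ) ^ 2) * (1 + (n : ℝ) ^ 2)) =
        a * (1 + n ^ 2) + m * n * (1 + a ^ 2) := by
      rw [lamZ, lamZ]
      have h1 : (1 + (a : ℝ) ^ 2) ≠ 0 := by positivity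
      have h3 : (1 + (n : ℝ) ^ 2) ≠ 0 := by positivity
      field_simp
    rw [hres, zero_mul] at e
    exact_mod_cast e.symm
  have hy : (2 * m * n * a + (1 + n ^ 2)) ^ 2 = (1 + n ^ 2) ^ 2 - 4 * (m ^ 2) * n ^ 2 := by
    linear_combination 4 * m * n * hint
  rcases sq_cases_of_abs_le_four hm0 hm with h2 | h2 | h2 | h2 <;> rw [h2] at hy
  · have hna : ∀ k : ℤ, |k| = 1 → n * a ≠ k := by
      intro k hk hna
      have h3 : |n * a| = 1 := by rw [hna, hk]
      rw [abs_mul, abs_of_pos (by omega : 0 < n)] at h3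
      have h4 := Int.eq_one_or_neg_one_of_mul_eq_one h3
      omega
    rcases sq_eq_one_iff.mp h2 with h' | h' <;> subst h'
    · have hfac : (n * a + 1) * (a + n) = 0 := by linear_combination hint
      rcases mul_eq_zero.mp hfac with h3 | h3
      · exact hna (-1) (by norm_num) (by linarith)
      · exact ha.2 (by linarith)
    · have hfac : (n * a - 1) * (a - n) = 0 := by linear_combination -hint
      rcases mul_eq_zero.mp hfac with h3 | h3
      · exact hna 1 (by norm_num) (by linarith)
      · exact ha.1 (by linarith)
  · exact not_between_sq (y := 2 * m * n * a + (1 + n ^ 2)) (b := n ^ 2 - 8)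
      (by rw [hy]; nlinarith) (by rw [hy]; nlinarith) (by nlinarith)
  · exact not_between_sq (y := 2 * m * n * a + (1 + n ^ 2)) (b := n ^ 2 - 18)
      (by rw [hy]; nlinarith) (by rw [hy]; nlinarith) (by nlinarith)
  · exact not_between_sq (y := 2 * m * n * a + (1 + n ^ 2)) (b := n ^ 2 - 32)
      (by rw [hy]; nlinarith) (by rw [hy]; nlinarith) (by nlinarith)

/-- Momentum determines `a` from `m₁, m₂`, so a minimum over a finite set is positive. -/
theorem exists_divisor_bound_one {n₁ n₂ : ℤ} (h₁ : 1 ≤ n₁) (h₂ : 40 * n₁ ≤ n₂) :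
    ∃ κ > 0, ∀ m₁ m₂ a : ℤ, |m₁| ≤ 9 → |m₂| ≤ 9 → a ≠ 0 → (a ≠ n₁ ∧ a ≠ -n₁) →
      (a ≠ n₂ ∧ a ≠ -n₂) → a + m₁ * n₁ + m₂ * n₂ = 0 →
      κ ≤ |lamZ a + (m₁ * lamZ n₁ + m₂ * lamZ n₂)| := by
  have hfin : {x : ℤ × ℤ | |x.1| ≤ 9 ∧ |x.2| ≤ 9 ∧
      lamZ (-(x.1 * n₁ + x.2 * n₂)) + (x.1 * lamZ n₁ + x.2 * lamZ n₂) ≠ 0}.Finite := by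
    refine ((Set.finite_Icc (-9 : ℤ) 9).prod (Set.finite_Icc (-9 : ℤ) 9)).subset ?_
    rintro ⟨x, y⟩ ⟨hx, hy, -⟩
    exact ⟨abs_le.mp hx, abs_le.mp hy⟩
  obtain ⟨κ, hκ, h⟩ := exists_pos_le_of_finite hfin
    (f := fun x => |lamZ (-(x.1 * n₁ + x.2 * n₂)) + (x.1 * lamZ n₁ + x.2 * lamZ n₂)|)
    fun x hx => abs_pos.mpr hx.2.2
  refine ⟨κ, hκ, fun m₁ m₂ a hm₁ hm₂ ha0 ha₁ ha₂ hs => ?_⟩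
  have hne := no_resonance_one h₁ h₂ hm₁ hm₂ ha0 ha₁ ha₂ hs
  obtain rfl : a = -(m₁ * n₁ + m₂ * n₂) := by linarith
  exact h (m₁, m₂) ⟨hm₁, hm₂, hne⟩

/-- For large `|a|` the term `λ_a` is at most half of `λ_n`, and finitely many `a` remain. With `n =
n₁` the constant does not involve `n₂`, so `n₂` can be taken large against it. -/
theorem exists_lamZ_add_mul_bound {n : ℤ} (hn : 30 ≤ n) :
    ∃ ε > 0, ∀ m a : ℤ, m ≠ 0 → |m| ≤ 4 → (a ≠ n ∧ a ≠ -n) → ε ≤ |lamZ a + m * lamZ n| := by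
  have hpos := lamZ_pos (by omega : 1 ≤ n)
  obtain ⟨A, hA⟩ := exists_nat_gt (2 / lamZ n)
  have hA0 : (0 : ℝ) < A := lt_trans (by positivity) hA
  have hfin : {x : ℤ × ℤ | (x.1 ≠ 0 ∧ |x.1| ≤ 4 ∧ x.2 ≠ n ∧ x.2 ≠ -n) ∧ |x.2| ≤ A}.Finite := by
    refine ((Set.finite_Icc (-4 : ℤ) 4).prod (Set.finite_Icc (-A : ℤ) A)).subset ?_
    rintro ⟨x, y⟩ ⟨⟨-, hx, -⟩, hy⟩
    exact ⟨abs_le.mp hx, abs_le.mp hy⟩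
  obtain ⟨κ, hκ, h⟩ := exists_pos_le_of_finite hfin (f := fun x => |lamZ x.2 + x.1 * lamZ n|)
    fun x hx => abs_pos.mpr (lamZ_add_mul_ne_zero hn hx.1.1 hx.1.2.1 hx.1.2.2)
  refine ⟨min κ (lamZ n / 2), lt_min hκ (by positivity), fun m a hm0 hm ha => ?_⟩
  by_cases hb : |a| ≤ A
  · exact (min_le_left _ _).trans (h (m, a) ⟨⟨hm0, hm, ha⟩, hb⟩)
  · refine (min_le_right _ _).trans ?_
    have hb' : (A : ℝ) ≤ |(a : ℝ)| := by
      have : (A : ℤ) ≤ |a| := by omega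
      exact_mod_cast this
    have e1 := abs_lamZ_le hA0 hb'
    have e2 : 1 / (A : ℝ) ≤ lamZ n / 2 := by
      rw [div_lt_iff₀ hpos] at hA
      rw [div_le_div_iff₀ hA0 (by norm_num)]
      linarith
    have e3 := lamZ_le_abs_mul (by omega : 1 ≤ n) hm0
    have e4 : |m * lamZ n| ≤ |lamZ a + m * lamZ n| + |lamZ a| := by
      have : (m : ℝ) * lamZ n = (lamZ a + m * lamZ n) - lamZ a := by ring
      calc |m * lamZ n| = |(lamZ a + m * lamZ n) - lamZ a| := by rw [← this]
        _ ≤ _ := abs_sub _ _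
    linarith

/-- `λ_b` and `m₂ λ_{n₂}` are each at most `4 / n₂`, together less than `ε`. -/
theorem no_resonance_two_mixed {n₁ n₂ m₁ m₂ a b : ℤ} {ε : ℝ} (h₁ : 1 ≤ n₁) (h₂ : 8 * n₁ ≤ n₂)
    (hε : ∀ m a : ℤ, m ≠ 0 → |m| ≤ 4 → (a ≠ n₁ ∧ a ≠ -n₁) → ε ≤ |lamZ a + m * lamZ n₁|)
    (hn₂ : 8 < ε * n₂) (hm₁ : m₁ ≠ 0) (hM₁ : |m₁| ≤ 4) (hM₂ : |m₂| ≤ 4)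
    (ha : a ≠ n₁ ∧ a ≠ -n₁) (hb : (n₂ : ℝ) / 4 ≤ |(b : ℝ)|) :
    lamZ a + lamZ b + (m₁ * lamZ n₁ + m₂ * lamZ n₂) ≠ 0 := by
  intro hres
  have hn : (0 : ℝ) < n₂ := by
    have : 0 < n₂ := by omega
    exact_mod_cast this
  have e1 := hε m₁ a hm₁ hM₁ ha
  have e2 := abs_lamZ_le (by positivity) hb
  have e3 : |m₂ * lamZ n₂| ≤ 4 * (1 / n₂) := by
    rw [abs_mul]
    have hM : |(m₂ : ℝ)| ≤ 4 := by exact_mod_cast hM₂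
    exact mul_le_mul hM (abs_lamZ_le hn (le_abs_self _)) (abs_nonneg _) (by norm_num)
  have e4 : |lamZ a + m₁ * lamZ n₁| ≤ |lamZ b| + |m₂ * lamZ n₂| := by
    have : lamZ a + m₁ * lamZ n₁ = -lamZ b - m₂ * lamZ n₂ := by linarith
    rw [this]
    exact (abs_sub _ _).trans (by rw [abs_neg])
  have e5 : 1 / ((n₂ : ℝ) / 4) + 4 * (1 / n₂) = 8 / n₂ := by
    field_simp
    norm_num
  have e6 : 8 / (n₂ : ℝ) < ε := by rwa [div_lt_iff₀ hn]
  linarith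

/-- Otherwise `n₂ ≤ |m₂| n₂ < n₂ / 4 + n₂ / 4 + 4 n₁`, and `4 n₁ ≤ n₂ / 10`. -/
theorem quarter_le_abs {n₁ n₂ m₁ m₂ a b : ℤ} (h₁ : 1 ≤ n₁) (h₂ : 40 * n₁ ≤ n₂)
    (hM₁ : |m₁| ≤ 4) (hm₂ : m₂ ≠ 0) (h : a + b + m₁ * n₁ + m₂ * n₂ = 0) :
    (n₂ : ℝ) / 4 ≤ |(a : ℝ)| ∨ (n₂ : ℝ) / 4 ≤ |(b : ℝ)| := by
  by_contra hcon
  push Not at hcon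
  obtain ⟨ha, hb⟩ := hcon
  have hn₁ : (1 : ℝ) ≤ n₁ := by exact_mod_cast h₁
  have hn₂ : 40 * (n₁ : ℝ) ≤ n₂ := by exact_mod_cast h₂
  have hM : |(m₁ : ℝ)| ≤ 4 := by exact_mod_cast hM₁
  have hs : (a : ℝ) + b + m₁ * n₁ + m₂ * n₂ = 0 := by exact_mod_cast h
  have e1 : |(m₂ * n₂ : ℝ)| ≤ |(a : ℝ)| + |(b : ℝ)| + |(m₁ * n₁ : ℝ)| := by
    have : (m₂ * n₂ : ℝ) = -(a + b + m₁ * n₁) := by linarith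
    rw [this, abs_neg]
    exact abs_add_three _ _ _
  rw [abs_mul, abs_mul, abs_of_pos (by linarith : (0 : ℝ) < n₂),
    abs_of_pos (by linarith : (0 : ℝ) < n₁)] at e1
  nlinarith [one_le_abs_cast hm₂]

theorem no_resonance_two {n₁ n₂ m₁ m₂ a b : ℤ} {ε : ℝ} (h₁ : 30 ≤ n₁) (h₂ : 40 * n₁ ≤ n₂)
    (hε : ∀ m a : ℤ, m ≠ 0 → |m| ≤ 4 → (a ≠ n₁ ∧ a ≠ -n₁) → ε ≤ |lamZ a + m * lamZ n₁|)
    (hn₂ : 8 < ε * n₂) (hM₁ : |m₁| ≤ 4) (hM₂ : |m₂| ≤ 4) (hm : ¬(m₁ = 0 ∧ m₂ = 0))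
    (ha0 : a ≠ 0) (hb0 : b ≠ 0) (ha₁ : a ≠ n₁ ∧ a ≠ -n₁) (ha₂ : a ≠ n₂ ∧ a ≠ -n₂)
    (hb₁ : b ≠ n₁ ∧ b ≠ -n₁) (h : a + b + m₁ * n₁ + m₂ * n₂ = 0) :
    lamZ a + lamZ b + (m₁ * lamZ n₁ + m₂ * lamZ n₂) ≠ 0 := by
  by_cases hm₂ : m₂ = 0
  · subst hm₂
    have := no_resonance_two_pure h₁ (fun h0 => hm ⟨h0, rfl⟩) hM₁ ha0 hb0 ha₁ (by simpa using h)
    simpa using this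
  by_cases hm₁ : m₁ = 0
  · subst hm₁
    have := no_resonance_two_pure (n := n₂) (by omega) hm₂ hM₂ ha0 hb0 ha₂ (by simpa using h)
    simpa using this
  rcases quarter_le_abs (by omega) h₂ hM₁ hm₂ h with hq | hq
  · have := no_resonance_two_mixed (by omega) (by omega) hε hn₂ hm₁ hM₁ hM₂ hb₁ hq
    rwa [add_comm (lamZ b)] at this
  · exact no_resonance_two_mixed (by omega) (by omega) hε hn₂ hm₁ hM₁ hM₂ ha₁ hq

theorem combination_ne_zero {n₁ n₂ m₁ m₂ : ℤ} (h₁ : 1 ≤ n₁) (h₂ : 40 * n₁ ≤ n₂)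
    (hM₂ : |m₂| ≤ 4) (hm : ¬(m₁ = 0 ∧ m₂ = 0)) : m₁ * lamZ n₁ + m₂ * lamZ n₂ ≠ 0 := by
  intro h
  have hp₂ := lamZ_pos (by omega : 1 ≤ n₂)
  by_cases hm₁ : m₁ = 0
  · have hm₂ : m₂ ≠ 0 := fun h0 => hm ⟨hm₁, h0⟩
    rw [hm₁, Int.cast_zero, zero_mul, zero_add] at h
    have := lamZ_le_abs_mul (by omega : 1 ≤ n₂) hm₂
    rw [h, abs_zero] at this
    linarith
  have hn₁ : (1 : ℝ) ≤ n₁ := by exact_mod_cast h₁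
  have hn₂ : 40 * (n₁ : ℝ) ≤ n₂ := by exact_mod_cast h₂
  have hM : |(m₂ : ℝ)| ≤ 4 := by exact_mod_cast hM₂
  have e1 := lamZ_le_abs_mul h₁ hm₁
  have e2 := one_div_le_lamZ h₁
  have e3 : |m₂ * lamZ n₂| ≤ 4 * (1 / (40 * n₁)) := by
    rw [abs_mul]
    exact mul_le_mul hM (abs_lamZ_le (by positivity) (hn₂.trans (le_abs_self _)))
      (abs_nonneg _) (by norm_num)
  have e4 : |m₁ * lamZ n₁| = |m₂ * lamZ n₂| := by
    rw [eq_neg_of_add_eq_zero_left h, abs_neg]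
  have e5 : 4 * (1 / (40 * (n₁ : ℝ))) < 1 / (2 * n₁) := by
    have : (0 : ℝ) < 1 / n₁ := by positivity
    have e1 : 1 / (40 * (n₁ : ℝ)) = 1 / 40 * (1 / n₁) := by ring
    have e3 : 1 / (2 * (n₁ : ℝ)) = 1 / 2 * (1 / n₁) := by ring
    rw [e1, e3]
    linarith
  linarith

/-- For `|a| ≤ T` there are finitely many divisors, all nonzero by `no_resonance_two`. Beyond `T`
both outside frequencies are at most a quarter of the least contribution `ρ` of the indices in `S`.
-/
theorem exists_divisor_bound_two {n₁ : ℤ} (h₁ : 30 ≤ n₁) : ∃ N : ℕ, ∀ n₂ : ℤ, N ≤ n₂ →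
    ∃ κ > 0, ∀ m₁ m₂ a b : ℤ, |m₁| ≤ 4 → |m₂| ≤ 4 → ¬(m₁ = 0 ∧ m₂ = 0) → a ≠ 0 → b ≠ 0 →
      (a ≠ n₁ ∧ a ≠ -n₁) → (a ≠ n₂ ∧ a ≠ -n₂) → (b ≠ n₁ ∧ b ≠ -n₁) →
      a + b + m₁ * n₁ + m₂ * n₂ = 0 →
      κ ≤ |lamZ a + lamZ b + (m₁ * lamZ n₁ + m₂ * lamZ n₂)| := by
  obtain ⟨ε, hε0, hε⟩ := exists_lamZ_add_mul_bound h₁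
  obtain ⟨N, hN⟩ := exists_nat_gt (8 / ε)
  refine ⟨max N (40 * n₁).toNat, fun n₂ hn₂ => ?_⟩
  have h₂ : 40 * n₁ ≤ n₂ := by
    have := le_max_right N (40 * n₁).toNat
    omega
  have hεn : 8 < ε * n₂ := by
    have e1 : (N : ℤ) ≤ n₂ := by
      have := le_max_left N (40 * n₁).toNat
      omega
    have e2 : (N : ℝ) ≤ n₂ := by exact_mod_cast e1
    rw [div_lt_iff₀ hε0] at hN
    nlinarith
  -- a lower bound for the contribution of the indices in `S`
  have hfin0 : {x : ℤ × ℤ | |x.1| ≤ 4 ∧ |x.2| ≤ 4 ∧ ¬(x.1 = 0 ∧ x.2 = 0)}.Finite := by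
    refine ((Set.finite_Icc (-4 : ℤ) 4).prod (Set.finite_Icc (-4 : ℤ) 4)).subset ?_
    rintro ⟨x, y⟩ ⟨hx, hy, -⟩
    exact ⟨abs_le.mp hx, abs_le.mp hy⟩
  obtain ⟨ρ, hρ, hρm⟩ := exists_pos_le_of_finite hfin0
    (f := fun x => |x.1 * lamZ n₁ + x.2 * lamZ n₂|)
    fun x hx => abs_pos.mpr (combination_ne_zero (by omega) h₂ hx.2.1 hx.2.2)
  obtain ⟨A, hA⟩ := exists_nat_gt (4 / ρ)
  have hA0 : (0 : ℝ) < A := lt_trans (by positivity) hA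
  -- By momentum, `|a| > T` leaves `|b| ≥ A` as well, as `|m₁|, |m₂| ≤ 4`.
  set T : ℤ := A + 4 * n₁ + 4 * n₂ with hT
  have hfin : {x : (ℤ × ℤ) × ℤ | (|x.1.1| ≤ 4 ∧ |x.1.2| ≤ 4 ∧ |x.2| ≤ T) ∧
      lamZ x.2 + lamZ (-(x.2 + x.1.1 * n₁ + x.1.2 * n₂)) +
        (x.1.1 * lamZ n₁ + x.1.2 * lamZ n₂) ≠ 0}.Finite := by
    refine (((Set.finite_Icc (-4 : ℤ) 4).prod (Set.finite_Icc (-4 : ℤ) 4)).prod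
      (Set.finite_Icc (-T) T)).subset ?_
    rintro ⟨⟨x, y⟩, w⟩ ⟨⟨hx, hy, hw⟩, -⟩
    exact ⟨⟨abs_le.mp hx, abs_le.mp hy⟩, abs_le.mp hw⟩
  obtain ⟨κ, hκ, hκm⟩ := exists_pos_le_of_finite hfin
    (f := fun x => |lamZ x.2 + lamZ (-(x.2 + x.1.1 * n₁ + x.1.2 * n₂)) +
        (x.1.1 * lamZ n₁ + x.1.2 * lamZ n₂)|) fun x hx => abs_pos.mpr hx.2
  refine ⟨min κ (ρ / 2), lt_min hκ (by positivity), ?_⟩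
  intro m₁ m₂ a b hM₁ hM₂ hm ha0 hb0 ha₁ ha₂ hb₁ hs
  have hne := no_resonance_two h₁ h₂ hε hεn hM₁ hM₂ hm ha0 hb0 ha₁ ha₂ hb₁ hs
  obtain rfl : b = -(a + m₁ * n₁ + m₂ * n₂) := by linarith
  by_cases haT : |a| ≤ T
  · exact (min_le_left _ _).trans (hκm ((m₁, m₂), a) ⟨⟨hM₁, hM₂, haT⟩, hne⟩)
  · refine (min_le_right _ _).trans ?_
    set b := -(a + m₁ * n₁ + m₂ * n₂) with hb
    have hbA : (A : ℤ) ≤ |b| := by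
      have e1 : |a| ≤ |b| + |m₁ * n₁| + |m₂ * n₂| := by
        have : a = -(b + m₁ * n₁ + m₂ * n₂) := by linarith
        calc |a| = |b + m₁ * n₁ + m₂ * n₂| := by rw [this, abs_neg]
          _ ≤ _ := abs_add_three _ _ _
      rw [abs_mul, abs_mul, abs_of_pos (by omega : 0 < n₁), abs_of_pos (by omega : 0 < n₂)] at e1
      nlinarith
    have haA : (A : ℤ) ≤ |a| := by omega
    have e1 := abs_lamZ_le (a := a) hA0 (by exact_mod_cast haA)
    have e2 := abs_lamZ_le (a := b) hA0 (by exact_mod_cast hbA)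
    have e3 : 1 / (A : ℝ) ≤ ρ / 4 := by
      rw [div_lt_iff₀ hρ] at hA
      rw [div_le_div_iff₀ hA0 (by norm_num)]
      linarith
    have e4 := hρm (m₁, m₂) ⟨hM₁, hM₂, hm⟩
    have e5 : |m₁ * lamZ n₁ + m₂ * lamZ n₂| ≤
        |lamZ a + lamZ b + (m₁ * lamZ n₁ + m₂ * lamZ n₂)| + (|lamZ a| + |lamZ b|) := by
      have : m₁ * lamZ n₁ + m₂ * lamZ n₂ =
          (lamZ a + lamZ b + (m₁ * lamZ n₁ + m₂ * lamZ n₂)) - (lamZ a + lamZ b) := by ring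
      calc |m₁ * lamZ n₁ + m₂ * lamZ n₂| = |(lamZ a + lamZ b + (m₁ * lamZ n₁ + m₂ * lamZ n₂)) -
            (lamZ a + lamZ b)| := by rw [← this]
        _ ≤ _ := (abs_sub _ _).trans (add_le_add le_rfl (abs_add_le _ _))
    simp only at e4
    linarith

end Divisors

/-! ### Divisors of tuples of indices -/

section Divisors

variable {n₁ n₂ : ℕ+} {m : ℕ}

open Classical in
theorem sum_val_eq (hn : n₁ ≠ n₂) (j : Fin m → NZ) :
    ∑ i, (j i).1 = ∑ i ∈ Finset.univ.filter (fun i => j i ∉ S n₁ n₂), (j i).1 +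
      (netCnt j n₁ * (n₁ : ℤ) + netCnt j n₂ * (n₂ : ℤ)) := by
  have h := sum_odd_eq hn j (g := fun l => (l.1 : ℝ)) (fun l => by simp [opp_val])
  simp only [pos] at h
  exact_mod_cast h

/-- This supplies the ranges of the resonance lemmas: at most `9` for ten indices with one outside
`S`, at most `4` for six indices with two outside. -/
theorem abs_netCnt_add_outs_le (hn : n₁ ≠ n₂) (j : Fin m → NZ) :
    |netCnt j n₁| + outs n₁ n₂ j ≤ m ∧ |netCnt j n₂| + outs n₁ n₂ j ≤ m := by
  have h := card_in_eq hn j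
  have h1 : |netCnt j n₁| ≤ m - outs n₁ n₂ j := by
    rw [abs_le, netCnt]; constructor <;> omega
  have h2 : |netCnt j n₂| ≤ m - outs n₁ n₂ j := by
    rw [abs_le, netCnt]; constructor <;> omega
  constructor <;> linarith

theorem cnt_opp_eq_of_netCnt {j : Fin m → NZ} (h₁ : netCnt j n₁ = 0) (h₂ : netCnt j n₂ = 0)
    (h : ∀ l ∉ S n₁ n₂, cnt j (opp l) = cnt j l) (l : NZ) : cnt j (opp l) = cnt j l := by
  by_cases hl : l ∈ S n₁ n₂
  · rw [netCnt] at h₁ h₂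
    rcases hl with rfl | rfl | rfl | rfl
    · omega
    · rw [opp_opp]; omega
    · omega
    · rw [opp_opp]; omega
  · exact h l hl

open Classical in
theorem cnt_eq_sum_outs {j : Fin m → NZ} {l : NZ} (hl : l ∉ S n₁ n₂) :
    cnt j l = ∑ i ∈ Finset.univ.filter (fun i => j i ∉ S n₁ n₂), if j i = l then 1 else 0 := by
  rw [cnt, Finset.card_filter, Finset.sum_filter]
  refine Finset.sum_congr rfl fun i _ => ?_
  by_cases h : j i = l
  · rw [if_pos h, if_pos (h ▸ hl)]
  · simp [h]

theorem paired_of_outs_eq_zero (h40 : 40 * (n₁ : ℕ) ≤ n₂) {k : ℕ} (hk : k * 2 ≤ 14)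
    {j : Fin (k * 2) → NZ} (hj : outs n₁ n₂ j = 0) (hs : ∑ i, (j i).1 = 0) :
    j ∈ Paired (k * 2) := by
  classical
  have hpos := n₁.pos
  have hn : n₁ ≠ n₂ := by rintro rfl; omega
  have hO : (Finset.univ.filter fun i => j i ∉ S n₁ n₂) = ∅ := Finset.card_eq_zero.mp hj
  have h1 := sum_val_eq hn j
  rw [hO, Finset.sum_empty, zero_add, hs] at h1
  have hb := (abs_netCnt_add_outs_le hn j).1
  obtain ⟨e1, e2⟩ := no_resonance_zero (n₁ := n₁) (n₂ := n₂) (by exact_mod_cast hpos)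
    (by exact_mod_cast h40) (by omega) h1.symm
  refine paired_of_cnt (cnt_opp_eq_of_netCnt e1 e2 fun l hl => ?_)
  rw [cnt_eq_sum_outs hl, cnt_eq_sum_outs (mt opp_mem_S.mp hl), hO, Finset.sum_empty,
    Finset.sum_empty]

theorem val_ne_of_notMem_S {l : NZ} (hl : l ∉ S n₁ n₂) :
    (l.1 ≠ n₁ ∧ l.1 ≠ -n₁) ∧ (l.1 ≠ n₂ ∧ l.1 ≠ -n₂) := by
  refine ⟨⟨?_, ?_⟩, ?_, ?_⟩ <;> intro h <;> apply hl
  · exact Or.inl (Subtype.ext h)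
  · exact Or.inr (Or.inl (Subtype.ext h))
  · exact Or.inr (Or.inr (Or.inl (Subtype.ext h)))
  · exact Or.inr (Or.inr (Or.inr (Subtype.ext h)))

/-- The divisors of the unpaired tuples with at most one index outside of `S` are bounded
below. -/
theorem exists_divisor_bound_outs_le_one (h40 : 40 * (n₁ : ℕ) ≤ n₂) :
    ∃ κ : ℝ, 0 < κ ∧ ∀ k : ℕ, k * 2 ≤ 10 → ∀ j : Fin (k * 2) → NZ, outs n₁ n₂ j ≤ 1 →
      j ∉ Paired (k * 2) → ∑ i, (j i).1 = 0 → κ ≤ |∑ i, lam (j i)| := by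
  classical
  have hpos := n₁.pos
  have hn : n₁ ≠ n₂ := by rintro rfl; omega
  obtain ⟨κ, hκ, H⟩ := exists_divisor_bound_one (n₁ := n₁) (n₂ := n₂) (by exact_mod_cast hpos)
    (by exact_mod_cast h40)
  refine ⟨κ, hκ, fun k hk j ho hP hs => ?_⟩
  have ho1 : outs n₁ n₂ j = 1 := by
    by_contra h
    exact hP (paired_of_outs_eq_zero h40 (by omega) (by omega) hs)
  obtain ⟨i, hO⟩ := Finset.card_eq_one.mp ho1
  have hi : j i ∉ S n₁ n₂ :=
    (Finset.mem_filter.mp (hO ▸ Finset.mem_singleton_self i : i ∈ Finset.univ.filter _)).2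
  have hb := abs_netCnt_add_outs_le hn j
  have h1 := sum_val_eq hn j
  rw [sum_odd_eq hn j lam_opp]
  rw [hO, Finset.sum_singleton] at h1 ⊢
  have hv := val_ne_of_notMem_S hi
  exact H _ _ _ (by omega) (by omega) (j i).2 hv.1 hv.2 (by linarith)

/-- The divisors of the unpaired tuples of length six with at most two indices outside of `S` are
bounded below. -/
theorem exists_divisor_bound_outs_le_two (h30 : 30 ≤ (n₁ : ℕ)) :
    ∃ N : ℕ, ∀ n₂ : ℕ+, N ≤ n₂ → ∃ κ : ℝ, 0 < κ ∧ ∀ j : Fin 6 → NZ, outs n₁ n₂ j ≤ 2 →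
      j ∉ Paired 6 → ∑ i, (j i).1 = 0 → κ ≤ |∑ i, lam (j i)| := by
  classical
  obtain ⟨N, hN⟩ := exists_divisor_bound_two (n₁ := n₁) (by exact_mod_cast h30)
  refine ⟨max N (40 * n₁), fun n₂ hn₂ => ?_⟩
  have h40 : 40 * (n₁ : ℕ) ≤ n₂ := (le_max_right _ _).trans hn₂
  have hn : n₁ ≠ n₂ := by rintro rfl; omega
  obtain ⟨κ₁, hκ₁, H₁⟩ := exists_divisor_bound_outs_le_one h40
  obtain ⟨κ₂, hκ₂, H₂⟩ := hN n₂ (by exact_mod_cast (le_max_left _ _).trans hn₂)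
  refine ⟨min κ₁ κ₂, lt_min hκ₁ hκ₂, fun j ho hP hs => ?_⟩
  by_cases ho1 : outs n₁ n₂ j ≤ 1
  · exact (min_le_left _ _).trans (H₁ 3 (by norm_num) j ho1 hP hs)
  refine (min_le_right _ _).trans ?_
  obtain ⟨i, k, hik, hO⟩ := Finset.card_eq_two.mp (show outs n₁ n₂ j = 2 by omega)
  have hmem : ∀ x ∈ ({i, k} : Finset (Fin 6)), j x ∉ S n₁ n₂ := fun x hx =>
    (Finset.mem_filter.mp (hO ▸ hx : x ∈ Finset.univ.filter _)).2
  have hi := val_ne_of_notMem_S (hmem i (by simp))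
  have hk := val_ne_of_notMem_S (hmem k (by simp))
  have hb := abs_netCnt_add_outs_le hn j
  have h1 := sum_val_eq hn j
  rw [sum_odd_eq hn j lam_opp]
  rw [hO, Finset.sum_pair hik] at h1 ⊢
  refine H₂ _ _ _ _ (by omega) (by omega) ?_ (j i).2 (j k).2 hi.1 hi.2 hk.1 (by linarith)
  -- If both net multiplicities vanish, momentum makes the two outside indices opposite, and the
  -- tuple is paired.
  rintro ⟨e1, e2⟩
  have hk : j k = opp (j i) := Subtype.ext (by
    rw [hs, e1, e2] at h1
    rw [opp_val]
    linarith)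
  refine hP (paired_of_cnt (k := 3) (cnt_opp_eq_of_netCnt e1 e2 fun l hl => ?_))
  rw [cnt_eq_sum_outs hl, cnt_eq_sum_outs (mt opp_mem_S.mp hl), hO, Finset.sum_pair hik,
    Finset.sum_pair hik, hk, add_comm]
  simp only [opp_eq_iff, opp_opp]

end Divisors

/-! ### Lie transforms -/

section LieTransform

variable {p : ℝ} {m : ℕ} {f : (Fin (m + 1) → NZ) → ℂ} {A B : H p → ℂ}

theorem vfield_analyticAt (hp : 0 < p) (hf : Admissible f) (z : H p) :
    AnalyticAt ℂ (vfield hp hf) z :=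
  ((H.incl (by linarith : p ≤ p + 1)).analyticAt _).comp (field_analyticAt hp hf z)

theorem poisson_analyticOnNhd (hp : 0 < p) (hf : Admissible f) (hA : AnalyticOnNhd ℂ A Set.univ) :
    AnalyticOnNhd ℂ (poisson A (poly f)) Set.univ := by
  intro z _
  have h : poisson A (poly f) = fun w => fderiv ℂ A w (vfield hp hf w) :=
    funext (poisson_poly_right hp hf A)
  rw [h]
  exact (ContinuousLinearMap.analyticAt_bilinear (ContinuousLinearMap.id ℂ (H p →L[ℂ] ℂ)) _).comp
    ((hA z trivial).fderiv.prod (vfield_analyticAt hp hf z))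

theorem poisson_add (hp : 0 < p) (hf : Admissible f) (hA : AnalyticOnNhd ℂ A Set.univ)
    (hB : AnalyticOnNhd ℂ B Set.univ) :
    poisson (fun w => A w + B w) (poly f) =
      fun w => poisson A (poly f) w + poisson B (poly f) w := by
  funext z
  rw [poisson_poly_right hp hf, poisson_poly_right hp hf, poisson_poly_right hp hf,
    fderiv_fun_add (hA z trivial).differentiableAt (hB z trivial).differentiableAt]
  rfl

theorem poisson_const_mul (hp : 0 < p) (hf : Admissible f) (a : ℂ)
    (hA : AnalyticOnNhd ℂ A Set.univ) :
    poisson (fun w => a * A w) (poly f) = fun w => a * poisson A (poly f) w := by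
  funext z
  rw [poisson_poly_right hp hf, poisson_poly_right hp hf,
    fderiv_const_mul (hA z trivial).differentiableAt]
  rfl

theorem poisson_combination (hp : 0 < p) (hf : Admissible f) (a b : ℂ)
    (hA : AnalyticOnNhd ℂ A Set.univ) (hB : AnalyticOnNhd ℂ B Set.univ) :
    poisson (fun w => a * A w + b * B w) (poly f) =
      fun w => a * poisson A (poly f) w + b * poisson B (poly f) w := by
  rw [poisson_add hp hf (analyticOnNhd_const.mul hA) (analyticOnNhd_const.mul hB),
    poisson_const_mul hp hf a hA, poisson_const_mul hp hf b hB]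

/-- `γ` is an integral curve on `[0, 1]` of the Hamiltonian vector field of `poly f`. -/
def IsOrbit (hp : 0 < p) (hf : Admissible f) (γ : ℝ → H p) : Prop :=
  ∀ t ∈ Set.Icc (0 : ℝ) 1, HasDerivWithinAt γ (vfield hp hf (γ t)) (Set.Icc 0 1) t

theorem IsOrbit.hasDerivWithinAt {hp : 0 < p} {hf : Admissible f} {γ : ℝ → H p}
    (hγ : IsOrbit hp hf γ) (hA : AnalyticOnNhd ℂ A Set.univ) {t : ℝ} (ht : t ∈ Set.Icc (0 : ℝ) 1) :
    HasDerivWithinAt (fun s => A (γ s)) (poisson A (poly f) (γ t)) (Set.Icc 0 1) t := by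
  rw [poisson_poly_right hp hf]
  exact ((hA (γ t) trivial).differentiableAt.hasFDerivAt.restrictScalars ℝ).comp_hasDerivWithinAt
    t (hγ t ht)

theorem IsOrbit.continuousOn {hp : 0 < p} {hf : Admissible f} {γ : ℝ → H p}
    (hγ : IsOrbit hp hf γ) (hA : AnalyticOnNhd ℂ A Set.univ) :
    ContinuousOn (fun s => A (γ s)) (Set.Icc 0 1) :=
  fun _ ht => (hγ.hasDerivWithinAt hA ht).continuousWithinAt

theorem integral_unitInterval_eq_sub {U U' : ℝ → ℂ}
    (h : ∀ t ∈ Set.Icc (0 : ℝ) 1, HasDerivWithinAt U (U' t) (Set.Icc 0 1) t)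
    (hc : ContinuousOn U' (Set.Icc 0 1)) : ∫ t in (0 : ℝ)..1, U' t = U 1 - U 0 := by
  refine intervalIntegral.integral_eq_sub_of_hasDerivAt_of_le zero_le_one
    (fun t ht => (h t ht).continuousWithinAt)
    (fun t ht => (h t (Set.Ioo_subset_Icc_self ht)).hasDerivAt (Icc_mem_nhds ht.1 ht.2)) ?_
  exact ContinuousOn.intervalIntegrable_of_Icc zero_le_one hc

theorem hasDerivWithinAt_ofReal (t : ℝ) (s : Set ℝ) :
    HasDerivWithinAt (fun x : ℝ => (x : ℂ)) 1 s t :=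
  ((hasDerivAt_id t).ofReal_comp).hasDerivWithinAt

/-- The transform of `L + B + Q` to second order, where `{L, F} = -Q`. -/
theorem IsOrbit.lie_transform_two {hp : 0 < p} {hf : Admissible f} {γ : ℝ → H p}
    (hγ : IsOrbit hp hf γ) {L B Q : H p → ℂ} (hL : AnalyticOnNhd ℂ L Set.univ)
    (hB : AnalyticOnNhd ℂ B Set.univ) (hQ : AnalyticOnNhd ℂ Q Set.univ)
    (hLQ : ∀ z, poisson L (poly f) z = -Q z) :
    L (γ 1) + B (γ 1) + Q (γ 1) = L (γ 0) + B (γ 0) +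
      poisson (fun w => B w + 1 / 2 * Q w) (poly f) (γ 0) +
      poisson (poisson (fun w => 1 / 2 * B w + 1 / 3 * Q w) (poly f)) (poly f) (γ 0) +
      ∫ t in (0 : ℝ)..1, poisson (poisson (poisson
        (fun w => 1 / 2 * ((t : ℂ) - 1) ^ 2 * B w + 1 / 6 * ((t : ℂ) ^ 3 - 3 * t + 2) * Q w)
        (poly f)) (poly f)) (poly f) (γ t) := by
  have hB1 := poisson_analyticOnNhd hp hf hB
  have hB2 := poisson_analyticOnNhd hp hf hB1
  have hB3 := poisson_analyticOnNhd hp hf hB2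
  have hQ1 := poisson_analyticOnNhd hp hf hQ
  have hQ2 := poisson_analyticOnNhd hp hf hQ1
  have hQ3 := poisson_analyticOnNhd hp hf hQ2
  have h1 := poisson_combination hp hf 1 (1 / 2) hB hQ
  simp only [one_mul] at h1
  simp only [h1, poisson_combination hp hf _ _ hB hQ, poisson_combination hp hf _ _ hB1 hQ1,
    poisson_combination hp hf _ _ hB2 hQ2]
  -- The coefficient functions make the derivative telescope: each bracket produced by one term is
  -- cancelled by the derivative of the next coefficient, and `{L, F} = -Q` cancels the first `Q`.
  -- Those of brackets vanish at `1`, so only `L + B + Q` remains there.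
  rw [integral_unitInterval_eq_sub (U := fun t => L (γ t) + B (γ t) +
    ((1 - t) * poisson B (poly f) (γ t) +
      1 / 2 * ((t : ℂ) - 1) ^ 2 * poisson (poisson B (poly f)) (poly f) (γ t)) +
    (t * Q (γ t) + 1 / 2 * (1 - (t : ℂ) ^ 2) * poisson Q (poly f) (γ t) +
      1 / 6 * ((t : ℂ) ^ 3 - 3 * t + 2) * poisson (poisson Q (poly f)) (poly f) (γ t)))]
  · push_cast
    ring
  · intro t ht
    have hi := hasDerivWithinAt_ofReal t (Set.Icc 0 1)
    have hd := ((hγ.hasDerivWithinAt hL ht).add (hγ.hasDerivWithinAt hB ht)).add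
      (((hi.const_sub 1).mul (hγ.hasDerivWithinAt hB1 ht)).add
        ((((hi.sub_const 1).pow 2).const_mul (1 / 2)).mul (hγ.hasDerivWithinAt hB2 ht))) |>.add
      (((hi.mul (hγ.hasDerivWithinAt hQ ht)).add
        ((((hi.pow 2).const_sub 1).const_mul (1 / 2)).mul (hγ.hasDerivWithinAt hQ1 ht))).add
        (((((hi.pow 3).sub (hi.const_mul 3)).add_const 2).const_mul (1 / 6)).mul
          (hγ.hasDerivWithinAt hQ2 ht)))
    refine hd.congr_deriv ?_
    rw [hLQ]
    simp
    ring
  · have hi : ContinuousOn (fun t : ℝ => (t : ℂ)) (Set.Icc 0 1) :=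
      Complex.continuous_ofReal.continuousOn
    have e1 := hγ.continuousOn hB3
    have e2 := hγ.continuousOn hQ3
    fun_prop

/-- The transform of `L + B + R + Q + T` to first order, where `{L, F} = -Q`. -/
theorem IsOrbit.lie_transform_one {hp : 0 < p} {hf : Admissible f} {γ : ℝ → H p}
    (hγ : IsOrbit hp hf γ) {L B R Q T : H p → ℂ} (hL : AnalyticOnNhd ℂ L Set.univ)
    (hB : AnalyticOnNhd ℂ B Set.univ) (hR : AnalyticOnNhd ℂ R Set.univ)
    (hQ : AnalyticOnNhd ℂ Q Set.univ) (hT : AnalyticOnNhd ℂ T Set.univ)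
    (hLQ : ∀ z, poisson L (poly f) z = -Q z) :
    L (γ 1) + B (γ 1) + R (γ 1) + Q (γ 1) + T (γ 1) =
      L (γ 0) + B (γ 0) + R (γ 0) + T (γ 0) + poisson B (poly f) (γ 0) +
      ∫ t in (0 : ℝ)..1, ((1 - (t : ℂ)) * poisson (poisson B (poly f)) (poly f) (γ t) +
        poisson (fun w => R w + (t : ℂ) * Q w + T w) (poly f) (γ t)) := by
  have hB1 := poisson_analyticOnNhd hp hf hB
  have hB2 := poisson_analyticOnNhd hp hf hB1
  have hR1 := poisson_analyticOnNhd hp hf hR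
  have hQ1 := poisson_analyticOnNhd hp hf hQ
  have hT1 := poisson_analyticOnNhd hp hf hT
  have h1 : ∀ t : ℂ, poisson (fun w => R w + t * Q w + T w) (poly f) = fun w =>
      poisson R (poly f) w + t * poisson Q (poly f) w + poisson T (poly f) w := fun t => by
    rw [poisson_add hp hf (A := fun w => R w + t * Q w) (hR.add (analyticOnNhd_const.mul hQ)) hT,
      poisson_add hp hf hR (analyticOnNhd_const.mul hQ), poisson_const_mul hp hf t hQ]
  simp only [h1]
  -- Only `B` is expanded to first order; the brackets of `R`, `Q` and `T` stay under the integral.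
  rw [integral_unitInterval_eq_sub (U := fun t => L (γ t) + B (γ t) + R (γ t) + T (γ t) +
    ((1 - t) * poisson B (poly f) (γ t) + t * Q (γ t)))]
  · push_cast
    ring
  · intro t ht
    have hi := hasDerivWithinAt_ofReal t (Set.Icc 0 1)
    have hd := ((((hγ.hasDerivWithinAt hL ht).add (hγ.hasDerivWithinAt hB ht)).add
      (hγ.hasDerivWithinAt hR ht)).add (hγ.hasDerivWithinAt hT ht)).add
      (((hi.const_sub 1).mul (hγ.hasDerivWithinAt hB1 ht)).add
        (hi.mul (hγ.hasDerivWithinAt hQ ht)))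
    refine hd.congr_deriv ?_
    rw [hLQ]
    ring
  · have hi : ContinuousOn (fun t : ℝ => (t : ℂ)) (Set.Icc 0 1) :=
      Complex.continuous_ofReal.continuousOn
    have e1 := hγ.continuousOn hB2
    have e2 := hγ.continuousOn hR1
    have e3 := hγ.continuousOn hQ1
    have e4 := hγ.continuousOn hT1
    fun_prop

/-- The transform of `L + P + Q` to zeroth order, where `{L, F} = -Q`. -/
theorem IsOrbit.lie_transform_zero {hp : 0 < p} {hf : Admissible f} {γ : ℝ → H p}
    (hγ : IsOrbit hp hf γ) {L P Q : H p → ℂ} (hL : AnalyticOnNhd ℂ L Set.univ)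
    (hP : AnalyticOnNhd ℂ P Set.univ) (hQ : AnalyticOnNhd ℂ Q Set.univ)
    (hLQ : ∀ z, poisson L (poly f) z = -Q z) :
    L (γ 1) + P (γ 1) + Q (γ 1) = L (γ 0) + P (γ 0) +
      ∫ t in (0 : ℝ)..1, poisson (fun w => P w + (t : ℂ) * Q w) (poly f) (γ t) := by
  have hP1 := poisson_analyticOnNhd hp hf hP
  have hQ1 := poisson_analyticOnNhd hp hf hQ
  have h1 : ∀ t : ℂ, poisson (fun w => P w + t * Q w) (poly f) = fun w =>
      poisson P (poly f) w + t * poisson Q (poly f) w := fun t => by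
    rw [poisson_add hp hf hP (analyticOnNhd_const.mul hQ), poisson_const_mul hp hf t hQ]
  simp only [h1]
  rw [integral_unitInterval_eq_sub (U := fun t => L (γ t) + P (γ t) + t * Q (γ t))]
  · push_cast
    ring
  · intro t ht
    have hi := hasDerivWithinAt_ofReal t (Set.Icc 0 1)
    have hd := ((hγ.hasDerivWithinAt hL ht).add (hγ.hasDerivWithinAt hP ht)).add
      (hi.mul (hγ.hasDerivWithinAt hQ ht))
    refine hd.congr_deriv ?_
    rw [hLQ]
    ring
  · have hi : ContinuousOn (fun t : ℝ => (t : ℂ)) (Set.Icc 0 1) :=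
      Complex.continuous_ofReal.continuousOn
    have e1 := hγ.continuousOn hP1
    have e2 := hγ.continuousOn hQ1
    fun_prop

end LieTransform

/-! ### Homogeneous functions and uniform orders -/

section Order

variable {p : ℝ}

/-- `A` is given by an admissible homogeneous polynomial of degree `m`. -/
def IsHom (m : ℕ) (A : H p → ℂ) : Prop := ∃ c : (Fin m → NZ) → ℂ, Admissible c ∧ A = poly c

theorem IsHom.of_poly {m : ℕ} {c : (Fin m → NZ) → ℂ} (hc : Admissible c) :
    IsHom m (poly c : H p → ℂ) := ⟨c, hc, rfl⟩

theorem IsHom.analyticOnNhd (hp : 0 < p) {m : ℕ} {A : H p → ℂ} (hA : IsHom m A) :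
    AnalyticOnNhd ℂ A Set.univ := by
  obtain ⟨c, hc, rfl⟩ := hA
  exact fun z _ => poly_analyticAt hp hc.bdd z

theorem IsHom.add (hp : 0 < p) {m : ℕ} {A B : H p → ℂ} (hA : IsHom m A) (hB : IsHom m B) :
    IsHom m fun z => A z + B z := by
  obtain ⟨c, hc, rfl⟩ := hA
  obtain ⟨d, hd, rfl⟩ := hB
  exact ⟨_, hc.add hd, funext fun z => (poly_add hp hc.bdd hd.bdd z).symm⟩

theorem IsHom.poisson (hp : 0 < p) {a b : ℕ} {A B : H p → ℂ} (hA : IsHom (a + 1) A)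
    (hB : IsHom (b + 1) B) : IsHom (a + b) (poisson A B) := by
  obtain ⟨c, hc, rfl⟩ := hA
  obtain ⟨d, hd, rfl⟩ := hB
  exact ⟨_, hc.bracket hd, funext fun z => poisson_poly hp hc hd z⟩

theorem IsHom.hasAnalyticField (hp : 0 < p) {m : ℕ} {A : H p → ℂ} (hA : IsHom (m + 1) A) :
    HasAnalyticField (p + 1) A := by
  obtain ⟨c, hc, rfl⟩ := hA
  exact poly_hasAnalyticField hp hc

/-- `I t z` is of order `k` in `z`, uniformly in `0 ≤ t ≤ 1`. -/
def UniformOrder (k : ℕ) (I : ℝ → H p → ℂ) : Prop :=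
  ∃ C : ℝ, 0 ≤ C ∧ ∀ t ∈ Set.Icc (0 : ℝ) 1, ∀ z : H p, ‖z‖ ≤ 1 → ‖I t z‖ ≤ C * ‖z‖ ^ k

theorem IsHom.uniformOrder (hp : 0 < p) {m k : ℕ} (hk : k ≤ m) {A : H p → ℂ} (hA : IsHom m A) :
    UniformOrder k fun _ => A := by
  obtain ⟨c, hc, rfl⟩ := hA
  obtain ⟨C, hC, h⟩ := exists_norm_poly_le hp hc.bdd
  exact ⟨C, hC, fun t _ z hz => (h z).trans
    (mul_le_mul_of_nonneg_left (pow_le_pow_of_le_one (norm_nonneg z) hz hk) hC)⟩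

theorem UniformOrder.add {k : ℕ} {I J : ℝ → H p → ℂ} (hI : UniformOrder k I)
    (hJ : UniformOrder k J) : UniformOrder k fun t z => I t z + J t z := by
  obtain ⟨C, hC, h⟩ := hI
  obtain ⟨C', hC', h'⟩ := hJ
  exact ⟨C + C', add_nonneg hC hC', fun t ht z hz => (norm_add_le _ _).trans
    ((add_le_add (h t ht z hz) (h' t ht z hz)).trans_eq (add_mul _ _ _).symm)⟩

theorem UniformOrder.mul {k : ℕ} {I : ℝ → H p → ℂ} (hI : UniformOrder k I) {a : ℝ → ℂ}
    (ha : Continuous a) : UniformOrder k fun t z => a t * I t z := by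
  obtain ⟨C, hC, h⟩ := hI
  obtain ⟨M, hM⟩ := isCompact_Icc.exists_bound_of_continuousOn (s := Set.Icc (0 : ℝ) 1)
    ha.continuousOn
  refine ⟨|M| * C, by positivity, fun t ht z hz => ?_⟩
  rw [norm_mul, mul_assoc]
  exact mul_le_mul ((hM t ht).trans (le_abs_self M)) (h t ht z hz) (norm_nonneg _) (abs_nonneg M)

/-- The time-uniform linear bound keeps the orbits of small `z` in the unit ball, where the order
estimate applies. -/
theorem UniformOrder.integral_isBigO {k : ℕ} {I : ℝ → H p → ℂ} (hI : UniformOrder k I)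
    {φ : ℝ → H p → H p}
    (hφ : ∃ C : ℝ, ∀ᶠ z in 𝓝 (0 : H p), ∀ t ∈ Set.Icc (0 : ℝ) 1, ‖φ t z‖ ≤ C * ‖z‖) :
    (fun z => ∫ t in (0 : ℝ)..1, I t (φ t z)) =O[𝓝 0] fun z => ‖z‖ ^ k := by
  obtain ⟨C, hC, h⟩ := hI
  obtain ⟨K, hK⟩ := hφ
  have hsmall : ∀ᶠ z in 𝓝 (0 : H p), K * ‖z‖ ≤ 1 := by
    have : Tendsto (fun z : H p => K * ‖z‖) (𝓝 0) (𝓝 (K * ‖(0 : H p)‖)) :=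
      (continuous_const.mul continuous_norm).tendsto 0
    rw [norm_zero, mul_zero] at this
    exact this.eventually (eventually_le_nhds zero_lt_one)
  refine IsBigO.of_bound (C * |K| ^ k) ?_
  filter_upwards [hK, hsmall] with z h1 h2
  have hb : ∀ t ∈ Set.uIoc (0 : ℝ) 1, ‖I t (φ t z)‖ ≤ C * (|K| * ‖z‖) ^ k := by
    intro t ht
    rw [Set.uIoc_of_le zero_le_one] at ht
    have ht' := Set.Ioc_subset_Icc_self ht
    have h3 := h1 t ht'
    refine (h t ht' _ (h3.trans h2)).trans (mul_le_mul_of_nonneg_left ?_ hC)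
    exact pow_le_pow_left₀ (norm_nonneg _)
      (h3.trans (mul_le_mul_of_nonneg_right (le_abs_self K) (norm_nonneg z))) k
  have := intervalIntegral.norm_integral_le_of_norm_le_const hb
  rw [sub_zero, abs_one, mul_one] at this
  refine this.trans_eq ?_
  rw [norm_pow, norm_norm, mul_pow, mul_assoc]

end Order

/-! ### The coefficients of the normal form -/

section Coefficients

theorem poly_eq_add_parts {p : ℝ} (hp : 0 < p) {m : ℕ} {c : (Fin m → NZ) → ℂ} (hc : Bdd c)
    {D P E : Set (Fin m → NZ)} (hE : ∀ j, j ∈ E ↔ j ∉ D) (z : H p) :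
    poly c z = poly (part c (D ∩ P)) z + poly (part c (D \ P)) z + poly (part c E) z := by
  rw [← poly_add hp (hc.part _) (hc.part _),
    ← poly_add hp ((hc.part _).add (hc.part _)) (hc.part _)]
  congr 1
  funext j
  by_cases hD : j ∈ D
  · rw [part_of_notMem (mt (hE j).mp (not_not.mpr hD))]
    by_cases hP : j ∈ P
    · rw [part_of_mem (D := D ∩ P) ⟨hD, hP⟩, part_of_notMem (D := D \ P) fun h => h.2 hP]; simp
    · rw [part_of_notMem (D := D ∩ P) fun h => hP h.2, part_of_mem (D := D \ P) ⟨hD, hP⟩]; simp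
  · rw [part_of_notMem (D := D ∩ P) fun h => hD h.1, part_of_notMem (D := D \ P) fun h => hD h.1,
      part_of_mem ((hE j).mpr hD)]
    simp

theorem mem_of_part_ne_zero {m : ℕ} {c : (Fin m → NZ) → ℂ} (hc : Admissible c)
    {D : Set (Fin m → NZ)} {j : Fin m → NZ} (h : part c D j ≠ 0) : j ∈ D ∧ ∑ i, (j i).1 = 0 := by
  have hD : j ∈ D := by
    by_contra h'
    exact h (part_of_notMem h')
  refine ⟨hD, ?_⟩
  by_contra h'
  exact h ((hc.part D).1 j h')

/-- A polynomial which generates a real symplectic flow: the homological equation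
`{Λ, F} + poly c = 0` is solvable with small divisors bounded below. -/
structure IsGenerator {m : ℕ} (c : (Fin m → NZ) → ℂ) : Prop where
  admissible : Admissible c
  admissible_homol : Admissible (homol c)
  herm_homol : Herm (homol c)
  divisor_ne_zero : ∀ j, c j ≠ 0 → ∑ i, lam (j i) ≠ 0

/-- Symmetry of `D` under `j ↦ -j` preserves reality. Divisors need a bound only at zero momentum,
as the other coefficients vanish. -/
theorem isGenerator_part {m : ℕ} {c : (Fin m → NZ) → ℂ} (hc : Admissible c) (hh : Herm c)
    {D : Set (Fin m → NZ)} (hD : ∀ j, (fun i => opp (j i)) ∈ D ↔ j ∈ D) {κ : ℝ} (hκ : 0 < κ)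
    (h : ∀ j ∈ D, ∑ i, (j i).1 = 0 → κ ≤ |∑ i, lam (j i)|) : IsGenerator (part c D) where
  admissible := hc.part D
  admissible_homol := (hc.part D).homol hκ fun j hj =>
    h j (mem_of_part_ne_zero hc hj).1 (mem_of_part_ne_zero hc hj).2
  herm_homol := (hh.part hD).homol
  divisor_ne_zero j hj h0 := by
    have := h j (mem_of_part_ne_zero hc hj).1 (mem_of_part_ne_zero hc hj).2
    rw [h0, abs_zero] at this
    linarith

theorem opp_mem_outs_inter {n₁ n₂ : ℕ+} {m : ℕ} (P : ℕ → Prop) (j : Fin m → NZ) :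
    (fun i => opp (j i)) ∈ {j | P (outs n₁ n₂ j)} ∩ Paired m ↔
      j ∈ {j | P (outs n₁ n₂ j)} ∩ Paired m :=
  and_congr (by simp only [Set.mem_ofPred_eq, outs_opp]) (paired_opp j)

theorem opp_mem_outs_diff {n₁ n₂ : ℕ+} {m : ℕ} (P : ℕ → Prop) (j : Fin m → NZ) :
    (fun i => opp (j i)) ∈ {j | P (outs n₁ n₂ j)} \ Paired m ↔
      j ∈ {j | P (outs n₁ n₂ j)} \ Paired m :=
  and_congr (by simp only [Set.mem_ofPred_eq, outs_opp]) (not_congr (paired_opp j))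

theorem opp_mem_outs {n₁ n₂ : ℕ+} {m : ℕ} (P : ℕ → Prop) (j : Fin m → NZ) :
    (fun i => opp (j i)) ∈ {j | P (outs n₁ n₂ j)} ↔ j ∈ {j | P (outs n₁ n₂ j)} := by
  simp only [Set.mem_ofPred_eq, outs_opp]

/-- The coefficients of `Ḡ + Ĝ`. -/
def gnfCoeff (n₁ n₂ : ℕ+) (j : Fin 6 → NZ) : ℂ :=
  part gCoeff ({j | outs n₁ n₂ j ≤ 2} ∩ Paired 6) j + part gCoeff {j | 3 ≤ outs n₁ n₂ j} j

variable {n₁ n₂ : ℕ+}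

theorem gnfCoeff_admissible : Admissible (gnfCoeff n₁ n₂) :=
  (gCoeff_admissible.part _).add (gCoeff_admissible.part _)

theorem gnfCoeff_herm : Herm (gnfCoeff n₁ n₂) :=
  (gCoeff_herm.part (opp_mem_outs_inter (· ≤ 2))).add (gCoeff_herm.part (opp_mem_outs (3 ≤ ·)))

theorem gtildeCoeff_herm : Herm (gtildeCoeff n₁ n₂) :=
  gCoeff_herm.part (opp_mem_outs_diff (· ≤ 2))

theorem poly_gnfCoeff {p : ℝ} (hp : 0 < p) (z : H p) :
    poly (gnfCoeff n₁ n₂) z = Gbar n₁ n₂ z + Ghat n₁ n₂ z :=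
  poly_add hp (gCoeff_admissible.part _).bdd (gCoeff_admissible.part _).bdd z

/-- The coefficients of `{a (Ḡ + Ĝ) + b G̃, F}`. -/
def firstBracket (n₁ n₂ : ℕ+) (a b : ℝ) : (Fin 10 → NZ) → ℂ :=
  bracketCoeff (a := 5) (b := 5) (fun j => (a : ℂ) * gnfCoeff n₁ n₂ j + b * gtildeCoeff n₁ n₂ j)
    (homol (gtildeCoeff n₁ n₂))

/-- The coefficients of `{{(Ḡ + Ĝ) / 2 + G̃ / 3, F}, F} + {Ḡ + Ĝ, F'}`, where `F'` has the
coefficients `f`. -/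
def secondBracket (n₁ n₂ : ℕ+) (f : (Fin 10 → NZ) → ℂ) (x : Fin 14 → NZ) : ℂ :=
  bracketCoeff (a := 9) (b := 5) (firstBracket n₁ n₂ (1 / 2) (1 / 3))
      (homol (gtildeCoeff n₁ n₂)) x +
    bracketCoeff (a := 5) (b := 9) (gnfCoeff n₁ n₂) f x

theorem firstBracket_aux_admissible (hg : IsGenerator (gtildeCoeff n₁ n₂)) (a b : ℝ) :
    Admissible fun j => (a : ℂ) * gnfCoeff n₁ n₂ j + b * gtildeCoeff n₁ n₂ j :=
  (gnfCoeff_admissible.const_mul a).add (hg.admissible.const_mul b)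

theorem firstBracket_admissible (hg : IsGenerator (gtildeCoeff n₁ n₂)) (a b : ℝ) :
    Admissible (firstBracket n₁ n₂ a b) :=
  Admissible.bracket (a := 5) (b := 5) (firstBracket_aux_admissible hg a b) hg.admissible_homol

theorem firstBracket_herm (hg : IsGenerator (gtildeCoeff n₁ n₂)) (a b : ℝ) :
    Herm (firstBracket n₁ n₂ a b) :=
  Herm.bracket (a := 5) (b := 5) ((gnfCoeff_herm.const_mul (Complex.conj_ofReal a)).add
    (gtildeCoeff_herm.const_mul (Complex.conj_ofReal b))) hg.herm_homol

theorem secondBracket_admissible (hg : IsGenerator (gtildeCoeff n₁ n₂)) {f : (Fin 10 → NZ) → ℂ}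
    (hf : Admissible f) : Admissible (secondBracket n₁ n₂ f) :=
  (Admissible.bracket (a := 9) (b := 5) (firstBracket_admissible hg _ _) hg.admissible_homol).add
    (Admissible.bracket (a := 5) (b := 9) gnfCoeff_admissible hf)

theorem secondBracket_herm (hg : IsGenerator (gtildeCoeff n₁ n₂)) {f : (Fin 10 → NZ) → ℂ}
    (hf : Herm f) : Herm (secondBracket n₁ n₂ f) :=
  (Herm.bracket (a := 9) (b := 5) (firstBracket_herm hg _ _) hg.herm_homol).add
    (Herm.bracket (a := 5) (b := 9) gnfCoeff_herm hf)

theorem poisson_firstBracket {p : ℝ} (hp : 0 < p) (hg : IsGenerator (gtildeCoeff n₁ n₂))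
    (a b : ℝ) : poisson (fun z : H p => (a : ℂ) * (Gbar n₁ n₂ z + Ghat n₁ n₂ z) +
      b * Gtilde n₁ n₂ z) (F₁ n₁ n₂) = poly (firstBracket n₁ n₂ a b) := by
  funext z
  rw [firstBracket, ← poisson_poly hp (firstBracket_aux_admissible hg a b) hg.admissible_homol]
  congr 1
  funext w
  rw [poly_add hp (gnfCoeff_admissible.const_mul _).bdd (hg.admissible.const_mul _).bdd,
    poly_smul, poly_smul, poly_gnfCoeff hp]
  rfl

theorem order10_eq {p : ℝ} (hp : 0 < p) (hg : IsGenerator (gtildeCoeff n₁ n₂)) :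
    (order10 n₁ n₂ : H p → ℂ) = poly (firstBracket n₁ n₂ 1 (1 / 2)) := by
  rw [← poisson_firstBracket hp hg, order10]
  congr 1
  funext w
  push_cast
  ring

theorem order14_eq {p : ℝ} (hp : 0 < p) (hg : IsGenerator (gtildeCoeff n₁ n₂)) :
    (order14 n₁ n₂ : H p → ℂ) =
      poisson (poly (firstBracket n₁ n₂ (1 / 2) (1 / 3))) (F₁ n₁ n₂) := by
  rw [← poisson_firstBracket hp hg, order14]
  congr 2
  funext w
  push_cast
  ring

theorem poly_secondBracket {p : ℝ} (hp : 0 < p) (hg : IsGenerator (gtildeCoeff n₁ n₂))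
    {f : (Fin 10 → NZ) → ℂ} (hf : Admissible f) (z : H p) :
    order14 n₁ n₂ z + poisson (fun w => Gbar n₁ n₂ w + Ghat n₁ n₂ w) (poly f) z =
      poly (secondBracket n₁ n₂ f) z := by
  have h : (fun w : H p => Gbar n₁ n₂ w + Ghat n₁ n₂ w) = poly (gnfCoeff n₁ n₂) :=
    funext fun w => (poly_gnfCoeff hp w).symm
  rw [order14_eq hp hg, h, F₁]
  have e1 := poisson_poly (a := 9) (b := 5) hp (firstBracket_admissible hg (1 / 2) (1 / 3))
    hg.admissible_homol z
  have e2 := poisson_poly (a := 5) (b := 9) hp (gnfCoeff_admissible (n₁ := n₁) (n₂ := n₂)) hf z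
  rw [e1, e2]
  exact (poly_add hp
    (Admissible.bracket (a := 9) (b := 5) (firstBracket_admissible hg _ _) hg.admissible_homol).bdd
    (Admissible.bracket (a := 5) (b := 9) gnfCoeff_admissible hf).bdd z).symm

theorem ham_eq {p : ℝ} (hp : 0 < p) (z : H p) :
    ham z = Lam z + (Gbar n₁ n₂ z + Ghat n₁ n₂ z) + Gtilde n₁ n₂ z := by
  have h := poly_eq_add_parts hp gCoeff_admissible.bdd (D := {j | outs n₁ n₂ j ≤ 2})
    (P := Paired 6) (E := {j | 3 ≤ outs n₁ n₂ j})
    (fun j => by simp only [Set.mem_ofPred_eq]; omega) z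
  rw [ham, h, Gbar, Ghat, Gtilde, gtildeCoeff]
  ring

end Coefficients

/-! ### The normal form -/

section NormalForm

variable {p : ℝ}

theorem IsGenerator.exists_flow (hp : 0 < p) {m : ℕ} (hm : 2 ≤ m) {c : (Fin (m + 1) → NZ) → ℂ}
    (hc : IsGenerator c) :
    ∃ φ : ℝ → H p → H p, IsFlow (poly (homol c)) φ ∧ IsSympTransf (p + 1) (φ 1) ∧
      (∀ᶠ z in 𝓝 (0 : H p), φ 0 z = z ∧ IsOrbit hp hc.admissible_homol fun t => φ t z) ∧
      ∃ C : ℝ, ∀ᶠ z in 𝓝 (0 : H p), ∀ t ∈ Set.Icc (0 : ℝ) 1, ‖φ t z‖ ≤ C * ‖z‖ :=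
  exists_hamFlow hp hm hc.admissible_homol hc.herm_homol

theorem Lam_isHom (hp : 0 < p) : IsHom 2 (Lam : H p → ℂ) :=
  ⟨lamCoeff, lamCoeff_admissible, Lam_eq_poly hp⟩

theorem isBigO_norm_pow_comp {g : H p → ℂ} {Φ : H p → H p} {k : ℕ}
    (hg : g =O[𝓝 0] fun z => ‖z‖ ^ k) (hΦ : Tendsto Φ (𝓝 0) (𝓝 0))
    (hC : ∃ C : ℝ, ∀ᶠ z in 𝓝 (0 : H p), ‖Φ z‖ ≤ C * ‖z‖) :
    (fun z => g (Φ z)) =O[𝓝 0] fun z => ‖z‖ ^ k := by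
  obtain ⟨C, hC⟩ := hC
  refine (hg.comp_tendsto hΦ).trans ?_
  have h : (fun z => ‖Φ z‖) =O[𝓝 0] fun z : H p => ‖z‖ := by
    refine IsBigO.of_bound C ?_
    simpa only [norm_norm] using hC
  exact h.pow k

variable {n₁ n₂ : ℕ+}

theorem remainder₁_isBigO (hp : 0 < p) (hg : IsGenerator (gtildeCoeff n₁ n₂))
    {φ : ℝ → H p → H p}
    (hφ : ∃ C : ℝ, ∀ᶠ z in 𝓝 (0 : H p), ∀ t ∈ Set.Icc (0 : ℝ) 1, ‖φ t z‖ ≤ C * ‖z‖) :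
    remainder₁ n₁ n₂ φ =O[𝓝 0] fun z => ‖z‖ ^ 18 := by
  have hf : IsHom (5 + 1) (poly (homol (gtildeCoeff n₁ n₂)) : H p → ℂ) :=
    .of_poly hg.admissible_homol
  have hB : IsHom (5 + 1) (fun z : H p => Gbar n₁ n₂ z + Ghat n₁ n₂ z) :=
    IsHom.add hp (.of_poly (gCoeff_admissible.part _)) (.of_poly (gCoeff_admissible.part _))
  have hQ : IsHom (5 + 1) (Gtilde n₁ n₂ : H p → ℂ) := .of_poly hg.admissible
  -- Degrees `a + 1` and `b + 1` bracket to `a + b`; brackets with `F` give `6, 10, 14, 18`, written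
  -- as successors so that the rule applies again.
  have hB1 : IsHom (9 + 1) _ := hB.poisson hp hf
  have hB2 : IsHom (13 + 1) _ := hB1.poisson hp hf
  have hB3 : IsHom 18 _ := hB2.poisson hp hf
  have hQ1 : IsHom (9 + 1) _ := hQ.poisson hp hf
  have hQ2 : IsHom (13 + 1) _ := hQ1.poisson hp hf
  have hQ3 : IsHom 18 _ := hQ2.poisson hp hf
  have hU := ((hB3.uniformOrder hp le_rfl).mul (a := fun t => 1 / 2 * ((t : ℂ) - 1) ^ 2)
    (by fun_prop)).add ((hQ3.uniformOrder hp le_rfl).mul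
    (a := fun t => 1 / 6 * ((t : ℂ) ^ 3 - 3 * t + 2)) (by fun_prop))
  have hadm := hg.admissible_homol
  refine (hU.integral_isBigO hφ).congr_left fun z => ?_
  simp only [remainder₁, F₁,
    poisson_combination hp hadm _ _ (hB.analyticOnNhd hp) (hQ.analyticOnNhd hp),
    poisson_combination hp hadm _ _ (hB1.analyticOnNhd hp) (hQ1.analyticOnNhd hp),
    poisson_combination hp hadm _ _ (hB2.analyticOnNhd hp) (hQ2.analyticOnNhd hp)]

/-- The part independent of how the splittings arise: two decompositions and three generators give
the transformations and `W` with both of its descriptions. -/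
theorem exists_normal_form (hp : 0 < p) (hg : IsGenerator (gtildeCoeff n₁ n₂))
    {rTilde rHat : (Fin 10 → NZ) → ℂ} {tTilde tHat : (Fin 14 → NZ) → ℂ}
    (hr : IsGenerator rTilde) (hrHat : Admissible rHat) (ht : IsGenerator tTilde)
    (htHat : Admissible tHat) {Rbar Tbar : H p → ℂ} (hRbar : IsHom 10 Rbar) (hTbar : IsHom 14 Tbar)
    (h10 : ∀ z : H p, order10 n₁ n₂ z = Rbar z + poly rTilde z + poly rHat z)
    (h14 : ∀ z : H p, order14 n₁ n₂ z +
      poisson (fun w => Gbar n₁ n₂ w + Ghat n₁ n₂ w) (poly (homol rTilde)) z =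
        Tbar z + poly tTilde z + poly tHat z) :
    ∃ (φ₁ φ₂ φ₃ : ℝ → H p → H p) (W : H p → ℂ),
      IsFlow (F₁ n₁ n₂) φ₁ ∧ IsSympTransf (p + 1) (φ₁ 1) ∧
      IsFlow (poly (homol rTilde)) φ₂ ∧ IsSympTransf (p + 1) (φ₂ 1) ∧
      IsFlow (poly (homol tTilde)) φ₃ ∧ IsSympTransf (p + 1) (φ₃ 1) ∧
      (∀ z, ham (φ₁ 1 (φ₂ 1 (φ₃ 1 z))) = Lam z + Gbar n₁ n₂ z + Ghat n₁ n₂ z + Rbar z +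
        poly rHat z + Tbar z + poly tHat z + W z) ∧
      (∀ᶠ z in 𝓝 (0 : H p), W z = remainder₁ n₁ n₂ φ₁ (φ₂ 1 (φ₃ 1 z)) +
        (∫ t in (0 : ℝ)..1, ((1 - (t : ℂ)) *
          poisson (poisson (fun w => Gbar n₁ n₂ w + Ghat n₁ n₂ w) (poly (homol rTilde)))
            (poly (homol rTilde)) (φ₂ t (φ₃ 1 z)) +
          poisson (fun w => Rbar w + poly rHat w + (t : ℂ) * poly rTilde w + order14 n₁ n₂ w)
            (poly (homol rTilde)) (φ₂ t (φ₃ 1 z)))) +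
        ∫ t in (0 : ℝ)..1, poisson (fun w => Gbar n₁ n₂ w + Ghat n₁ n₂ w + Rbar w + poly rHat w +
          Tbar w + poly tHat w + (t : ℂ) * poly tTilde w) (poly (homol tTilde)) (φ₃ t z)) ∧
      W =O[𝓝 0] (fun z => ‖z‖ ^ 18) ∧ HasAnalyticField (p + 1) W := by
  obtain ⟨φ₁, hf₁, hs₁, ho₁, hb₁⟩ := IsGenerator.exists_flow hp (m := 5) (by norm_num) hg
  obtain ⟨φ₂, hf₂, hs₂, ho₂, hb₂⟩ := IsGenerator.exists_flow hp (m := 9) (by norm_num) hr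
  obtain ⟨φ₃, hf₃, hs₃, ho₃, hb₃⟩ := IsGenerator.exists_flow hp (m := 13) (by norm_num) ht
  have hpq : p ≤ p + 1 := by linarith
  have ht₂ := hs₂.tendsto hpq
  have ht₃ := hs₃.tendsto hpq
  have hL := Lam_isHom hp
  have hG₁ : IsHom (5 + 1) (Gbar n₁ n₂ : H p → ℂ) := .of_poly (gCoeff_admissible.part _)
  have hG₂ : IsHom (5 + 1) (Ghat n₁ n₂ : H p → ℂ) := .of_poly (gCoeff_admissible.part _)
  have hB : IsHom (5 + 1) (fun z : H p => Gbar n₁ n₂ z + Ghat n₁ n₂ z) := hG₁.add hp hG₂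
  have hQ : IsHom (5 + 1) (Gtilde n₁ n₂ : H p → ℂ) := .of_poly hg.admissible
  have hR : IsHom (9 + 1) (fun z => Rbar z + poly rHat z) := hRbar.add hp (.of_poly hrHat)
  have hRt : IsHom (9 + 1) (poly rTilde : H p → ℂ) := .of_poly hr.admissible
  have hT : IsHom (13 + 1) (fun z => Tbar z + poly tHat z) := hTbar.add hp (.of_poly htHat)
  have hTt : IsHom (13 + 1) (poly tTilde : H p → ℂ) := .of_poly ht.admissible
  have h14h : IsHom (13 + 1) (order14 n₁ n₂ : H p → ℂ) := by
    rw [order14_eq hp hg]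
    exact IsHom.poisson (a := 9) (b := 5) hp (.of_poly (firstBracket_admissible hg _ _))
      (.of_poly hg.admissible_homol)
  have hPan : AnalyticOnNhd ℂ (fun w : H p => Gbar n₁ n₂ w + Ghat n₁ n₂ w + Rbar w + poly rHat w +
      Tbar w + poly tHat w) Set.univ :=
    (((hB.analyticOnNhd hp).add (hRbar.analyticOnNhd hp)).add
      ((IsHom.of_poly hrHat).analyticOnNhd hp)).add (hTbar.analyticOnNhd hp) |>.add
      ((IsHom.of_poly htHat).analyticOnNhd hp)
  -- the three transformations of the Hamiltonian
  have e₁ : ∀ᶠ z in 𝓝 (0 : H p), ham (φ₁ 1 z) = Lam z + (Gbar n₁ n₂ z + Ghat n₁ n₂ z) +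
      order10 n₁ n₂ z + order14 n₁ n₂ z + remainder₁ n₁ n₂ φ₁ z := by
    filter_upwards [ho₁] with z hz
    have h := hz.2.lie_transform_two (hL.analyticOnNhd hp) (hB.analyticOnNhd hp)
      (hQ.analyticOnNhd hp) (poisson_Lam_homol hp hg.admissible_homol hg.divisor_ne_zero)
    simp only [hz.1] at h
    rw [ham_eq (n₁ := n₁) (n₂ := n₂) hp]
    exact h
  have e₂ : ∀ᶠ z in 𝓝 (0 : H p), _ := ho₂.mono fun z hz =>
    hz.2.lie_transform_one (hL.analyticOnNhd hp) (hB.analyticOnNhd hp) (hR.analyticOnNhd hp)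
      (hRt.analyticOnNhd hp) (h14h.analyticOnNhd hp)
      (poisson_Lam_homol hp hr.admissible_homol hr.divisor_ne_zero)
  have e₃ : ∀ᶠ z in 𝓝 (0 : H p), _ := ho₃.mono fun z hz =>
    hz.2.lie_transform_zero (hL.analyticOnNhd hp) hPan (hTt.analyticOnNhd hp)
      (poisson_Lam_homol hp ht.admissible_homol ht.divisor_ne_zero)
  -- With this definition the normal form holds for every `z`; the content is the integral formula
  -- `hrem`, valid near the origin.
  set W : H p → ℂ := fun z => ham (φ₁ 1 (φ₂ 1 (φ₃ 1 z))) -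
    (Lam z + (Gbar n₁ n₂ z + Ghat n₁ n₂ z) + (Rbar z + poly rHat z) + (Tbar z + poly tHat z))
    with hW
  have hrem : ∀ᶠ z in 𝓝 (0 : H p), W z = remainder₁ n₁ n₂ φ₁ (φ₂ 1 (φ₃ 1 z)) +
      (∫ t in (0 : ℝ)..1, ((1 - (t : ℂ)) *
        poisson (poisson (fun w => Gbar n₁ n₂ w + Ghat n₁ n₂ w) (poly (homol rTilde)))
          (poly (homol rTilde)) (φ₂ t (φ₃ 1 z)) +
        poisson (fun w => Rbar w + poly rHat w + (t : ℂ) * poly rTilde w + order14 n₁ n₂ w)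
          (poly (homol rTilde)) (φ₂ t (φ₃ 1 z)))) +
      ∫ t in (0 : ℝ)..1, poisson (fun w => Gbar n₁ n₂ w + Ghat n₁ n₂ w + Rbar w + poly rHat w +
        Tbar w + poly tHat w + (t : ℂ) * poly tTilde w) (poly (homol tTilde)) (φ₃ t z) := by
    filter_upwards [(ht₂.comp ht₃).eventually e₁, ht₃.eventually (e₂.and ho₂), e₃.and ho₃]
      with z h1 h2 h3
    obtain ⟨h2, h2', -⟩ := h2
    obtain ⟨h3, h3', -⟩ := h3
    simp only [Function.comp_apply] at h1
    simp only [h2'] at h2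
    simp only [h3'] at h3
    rw [h10] at h1
    have h4 := h14 (φ₃ 1 z)
    simp only [hW]
    linear_combination h1 + h2 + h3 + h4
  refine ⟨φ₁, φ₂, φ₃, W, hf₁, hs₁, hf₂, hs₂, hf₃, hs₃, fun z => by simp only [hW]; ring, hrem,
    ?_, ?_⟩
  · have hadm₂ := hr.admissible_homol
    have hadm₃ := ht.admissible_homol
    have hf₂ : IsHom (9 + 1) (poly (homol rTilde) : H p → ℂ) := .of_poly hadm₂
    have hf₃ : IsHom (13 + 1) (poly (homol tTilde) : H p → ℂ) := .of_poly hadm₃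
    have hat1 : ∀ {φ : ℝ → H p → H p}, (∃ C : ℝ, ∀ᶠ z in 𝓝 (0 : H p), ∀ t ∈ Set.Icc (0 : ℝ) 1,
        ‖φ t z‖ ≤ C * ‖z‖) → ∃ C : ℝ, ∀ᶠ z in 𝓝 (0 : H p), ‖φ 1 z‖ ≤ C * ‖z‖ :=
      fun ⟨C, h⟩ => ⟨C, h.mono fun z hz => hz 1 ⟨zero_le_one, le_rfl⟩⟩
    have o₁ := isBigO_norm_pow_comp (isBigO_norm_pow_comp (remainder₁_isBigO hp hg hb₁) ht₂
      (hat1 hb₂)) ht₃ (hat1 hb₃)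
    have hB1 : IsHom (13 + 1) _ := hB.poisson hp hf₂
    have hB2 : IsHom 22 _ := hB1.poisson hp hf₂
    have hR1 : IsHom 18 _ := hR.poisson hp hf₂
    have hRt1 : IsHom 18 _ := hRt.poisson hp hf₂
    have hO1 : IsHom 22 _ := h14h.poisson hp hf₂
    have hU₂ := ((hB2.uniformOrder hp (k := 18) (by norm_num)).mul (a := fun t => 1 - (t : ℂ))
      (by fun_prop)).add (((hR1.uniformOrder hp le_rfl).add ((hRt1.uniformOrder hp le_rfl).mul
      (a := fun t => (t : ℂ)) (by fun_prop))).add (hO1.uniformOrder hp (by norm_num)))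
    have o₂ := isBigO_norm_pow_comp (hU₂.integral_isBigO hb₂) ht₃ (hat1 hb₃)
    have hB1' : IsHom 18 _ := hB.poisson hp hf₃
    have hR1' : IsHom 22 _ := hR.poisson hp hf₃
    have hT1' : IsHom 26 _ := hT.poisson hp hf₃
    have hTt1' : IsHom 26 _ := hTt.poisson hp hf₃
    have hU₃ := (((hB1'.uniformOrder hp (k := 18) le_rfl).add
      (hR1'.uniformOrder hp (by norm_num))).add (hT1'.uniformOrder hp (by norm_num))).add
      ((hTt1'.uniformOrder hp (by norm_num)).mul (a := fun t => (t : ℂ)) (by fun_prop))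
    have o₃ := hU₃.integral_isBigO hb₃
    refine ((o₁.add o₂).add o₃).congr' ?_ EventuallyEq.rfl
    -- Brackets are split by linearity because their summands have different degrees, all at least
    -- `18`.
    have p₂ : ∀ t : ℂ, poisson (fun w : H p => Rbar w + poly rHat w + t * poly rTilde w +
        order14 n₁ n₂ w) (poly (homol rTilde)) = fun w =>
        poisson (fun w => Rbar w + poly rHat w) (poly (homol rTilde)) w +
          t * poisson (poly rTilde) (poly (homol rTilde)) w +
          poisson (order14 n₁ n₂) (poly (homol rTilde)) w := fun t => by
      have a1 := hR.analyticOnNhd hp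
      have a2 := hRt.analyticOnNhd hp
      rw [poisson_add (m := 9) hp hadm₂ (A := fun w => Rbar w + poly rHat w + t * poly rTilde w)
          (a1.add (analyticOnNhd_const.mul a2)) (h14h.analyticOnNhd hp),
        poisson_add (m := 9) hp hadm₂ (A := fun w => Rbar w + poly rHat w) a1
          (analyticOnNhd_const.mul a2), poisson_const_mul (m := 9) hp hadm₂ t a2]
    have p₃ : ∀ t : ℂ, poisson (fun w : H p => Gbar n₁ n₂ w + Ghat n₁ n₂ w + Rbar w +
        poly rHat w + Tbar w + poly tHat w + t * poly tTilde w) (poly (homol tTilde)) = fun w =>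
        poisson (fun w => Gbar n₁ n₂ w + Ghat n₁ n₂ w) (poly (homol tTilde)) w +
          poisson (fun w => Rbar w + poly rHat w) (poly (homol tTilde)) w +
          poisson (fun w => Tbar w + poly tHat w) (poly (homol tTilde)) w +
          t * poisson (poly tTilde) (poly (homol tTilde)) w := fun t => by
      have a0 := hB.analyticOnNhd hp
      have a1 := hR.analyticOnNhd hp
      have a2 := hT.analyticOnNhd hp
      have a3 := hTt.analyticOnNhd hp
      have e : (fun w : H p => Gbar n₁ n₂ w + Ghat n₁ n₂ w + Rbar w + poly rHat w + Tbar w +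
          poly tHat w + t * poly tTilde w) = fun w => (Gbar n₁ n₂ w + Ghat n₁ n₂ w) +
          (Rbar w + poly rHat w) + (Tbar w + poly tHat w) + t * poly tTilde w := by
        funext w; ring
      rw [e, poisson_add (m := 13) hp hadm₃ (A := fun w => (Gbar n₁ n₂ w + Ghat n₁ n₂ w) +
          (Rbar w + poly rHat w) + (Tbar w + poly tHat w)) ((a0.add a1).add a2)
          (analyticOnNhd_const.mul a3),
        poisson_add (m := 13) hp hadm₃ (A := fun w => (Gbar n₁ n₂ w + Ghat n₁ n₂ w) +
          (Rbar w + poly rHat w)) (a0.add a1) a2,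
        poisson_add (m := 13) hp hadm₃ (A := fun w => Gbar n₁ n₂ w + Ghat n₁ n₂ w) a0 a1,
        poisson_const_mul (m := 13) hp hadm₃ t a3]
    filter_upwards [hrem] with z hz
    rw [hz]
    simp only [p₂, p₃]
  -- The field is read off from the difference: a threefold composition of `ham` minus polynomials.
  -- No differentiation of the integrals is needed.
  · have hham : AnalyticAt ℂ (ham : H p → ℂ) 0 :=
      (hL.analyticOnNhd hp 0 trivial).add (poly_analyticAt hp gCoeff_admissible.bdd 0)
    have hhamX : HasAnalyticField (p + 1) (ham : H p → ℂ) :=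
      HasAnalyticField.add (hL.analyticOnNhd hp 0 trivial)
        (poly_analyticAt hp gCoeff_admissible.bdd 0) (IsHom.hasAnalyticField (m := 1) hp hL)
        (poly_hasAnalyticField (m := 5) hp gCoeff_admissible)
    have c₁ : AnalyticAt ℂ (fun z => ham (φ₁ 1 z)) 0 :=
      AnalyticAt.comp (g := ham) (by rwa [hs₁.map_zero]) (hs₁.analyticAt hpq)
    have c₂ : AnalyticAt ℂ (fun z => ham (φ₁ 1 (φ₂ 1 z))) 0 :=
      AnalyticAt.comp (g := fun z => ham (φ₁ 1 z)) (by rwa [hs₂.map_zero]) (hs₂.analyticAt hpq)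
    have c₃ : AnalyticAt ℂ (fun z => ham (φ₁ 1 (φ₂ 1 (φ₃ 1 z)))) 0 :=
      AnalyticAt.comp (g := fun z => ham (φ₁ 1 (φ₂ 1 z))) (by rwa [hs₃.map_zero])
        (hs₃.analyticAt hpq)
    have x₁ := HasAnalyticField.comp hpq hham hhamX hs₁
    have x₂ := HasAnalyticField.comp hpq c₁ x₁ hs₂
    have x₃ := HasAnalyticField.comp hpq c₂ x₂ hs₃
    have a0 := hL.analyticOnNhd hp 0 trivial
    have a1 := hB.analyticOnNhd hp 0 trivial
    have a2 := hR.analyticOnNhd hp 0 trivial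
    have a3 := hT.analyticOnNhd hp 0 trivial
    exact HasAnalyticField.sub c₃ (((a0.add a1).add a2).add a3) x₃
      (HasAnalyticField.add ((a0.add a1).add a2) a3 (HasAnalyticField.add (a0.add a1) a2
        (HasAnalyticField.add a0 a1 (IsHom.hasAnalyticField (m := 1) hp hL)
          (hB.hasAnalyticField hp)) (hR.hasAnalyticField hp)) (hT.hasAnalyticField hp))

end NormalForm

end GBBM

end

/-! ### ### Choice of `n₁`, `n₂` and of the splittings -/

theorem proposition3p6 :
    ∃ N₁ : ℕ+, ∀ n₁ ≥ N₁, ∃ N₂ : ℕ+, ∀ n₂ ≥ N₂,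
    ∃ (r : Fin 6 → ℝ) (τ : Fin 8 → ℝ)
      (rTilde rHat : (Fin 10 → GBBM.NZ) → ℂ) (tTilde tHat : (Fin 14 → GBBM.NZ) → ℂ),
      GBBM.Admissible rTilde ∧
      GBBM.SuppIn rTilde ({j | GBBM.outs n₁ n₂ j ≤ 1} \ GBBM.Paired 10) ∧
      GBBM.Admissible rHat ∧ GBBM.SuppIn rHat {j | 2 ≤ GBBM.outs n₁ n₂ j} ∧
      GBBM.Admissible tTilde ∧
      GBBM.SuppIn tTilde ({j | GBBM.outs n₁ n₂ j = 0} \ GBBM.Paired 14) ∧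
      GBBM.Admissible tHat ∧ GBBM.SuppIn tHat {j | 1 ≤ GBBM.outs n₁ n₂ j} ∧
      ∀ p : ℝ, 0 < p →
        let Gbar : GBBM.H p → ℂ := GBBM.Gbar n₁ n₂
        let Ghat : GBBM.H p → ℂ := GBBM.Ghat n₁ n₂
        let Rbar : GBBM.H p → ℂ := GBBM.actionPoly n₁ n₂ r
        let Rtilde : GBBM.H p → ℂ := GBBM.poly rTilde
        let Rhat : GBBM.H p → ℂ := GBBM.poly rHat
        let Tbar : GBBM.H p → ℂ := GBBM.actionPoly n₁ n₂ τ
        let Ttilde : GBBM.H p → ℂ := GBBM.poly tTilde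
        let That : GBBM.H p → ℂ := GBBM.poly tHat
        let F₂ : GBBM.H p → ℂ := GBBM.poly (GBBM.homol rTilde)
        let F₃ : GBBM.H p → ℂ := GBBM.poly (GBBM.homol tTilde)
        -- the splittings of the terms of order 10 and 14
        (∀ z : GBBM.H p, GBBM.order10 n₁ n₂ z = Rbar z + Rtilde z + Rhat z) ∧
        (∀ z : GBBM.H p,
          GBBM.order14 n₁ n₂ z + GBBM.poisson (fun w => Gbar w + Ghat w) F₂ z =
            Tbar z + Ttilde z + That z) ∧
        -- the transformations are the time-one maps of Hamiltonian flows
        ∃ (φ₁ φ₂ φ₃ : ℝ → GBBM.H p → GBBM.H p) (W : GBBM.H p → ℂ),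
          GBBM.IsFlow (GBBM.F₁ n₁ n₂) φ₁ ∧ GBBM.IsSympTransf (p + 1) (φ₁ 1) ∧
          GBBM.IsFlow F₂ φ₂ ∧ GBBM.IsSympTransf (p + 1) (φ₂ 1) ∧
          GBBM.IsFlow F₃ φ₃ ∧ GBBM.IsSympTransf (p + 1) (φ₃ 1) ∧
          -- the normal form
          (∀ᶠ z in 𝓝 (0 : GBBM.H p),
            GBBM.ham (φ₁ 1 (φ₂ 1 (φ₃ 1 z))) =
              GBBM.Lam z + Gbar z + Ghat z + Rbar z + Rhat z + Tbar z + That z + W z) ∧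
          -- the remainder
          (∀ᶠ z in 𝓝 (0 : GBBM.H p),
            W z = GBBM.remainder₁ n₁ n₂ φ₁ (φ₂ 1 (φ₃ 1 z)) +
              (∫ t in (0 : ℝ)..1,
                ((1 - (t : ℂ)) *
                    GBBM.poisson (GBBM.poisson (fun w => Gbar w + Ghat w) F₂) F₂
                      (φ₂ t (φ₃ 1 z)) +
                  GBBM.poisson
                    (fun w => Rbar w + Rhat w + (t : ℂ) * Rtilde w + GBBM.order14 n₁ n₂ w) F₂
                      (φ₂ t (φ₃ 1 z)))) +
              ∫ t in (0 : ℝ)..1,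
                GBBM.poisson
                  (fun w => Gbar w + Ghat w + Rbar w + Rhat w + Tbar w + That w +
                    (t : ℂ) * Ttilde w) F₃ (φ₃ t z)) ∧
          -- the estimates
          Ghat =O[𝓝 0] (fun z => ‖z‖ ^ 3 * GBBM.hatNorm n₁ n₂ z ^ 3) ∧
          Rhat =O[𝓝 0] (fun z => ‖z‖ ^ 8 * GBBM.hatNorm n₁ n₂ z ^ 2) ∧
          That =O[𝓝 0] (fun z => ‖z‖ ^ 13 * GBBM.hatNorm n₁ n₂ z) ∧
          W =O[𝓝 0] (fun z => ‖z‖ ^ 18) ∧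
          -- the vector fields
          GBBM.HasAnalyticField (p + 1) Gbar ∧ GBBM.HasAnalyticField (p + 1) Ghat ∧
          GBBM.HasAnalyticField (p + 1) Rbar ∧ GBBM.HasAnalyticField (p + 1) Rhat ∧
          GBBM.HasAnalyticField (p + 1) Tbar ∧ GBBM.HasAnalyticField (p + 1) That ∧
          GBBM.HasAnalyticField (p + 1) W := by
  open GBBM in
  (
    -- `30` is the threshold at which the discriminants are caught between consecutive squares.
    refine ⟨30, fun n₁ hn₁ => ?_⟩
    obtain ⟨N, hN⟩ := exists_divisor_bound_outs_le_two (n₁ := n₁) (by exact_mod_cast hn₁)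
    refine ⟨⟨max N (40 * n₁) + 1, Nat.succ_pos _⟩, fun n₂ hn₂ => ?_⟩
    have hn₂' : max N (40 * n₁) + 1 ≤ (n₂ : ℕ) := hn₂
    have h40 : 40 * (n₁ : ℕ) ≤ n₂ := by omega
    have hn : n₁ ≠ n₂ := by
      rintro rfl
      have := n₁.pos
      omega
    obtain ⟨κ₆, hκ₆, hdiv₆⟩ := hN n₂ (by omega)
    obtain ⟨κ₁₀, hκ₁₀, hdiv₁₀⟩ := exists_divisor_bound_outs_le_one h40
    have hg : IsGenerator (gtildeCoeff n₁ n₂) :=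
      isGenerator_part gCoeff_admissible gCoeff_herm (opp_mem_outs_diff (· ≤ 2)) hκ₆
        fun j hj hs => hdiv₆ j hj.1 hj.2 hs
    set e := firstBracket n₁ n₂ 1 (1 / 2) with he
    have hea : Admissible e := firstBracket_admissible hg _ _
    have heh : Herm e := firstBracket_herm hg _ _
    set rTilde := part e ({j | outs n₁ n₂ j ≤ 1} \ Paired 10) with hrT
    have hr : IsGenerator rTilde :=
      isGenerator_part hea heh (opp_mem_outs_diff (· ≤ 1)) hκ₁₀
        fun j hj hs => hdiv₁₀ 5 (by norm_num) j hj.1 hj.2 hs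
    set g := secondBracket n₁ n₂ (homol rTilde) with hgdef
    have hga : Admissible g := secondBracket_admissible hg hr.admissible_homol
    have hgh : Herm g := secondBracket_herm hg hr.herm_homol
    -- Zero momentum with all indices in `S` forces pairing, so this part has no nonzero coefficient
    -- and any lower bound, here one, holds vacuously.
    have ht : IsGenerator (part g ({j | outs n₁ n₂ j = 0} \ Paired 14)) :=
      isGenerator_part hga hgh (opp_mem_outs_diff (· = 0)) zero_lt_one
        fun j hj hs => absurd (paired_of_outs_eq_zero (k := 7) h40 (by norm_num) hj.1 hs) hj.2
    -- A paired tuple with at most one index outside `S` has none, so the resonant part of degree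
    -- ten involves only the actions of `n₁` and `n₂`.
    obtain ⟨r, hrbar⟩ := exists_actionPoly hn 5 heh (D := {j | outs n₁ n₂ j ≤ 1} ∩ Paired 10)
      fun j => ⟨fun h => ⟨outs_eq_zero_of_paired (by decide) h.2 h.1, h.2⟩,
        fun h => ⟨h.1.le.trans zero_le_one, h.2⟩⟩
    obtain ⟨τ, hτbar⟩ := exists_actionPoly hn 7 hgh (D := {j | outs n₁ n₂ j = 0} ∩ Paired 14)
      fun j => Iff.rfl
    refine ⟨r, τ, rTilde, part e {j | 2 ≤ outs n₁ n₂ j},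
      part g ({j | outs n₁ n₂ j = 0} \ Paired 14), part g {j | 1 ≤ outs n₁ n₂ j},
      hr.admissible, part_suppIn _ _, hea.part _, part_suppIn _ _, ht.admissible, part_suppIn _ _,
      hga.part _, part_suppIn _ _, ?_⟩
    intro p hp Gbar Ghat Rbar Rtilde Rhat Tbar Ttilde That F₂ F₃
    have hR : Rbar = poly (part e ({j | outs n₁ n₂ j ≤ 1} ∩ Paired 10)) := funext (hrbar p)
    have hT : Tbar = poly (part g ({j | outs n₁ n₂ j = 0} ∩ Paired 14)) := funext (hτbar p)
    have hRhom : IsHom 10 Rbar := ⟨_, hea.part _, hR⟩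
    have hThom : IsHom 14 Tbar := ⟨_, hga.part _, hT⟩
    have h10 : ∀ z : H p, order10 n₁ n₂ z = Rbar z + Rtilde z + Rhat z := fun z => by
      rw [order10_eq hp hg, hR]
      exact poly_eq_add_parts hp hea.bdd (fun j => by simp only [Set.mem_ofPred_eq]; omega) z
    have h14 : ∀ z : H p, order14 n₁ n₂ z + poisson (fun w => Gbar w + Ghat w) F₂ z =
        Tbar z + Ttilde z + That z := fun z => by
      rw [hT]
      exact (poly_secondBracket hp hg hr.admissible_homol z).trans
        (poly_eq_add_parts hp hga.bdd (fun j => by simp only [Set.mem_ofPred_eq]; omega) z)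
    obtain ⟨φ₁, φ₂, φ₃, W, hf₁, hs₁, hf₂, hs₂, hf₃, hs₃, hnf, hrem, hWO, hWX⟩ :=
      exists_normal_form hp hg hr (hea.part _) ht (hga.part _) hRhom hThom h10 h14
    refine ⟨h10, h14, φ₁, φ₂, φ₃, W, hf₁, hs₁, hf₂, hs₂, hf₃, hs₃, Eventually.of_forall hnf, hrem,
      ?_, ?_, ?_, hWO, ?_, ?_, hRhom.hasAnalyticField (m := 9) hp, ?_,
      hThom.hasAnalyticField (m := 13) hp, ?_, hWX⟩
    · exact exists_norm_poly_le_hat hp n₁ n₂ (m := 6) (k := 3) (by norm_num)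
        (gCoeff_admissible.part _).bdd (part_suppIn _ _)
    · exact exists_norm_poly_le_hat hp n₁ n₂ (m := 10) (k := 2) (by norm_num)
        (hea.part _).bdd (part_suppIn _ _)
    · have h := exists_norm_poly_le_hat hp n₁ n₂ (m := 14) (k := 1) (by norm_num)
        (hga.part {j | 1 ≤ outs n₁ n₂ j}).bdd (part_suppIn _ _)
      simpa only [pow_one] using h
    · exact poly_hasAnalyticField (m := 5) hp (gCoeff_admissible.part _)
    · exact poly_hasAnalyticField (m := 5) hp (gCoeff_admissible.part _)
    · exact poly_hasAnalyticField (m := 9) hp (hea.part _)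
    · exact poly_hasAnalyticField (m := 13) hp (hga.part _))
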